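/- \textbf{Setting.} A firm has an unobserved type $D\in\{1,\dots,J\}$, $J$ known, with $\pi^j=\Pr(D=j)>0$; $E^j$ and $g^j$ denote expectations and densities conditional on $D=j$. In periods $t=1,\dots,T$, for type $j$, $$Y_t=e^{\omega_t+\epsilon_t}F_t^j(K_t,M_t,L_t),\quad \omega_t=h_t^j(\omega_{t-1})+\eta_t\ (t\ge 2),\quad L_t=e^{\psi_t^j}\widetilde L_t,\quad B_t=e^{v_t+\zeta_t}P_{L,t}L_t ,$$ where $Y_t$ is output, $K_t$ capital, $M_t$ intermediate input, $\widetilde L_t$ the number of workers, $L_t$ labor in effective units, and $B_t$ the wage bill. The prices $P_{M,t},P_{Y,t}>0$ are known and $P_{L,t}>0$ is not; all are common to all firms. Let $\boldsymbol Z_t=(S^m_t,S^\ell_t,K_t,M_t,\widetilde L_t)$ with $S^m_t=P_{M,t}M_t/(P_{Y,t}Y_t)$ and $S^\ell_t=B_t/(P_{Y,t}Y_t)$. For every type its support is $\mathcal Z_t=\mathcal S_t\times\mathcal K_t\times\mathcal M_t\times\widetilde{\mathcal L}_t$, where $\mathcal S_t\subset(0,\infty)^2$ and $\mathcal K_t,\mathcal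 M_t,\widetilde{\mathcal L}_t\subset(0,\infty)$ are open, connected and nonempty; put $\mathcal L_t^j=e^{\psi_t^j}\widetilde{\mathcal L}_t$. \textbf{Assumptions}, conditional on each type $j$: \begin{enumerate} \item $v_t$, $\eta_t$ ($t\ge2$) and $(\epsilon_t,\zeta_t)$ have mean zero and densities $g_{v_t}^j$, $g_{\eta_t}^j$, $g_{\epsilon_t,\zeta_t}^j$; $E^j[e^{\epsilon_t}],E^j[e^{\zeta_t}]<\infty$; $E^j[\omega_t]=0$ for every $t$. Let $\mathcal H_{t-1}$ be generated by $(K_s,\omega_s,v_s,\epsilon_s,\zeta_s)_{1\le s<t}$. Then $(\epsilon_t,\zeta_t)$ is independent of $(\mathcal H_{t-1},K_t,\omega_t,v_t)$, $v_t$ is independent of $(\mathcal H_{t-1},K_t,\omega_t)$, and $\eta_t$ ($t\ge 2$) is independent of $(\mathcal H_{t-1},K_t)$. \item For $t\ge2$, $K_t$ has a conditional density given $\mathcal H_{t-1}$ which depends only on $(K_{t-1},\omega_{t-1})$. \item $F_t^j$ is measurable and positive on $\mathcal K_t\times\mathcal M_t\times\mathcal L_t^j$ and, for each $k\in\mathcal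 K_t$, $F_t^j(k,\cdot,\cdot)$ is continuously differentiable and strictly concave on $\mathcal M_t\times\mathcal L_t^j$; $h_t^j$ is measurable. Almost surely $(M_t,L_t)$ is the value of a measurable function of $(K_t,\omega_t,v_t)$ and maximizes $$P_{Y,t}E^j[e^{\epsilon_t}]e^{\omega_t}F_t^j(K_t,m,l)-P_{M,t}m-E^j[e^{\zeta_t}]e^{v_t}P_{L,t}\,l$$ over $(m,l)\in\mathcal M_t\times\mathcal L_t^j$; for given $K_t$ that function is invertible in $(\omega_t,v_t)$ with probability one. \item $\sum_{j}\pi^je^{\psi_t^j}=1$ for every $t$. \item The density $g_{\boldsymbol Z_1}^j$ and the conditional densities $g_{\boldsymbol Z_t|\boldsymbol Z_{t-1}}^j$ are continuous and strictly positive on $\mathcal Z_1$ and $\mathcal Z_t\times\mathcal Z_{t-1}$, $2\le t\le T$. \item (Rank condition.) For points $\boldsymbol a_1,\dots,\boldsymbol a_J$ and $\boldsymbol b_1,\dots,\boldsymbol b_{J-1}$ let $\boldsymbol L_{\boldsymbol z_3}$ be the $J\times J$ matrix with first row $(1,\dots,1)$ and further rows $(g^j_{\boldsymbol Z_4|\boldsymbol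 Z_3}(\boldsymbol b_i|\boldsymbol z_3))_{j}$, and $\bar{\boldsymbol L}_{\boldsymbol z_2}$ the $J\times J$ matrix with entries $\pi^jg^j_{\boldsymbol Z_2|\boldsymbol Z_1}(\boldsymbol z_2|\boldsymbol a_i)g^j_{\boldsymbol Z_1}(\boldsymbol a_i)$ in row $i$, column $j$. There is $\boldsymbol z_3^*\in\mathcal Z_3$ such that for every $\boldsymbol z_3\in\mathcal Z_3$ there are $\bar{\boldsymbol z}_2,\check{\boldsymbol z}_2\in\mathcal Z_2$, $\bar{\boldsymbol z}_3\in\mathcal Z_3$, $\boldsymbol a_i\in\mathcal Z_1$ and $\boldsymbol b_i\in\mathcal Z_4$ for which $\boldsymbol L_{\boldsymbol z_3^*},\boldsymbol L_{\boldsymbol z_3},\boldsymbol L_{\bar{\boldsymbol z}_3},\bar{\boldsymbol L}_{\check{\boldsymbol z}_2},\bar{\boldsymbol L}_{\bar{\boldsymbol z}_2}$ are nonsingular and, with $\lambda^j=g^j_{\boldsymbol Z_3|\boldsymbol Z_2}$, the $J$ numbers $$\frac{\lambda^j(\boldsymbol z_3|\check{\boldsymbol z}_2)\,\lambda^j(\bar{\boldsymbol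 z}_3|\bar{\boldsymbol z}_2)}{\lambda^j(\bar{\boldsymbol z}_3|\check{\boldsymbol z}_2)\,\lambda^j(\boldsymbol z_3|\bar{\boldsymbol z}_2)}$$ are distinct. Moreover $\lambda^j(\boldsymbol z_3|\boldsymbol z_2)>0$ for all $j$ and all $(\boldsymbol z_2,\boldsymbol z_3)\in\mathcal Z_2\times\mathcal Z_3$. \end{enumerate} \textbf{Proposition.} Let $T\ge4$. Put $\Gamma_{M,t}^j=\frac{\partial F_t^j}{\partial M}\frac{M}{F_t^j}$ and $\Gamma_{L,t}^j=\frac{\partial F_t^j}{\partial L}\frac{L}{F_t^j}$. Then $$\boldsymbol\theta=\Big\{\pi^j,\{g_{v_t}^j,g_{\epsilon_t,\zeta_t}^j,\Gamma_{M,t}^j,\Gamma_{L,t}^j,P_{L,t},\psi_t^j\}_{t=1}^T,\{F_t^j\}_{t=2}^T,\{h_t^j,g_{\eta_t}^j\}_{t=3}^T\Big\}_{j=1}^J$$ is uniquely determined by the joint density of $(\boldsymbol Z_1,\dots,\boldsymbol Z_T)$, up to one common relabeling of the types. That is, if two models with the same $J$, $T$, $P_{M,t}$, $P_{Y,t}$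 and supports satisfy the assumptions and generate the same joint density, then the $P_{L,t}$ agree and there is one permutation of the types, the same for all periods, under which all components of $\boldsymbol\theta$ agree: $\pi^j$ and $\psi_t^j$ exactly; the shock densities Lebesgue almost everywhere; $\Gamma_{M,t}^j$, $\Gamma_{L,t}^j$ and $F_t^j$ for almost every $k\in\mathcal K_t$ and all $(m,l)\in\mathcal M_t\times\mathcal L_t^j$; and $h_t^j$ almost everywhere with respect to the law of $\omega_{t-1}$ given type $j$ (in either model). -/

import Mathlib

open MeasureTheory ProbabilityTheory Set

noncomputable section

namespace FirmPanel

/-- One period's observation of a firm, `((s^m, s^ℓ), k, m, l̃)`: the ratios of intermediate-input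
cost and of the wage bill to revenue, then capital, intermediate input and number of workers. -/
abbrev Obs : Type := (ℝ × ℝ) × ℝ × ℝ × ℝ

/-- What the econometrician knows besides the joint density of the observations: the number `J` of
types, the number `T` of periods (numbered `1, …, T`), the prices of the intermediate input and of
output, and the supports of the observed variables in each period. -/
structure Env where
  J : ℕ
  T : ℕ
  PM : ℕ → ℝ
  PY : ℕ → ℝ
  suppS : ℕ → Set (ℝ × ℝ)
  suppK : ℕ → Set ℝ
  suppM : ℕ → Set ℝ
  suppN : ℕ → Set ℝ
  PM_pos : ∀ t ∈ Icc 1 T, 0 < PM t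
  PY_pos : ∀ t ∈ Icc 1 T, 0 < PY t
  suppS_open : ∀ t ∈ Icc 1 T, IsOpen (suppS t)
  suppK_open : ∀ t ∈ Icc 1 T, IsOpen (suppK t)
  suppM_open : ∀ t ∈ Icc 1 T, IsOpen (suppM t)
  suppN_open : ∀ t ∈ Icc 1 T, IsOpen (suppN t)
  suppS_conn : ∀ t ∈ Icc 1 T, IsConnected (suppS t)
  suppK_conn : ∀ t ∈ Icc 1 T, IsConnected (suppK t)
  suppM_conn : ∀ t ∈ Icc 1 T, IsConnected (suppM t)
  suppN_conn : ∀ t ∈ Icc 1 T, IsConnected (suppN t)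
  suppS_pos : ∀ t ∈ Icc 1 T, suppS t ⊆ Ioi 0 ×ˢ Ioi 0
  suppK_pos : ∀ t ∈ Icc 1 T, suppK t ⊆ Ioi 0
  suppM_pos : ∀ t ∈ Icc 1 T, suppM t ⊆ Ioi 0
  suppN_pos : ∀ t ∈ Icc 1 T, suppN t ⊆ Ioi 0

/-- The support of one period's observation. -/
def Env.suppZ (E : Env) (t : ℕ) : Set Obs :=
  E.suppS t ×ˢ E.suppK t ×ˢ E.suppM t ×ˢ E.suppN t

/-- The structural parameter. `F t j k m l` is the production function of type `j` in period `t`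
at capital `k`, intermediate input `m` and labor `l` in effective units. -/
structure Theta (J : ℕ) where
  prob : Fin J → ℝ
  gv : ℕ → Fin J → ℝ → ℝ
  gεζ : ℕ → Fin J → ℝ × ℝ → ℝ
  PL : ℕ → ℝ
  ψ : ℕ → Fin J → ℝ
  F : ℕ → Fin J → ℝ → ℝ → ℝ → ℝ
  h : ℕ → Fin J → ℝ → ℝ
  gη : ℕ → Fin J → ℝ → ℝ

namespace Theta

variable {J : ℕ}

/-- Output elasticity of the intermediate input. -/
def ΓM (θ : Theta J) (t : ℕ) (j : Fin J) (k m l : ℝ) : ℝ :=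
  deriv (fun m' => θ.F t j k m' l) m * m / θ.F t j k m l

/-- Output elasticity of labor. -/
def ΓL (θ : Theta J) (t : ℕ) (j : Fin J) (k m l : ℝ) : ℝ :=
  deriv (fun l' => θ.F t j k m l') l * l / θ.F t j k m l

end Theta

/-- The support of labor in effective units for type `j`, which is `exp (ψ t j)` times the support
of the number of workers. -/
def suppL (E : Env) (θ : Theta E.J) (t : ℕ) (j : Fin E.J) : Set ℝ :=
  (fun n => Real.exp (θ.ψ t j) * n) '' E.suppN t

/-- The random variables of the model: type `D`, productivity `ω` and its innovation `η`, wage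
shocks `v` and `ζ`, output shock `ε`, capital `K`, intermediate input `M`, labor in effective units
`L`, number of workers `N`, output `Y` and wage bill `B`. -/
structure Vars (J : ℕ) (Ω : Type*) [MeasurableSpace Ω] where
  D : Ω → Fin J
  ω : ℕ → Ω → ℝ
  η : ℕ → Ω → ℝ
  v : ℕ → Ω → ℝ
  ε : ℕ → Ω → ℝ
  ζ : ℕ → Ω → ℝ
  K : ℕ → Ω → ℝ
  M : ℕ → Ω → ℝ
  L : ℕ → Ω → ℝ
  N : ℕ → Ω → ℝ
  Y : ℕ → Ω → ℝ
  B : ℕ → Ω → ℝ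
  D_meas : Measurable D
  ω_meas : ∀ t, Measurable (ω t)
  η_meas : ∀ t, Measurable (η t)
  v_meas : ∀ t, Measurable (v t)
  ε_meas : ∀ t, Measurable (ε t)
  ζ_meas : ∀ t, Measurable (ζ t)
  K_meas : ∀ t, Measurable (K t)
  M_meas : ∀ t, Measurable (M t)
  L_meas : ∀ t, Measurable (L t)
  N_meas : ∀ t, Measurable (N t)
  Y_meas : ∀ t, Measurable (Y t)
  B_meas : ∀ t, Measurable (B t)

namespace Vars

variable {J : ℕ} {Ω : Type*} [MeasurableSpace Ω]

/-- The probability measure conditional on being of type `j`. -/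
def P (X : Vars J Ω) (μ : Measure Ω) (j : Fin J) : Measure Ω :=
  cond μ (X.D ⁻¹' {j})

/-- The σ-algebra generated by `K`, `ω`, `v`, `ε`, `ζ` in the periods `1, …, t`. -/
abbrev history (X : Vars J Ω) (t : ℕ) : MeasurableSpace Ω :=
  ⨆ s ∈ Icc 1 t, MeasurableSpace.comap
    (fun o => (X.K s o, X.ω s o, X.v s o, X.ε s o, X.ζ s o)) inferInstance

/-- The information available when the inputs of period `t` are chosen (the type is accounted for
by conditioning on it, and the prices are constants). -/
abbrev info (X : Vars J Ω) (t : ℕ) : MeasurableSpace Ω :=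
  X.history (t - 1) ⊔
    MeasurableSpace.comap (fun o => (X.K t o, X.ω t o, X.v t o)) inferInstance

end Vars

/-- The observation of period `t`. -/
def obs (E : Env) {Ω : Type*} [MeasurableSpace Ω] (X : Vars E.J Ω) (t : ℕ) (o : Ω) : Obs :=
  ((E.PM t * X.M t o / (E.PY t * X.Y t o), X.B t o / (E.PY t * X.Y t o)),
    X.K t o, X.M t o, X.N t o)

section Assumptions

variable (E : Env) (θ : Theta E.J) {Ω : Type*} [MeasurableSpace Ω] (μ : Measure Ω)
  (X : Vars E.J Ω)

/-- Each firm has one of `J` types, with probabilities `π^j`. -/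
def TypeProbabilities : Prop :=
  ∀ j, 0 < θ.prob j ∧ μ (X.D ⁻¹' {j}) = ENNReal.ofReal (θ.prob j)

/-- Production, productivity, labor and wage bill equations. -/
def ModelEquations : Prop :=
  ∀ j, (∀ t ∈ Icc 1 E.T, ∀ᵐ o ∂(X.P μ j),
      X.Y t o = Real.exp (X.ω t o + X.ε t o) * θ.F t j (X.K t o) (X.M t o) (X.L t o) ∧
      X.L t o = Real.exp (θ.ψ t j) * X.N t o ∧
      X.B t o = Real.exp (X.v t o + X.ζ t o) * θ.PL t * X.L t o) ∧
    (∀ t ∈ Icc 2 E.T, Measurable (θ.h t j) ∧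
      ∀ᵐ o ∂(X.P μ j), X.ω t o = θ.h t j (X.ω (t - 1) o) + X.η t o)

/-- `g` is a (measurable, nonnegative) probability density of `ν`. -/
def IsDensity {α : Type*} [MeasureSpace α] (ν : Measure α) (g : α → ℝ) : Prop :=
  Measurable g ∧ (∀ x, 0 ≤ g x) ∧ ν = volume.withDensity (fun x => ENNReal.ofReal (g x))

/-- Densities and means of the shocks, given the type. -/
def ShockDistributions : Prop :=
  ∀ j, (∀ t ∈ Icc 1 E.T,
      IsDensity ((X.P μ j).map (X.v t)) (θ.gv t j) ∧
      IsDensity ((X.P μ j).map (fun o => (X.ε t o, X.ζ t o))) (θ.gεζ t j) ∧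
      (Integrable (X.v t) (X.P μ j) ∧ ∫ o, X.v t o ∂(X.P μ j) = 0) ∧
      (Integrable (X.ε t) (X.P μ j) ∧ ∫ o, X.ε t o ∂(X.P μ j) = 0) ∧
      (Integrable (X.ζ t) (X.P μ j) ∧ ∫ o, X.ζ t o ∂(X.P μ j) = 0) ∧
      (Integrable (X.ω t) (X.P μ j) ∧ ∫ o, X.ω t o ∂(X.P μ j) = 0) ∧
      Integrable (fun o => Real.exp (X.ε t o)) (X.P μ j) ∧
      Integrable (fun o => Real.exp (X.ζ t o)) (X.P μ j)) ∧
    (∀ t ∈ Icc 2 E.T,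
      IsDensity ((X.P μ j).map (X.η t)) (θ.gη t j) ∧
      Integrable (X.η t) (X.P μ j) ∧ ∫ o, X.η t o ∂(X.P μ j) = 0)

/-- Timing of the shocks, given the type: `(ε_t, ζ_t)` is independent of the information at the
time of the input choice; the transitory shock `v_t` is independent of `(K_t, ω_t)` and the past;
the innovation `η_t` is independent of `K_t` and the past. -/
def ShockTiming : Prop :=
  ∀ j, (∀ t ∈ Icc 1 E.T,
      Indep (MeasurableSpace.comap (fun o => (X.ε t o, X.ζ t o)) inferInstance)
        (X.info t) (X.P μ j) ∧
      Indep (MeasurableSpace.comap (X.v t) inferInstance)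
        (X.history (t - 1) ⊔
          MeasurableSpace.comap (fun o => (X.K t o, X.ω t o)) inferInstance) (X.P μ j)) ∧
    (∀ t ∈ Icc 2 E.T,
      Indep (MeasurableSpace.comap (X.η t) inferInstance)
        (X.history (t - 1) ⊔ MeasurableSpace.comap (X.K t) inferInstance) (X.P μ j))

/-- Given the type and the past, `K_t` has a conditional density that depends on
`(K_{t-1}, ω_{t-1})` only. -/
def CapitalTransition : Prop :=
  ∀ j, ∀ t ∈ Icc 2 E.T, ∃ gK : ℝ × ℝ × ℝ → ENNReal, Measurable gK ∧
    ∀ A : Set ℝ, MeasurableSet A → ∀ H : Set Ω, MeasurableSet[X.history (t - 1)] H →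
      X.P μ j (X.K t ⁻¹' A ∩ H) =
        ∫⁻ o in H, (∫⁻ k in A, gK (k, X.K (t - 1) o, X.ω (t - 1) o) ∂volume) ∂(X.P μ j)

/-- Expected profit, given the information of period `t`, of a firm of type `j` that has capital
`k`, productivity `w` and transitory wage shock `u` and chooses the inputs `(m, l)`. -/
def profit (t : ℕ) (j : Fin E.J) (k w u : ℝ) (p : ℝ × ℝ) : ℝ :=
  E.PY t * (∫ o, Real.exp (X.ε t o) ∂(X.P μ j)) * Real.exp w * θ.F t j k p.1 p.2
    - E.PM t * p.1
    - (∫ o, Real.exp (X.ζ t o) ∂(X.P μ j)) * Real.exp u * θ.PL t * p.2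

/-- The inputs are the values of demand functions `Md`, `Ld` of `(K_t, ω_t, v_t)`, maximize
expected profit, and reveal `(ω_t, v_t)` given `K_t` with probability one. -/
def InputDemand : Prop :=
  ∀ j, ∀ t ∈ Icc 1 E.T, ∃ Md Ld : ℝ × ℝ × ℝ → ℝ, Measurable Md ∧ Measurable Ld ∧
    (∀ᵐ o ∂(X.P μ j),
      X.M t o = Md (X.K t o, X.ω t o, X.v t o) ∧
      X.L t o = Ld (X.K t o, X.ω t o, X.v t o) ∧
      (X.M t o, X.L t o) ∈ E.suppM t ×ˢ suppL E θ t j ∧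
      IsMaxOn (profit E θ μ X t j (X.K t o) (X.ω t o) (X.v t o))
        (E.suppM t ×ˢ suppL E θ t j) (X.M t o, X.L t o)) ∧
    ∃ G : Set (ℝ × ℝ × ℝ), MeasurableSet G ∧
      (∀ᵐ o ∂(X.P μ j), (X.K t o, X.ω t o, X.v t o) ∈ G) ∧
      ∀ k ∈ E.suppK t, InjOn (fun p : ℝ × ℝ => (Md (k, p), Ld (k, p))) {p | (k, p) ∈ G}

/-- The production functions are measurable and positive and, for each level of capital,
continuously differentiable and strictly concave in the flexible inputs. -/
def ProductionFunctions : Prop :=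
  ∀ j, ∀ t ∈ Icc 1 E.T,
    Measurable (fun x : ℝ × ℝ × ℝ => θ.F t j x.1 x.2.1 x.2.2) ∧
    ∀ k ∈ E.suppK t,
      (∀ p ∈ E.suppM t ×ˢ suppL E θ t j, 0 < θ.F t j k p.1 p.2) ∧
      ContDiffOn ℝ 1 (fun p : ℝ × ℝ => θ.F t j k p.1 p.2) (E.suppM t ×ˢ suppL E θ t j) ∧
      StrictConcaveOn ℝ (E.suppM t ×ˢ suppL E θ t j) (fun p : ℝ × ℝ => θ.F t j k p.1 p.2)

/-- The market wage is common to all firms and positive, and labor quality is normalized. -/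
def WagesAndQuality : Prop :=
  ∀ t ∈ Icc 1 E.T, 0 < θ.PL t ∧ ∑ j, θ.prob j * Real.exp (θ.ψ t j) = 1

/-- `g₁ j` is the density of `Z_1` and `g t j z z'` that of `Z_t` at `z` given `Z_{t-1} = z'`, for
type `j`, where `Z_t` is the observation of period `t`; they are continuous and strictly positive on
the supports. -/
def TypeDensities (g₁ : Fin E.J → Obs → ℝ) (g : ℕ → Fin E.J → Obs → Obs → ℝ) : Prop :=
  ∀ j, ContinuousOn (g₁ j) (E.suppZ 1) ∧ (∀ z ∈ E.suppZ 1, 0 < g₁ j z) ∧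
    (X.P μ j).map (obs E X 1) =
      (volume.restrict (E.suppZ 1)).withDensity (fun z => ENNReal.ofReal (g₁ j z)) ∧
    ∀ t ∈ Icc 2 E.T,
      ContinuousOn (fun p : Obs × Obs => g t j p.1 p.2) (E.suppZ t ×ˢ E.suppZ (t - 1)) ∧
      (∀ z ∈ E.suppZ t, ∀ z' ∈ E.suppZ (t - 1), 0 < g t j z z') ∧
      (X.P μ j).map (fun o => (obs E X t o, obs E X (t - 1) o)) =
        ((volume.restrict (E.suppZ t)).prod ((X.P μ j).map (obs E X (t - 1)))).withDensity
          (fun p => ENNReal.ofReal (g t j p.1 p.2))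

end Assumptions

section Rank

variable {J : ℕ}

/-- The `J × J` matrix with first row `1` and rows `g_4^j(b_i | z_3)` below it. -/
def matL (g : ℕ → Fin J → Obs → Obs → ℝ) (b : Fin (J - 1) → Obs) (z₃ : Obs) :
    Matrix (Fin J) (Fin J) ℝ :=
  Matrix.of fun i j =>
    if hi : (i : ℕ) = 0 then 1 else g 4 j (b ⟨(i : ℕ) - 1, by omega⟩) z₃

/-- The `J × J` matrix with entries `π^j g_2^j(z_2 | a_i) g_1^j(a_i)`. -/
def matLbar (π : Fin J → ℝ) (g₁ : Fin J → Obs → ℝ) (g : ℕ → Fin J → Obs → Obs → ℝ)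
    (a : Fin J → Obs) (z₂ : Obs) : Matrix (Fin J) (Fin J) ℝ :=
  Matrix.of fun i j => π j * g 2 j z₂ (a i) * g₁ j (a i)

/-- The rank and distinctness condition on the type-specific densities. -/
def RankCondition (E : Env) (π : Fin E.J → ℝ) (g₁ : Fin E.J → Obs → ℝ)
    (g : ℕ → Fin E.J → Obs → Obs → ℝ) : Prop :=
  (∃ zs ∈ E.suppZ 3, ∀ z₃ ∈ E.suppZ 3,
    ∃ zbar₂ ∈ E.suppZ 2, ∃ zcheck₂ ∈ E.suppZ 2, ∃ zbar₃ ∈ E.suppZ 3,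
    ∃ a : Fin E.J → Obs, (∀ i, a i ∈ E.suppZ 1) ∧
    ∃ b : Fin (E.J - 1) → Obs, (∀ i, b i ∈ E.suppZ 4) ∧
      ((matL g b zs).det ≠ 0 ∧ (matL g b z₃).det ≠ 0 ∧ (matL g b zbar₃).det ≠ 0 ∧
        (matLbar π g₁ g a zcheck₂).det ≠ 0 ∧ (matLbar π g₁ g a zbar₂).det ≠ 0) ∧
      Function.Injective (fun j =>
        g 3 j z₃ zcheck₂ * (g 3 j zbar₃ zcheck₂)⁻¹ * g 3 j zbar₃ zbar₂ * (g 3 j z₃ zbar₂)⁻¹)) ∧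
  ∀ z₂ ∈ E.suppZ 2, ∀ z₃ ∈ E.suppZ 3, ∀ j, 0 < g 3 j z₃ z₂

end Rank

/-- The random variables `X` on `(Ω, μ)` form a model with structural parameter `θ` that satisfies
all the assumptions. -/
structure IsModel (E : Env) (θ : Theta E.J) {Ω : Type*} [MeasurableSpace Ω] (μ : Measure Ω)
    (X : Vars E.J Ω) : Prop where
  types : TypeProbabilities E θ μ X
  equations : ModelEquations E θ μ X
  shocks : ShockDistributions E θ μ X
  timing : ShockTiming E μ X
  capital : CapitalTransition E μ X
  demand : InputDemand E θ μ X
  production : ProductionFunctions E θ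
  wages : WagesAndQuality E θ
  densities : ∃ g₁ g, TypeDensities E μ X g₁ g ∧ RankCondition E θ.prob g₁ g

/-- `g` is the joint density of the observations of the periods `1, …, T`. -/
def IsJointDensity (E : Env) {Ω : Type*} [MeasurableSpace Ω] (μ : Measure Ω) (X : Vars E.J Ω)
    (g : (Fin E.T → Obs) → ℝ) : Prop :=
  IsDensity (μ.map (fun o (i : Fin E.T) => obs E X (i + 1) o)) g

end FirmPanel

end

/-! The proof has two halves: a finite-mixture argument that separates the types, and then a
comparison of the two models type by type.

Separation of types. Given the type, the first-order conditions can be solved for productivity and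
all shocks in terms of the observation (`IsModel.exists_inversion`). The past therefore enters the
law of the next observation only through the present one: the observations form a Markov chain
(`IsModel.exists_transition`, `IsModel.map_prodMk_obs`), and the density of the first four is a
mixture of products of transition densities. Fix the second and third observations at z₂, z₃ and let
the first and fourth run over finitely many points. The density becomes a matrix L diag(λ) Wᵀ, where
L depends on z₃ only and W on z₂ only. A second model with the same density gives matrices R = L⁻¹L'
and N = WᵀW'ᵀ⁻¹ with λ_i N_ij = R_ij λ'_j. In the cross ratio of λ over two values of z₃ and two of
z₂ the entries of R and N cancel, so R_ij ≠ 0 forces type i of the first model and type j of the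
second to have the same ratio. These ratios are distinct, so R has one nonzero entry in each column,
and the row of ones (fourth observation integrated out) makes that entry 1. The reference point z₃*
makes the permutation the same for all z₃ (`mixture_components`). For later periods, the conditional
probabilities of future events given z₃ are the unknowns of a nonsingular linear system
(`future_ae_eq`). The outcome is `exists_relabeling`: after one relabeling the models share the type
probabilities and the law of each pair of successive observations.

Comparison for one type. Everything is transported to the common law of the observations
(`PeriodLaw`, `TransitionLaw`). The log material share plus ε is a function of the inputs, and ε is
centered given the inputs; so two candidates for ε differ by a function of the inputs that must
vanish. The labor share treats ζ in the same way. The shares then give the elasticities, first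
almost everywhere and then everywhere by continuity. The log wage bill per worker is v + ζ + log P_L
+ ψ, whose mean gives P_L e^ψ; averaging over types yields P_L.

Integrating the elasticities over the connected supports determines log F up to a function D(K_t),
and ω_t up to the same function. Since η_t is centered given K_t and the previous observation, the
innovations of the two models coincide, and D(K_t) equals a function of the previous observation.
The joint law of these two dominates a product, so D is constant, and the zero mean of ω_t makes it
zero (`PeriodLaw.output_eq`). The argument needs a transition into period t, hence F is obtained
from period 2 on; h needs productivity in two successive such periods, hence starts at period 3. -/

noncomputable section

namespace FirmPanel

/-! ### Uniqueness of the components of a finite mixture. -/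

section LinearAlgebra

open Matrix

variable {ι α β γ δ : Type*} [Fintype ι] [DecidableEq ι]

/-- An invertible matrix with at most one nonzero entry in each column determines a permutation. -/
theorem exists_perm_of_det_ne_zero {R : Matrix ι ι ℝ} (hR : R.det ≠ 0)
    (h : ∀ i i' j, R i j ≠ 0 → R i' j ≠ 0 → i = i') :
    ∃ τ : Equiv.Perm ι, ∀ i j, R i j ≠ 0 → i = τ j := by
  have h1 : ∀ j, ∃ i, R i j ≠ 0 := by
    intro j
    by_contra! hc
    exact hR (Matrix.det_eq_zero_of_column_eq_zero j hc)
  choose τ hτ using h1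
  have hs : Function.Surjective τ := by
    intro i
    by_contra! hc
    refine hR (Matrix.det_eq_zero_of_row_eq_zero i fun j => ?_)
    by_contra hij
    exact hc j (h _ _ j (hτ j) hij)
  refine ⟨Equiv.ofBijective τ (Finite.surjective_iff_bijective.1 hs), fun i j hij => ?_⟩
  exact h _ _ j hij (hτ j)

/-- A factorization of the same matrix in two ways. -/
theorem diagonal_intertwine {L L' W W' : Matrix ι ι ℝ} {l l' : ι → ℝ}
    (hL : L.det ≠ 0) (hW : W.det ≠ 0) (hl : ∀ i, 0 < l i)
    (h : L * diagonal l * Wᵀ = L' * diagonal l' * W'ᵀ) :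
    L'.det ≠ 0 ∧ W'.det ≠ 0 ∧
      ∀ i j, l i * (Wᵀ * W'ᵀ⁻¹) i j = (L⁻¹ * L') i j * l' j := by
  -- Comparing determinants transfers nonsingularity from one factorization to the other, so only
  -- one side needs a rank hypothesis.
  have hd := congrArg det h
  simp only [det_mul, det_transpose, det_diagonal] at hd
  have h0 : L.det * (∏ i, l i) * W.det ≠ 0 :=
    mul_ne_zero (mul_ne_zero hL (Finset.prod_pos fun i _ => hl i).ne') hW
  rw [hd] at h0
  have hL' : L'.det ≠ 0 := fun h1 => h0 (by simp [h1])
  have hW' : W'.det ≠ 0 := fun h1 => h0 (by simp [h1])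
  refine ⟨hL', hW', fun i j => ?_⟩
  have e : diagonal l * (Wᵀ * W'ᵀ⁻¹) = (L⁻¹ * L') * diagonal l' := by
    have hu : IsUnit L.det := isUnit_iff_ne_zero.2 hL
    have hu' : IsUnit W'ᵀ.det := by rw [det_transpose]; exact isUnit_iff_ne_zero.2 hW'
    calc diagonal l * (Wᵀ * W'ᵀ⁻¹) = L⁻¹ * L * diagonal l * (Wᵀ * W'ᵀ⁻¹) := by
          rw [nonsing_inv_mul _ hu, Matrix.one_mul]
      _ = L⁻¹ * (L * diagonal l * Wᵀ) * W'ᵀ⁻¹ := by simp only [Matrix.mul_assoc]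
      _ = L⁻¹ * (L' * diagonal l' * W'ᵀ) * W'ᵀ⁻¹ := by rw [h]
      _ = L⁻¹ * L' * diagonal l' * (W'ᵀ * W'ᵀ⁻¹) := by simp only [Matrix.mul_assoc]
      _ = _ := by rw [mul_nonsing_inv _ hu', Matrix.mul_one]
  have := congrFun (congrFun e i) j
  simpa [diagonal_mul, mul_diagonal] using this

/-- If each column of `R` is supported at `τ j` and the rows of ones agree, then `L⁻¹ * L' = R`
is the permutation matrix of `τ`. -/
theorem columns_eq_of_support {L L' : Matrix ι ι ℝ} (hL : L.det ≠ 0) (τ : Equiv.Perm ι)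
    (hτ : ∀ i j, (L⁻¹ * L') i j ≠ 0 → i = τ j) {i₀ : ι} (h₀ : ∀ j, L i₀ j = 1)
    (h₀' : ∀ j, L' i₀ j = 1) (i j : ι) : L' i j = L i (τ j) ∧ (L⁻¹ * L') (τ j) j = 1 := by
  have hu : IsUnit L.det := isUnit_iff_ne_zero.2 hL
  have e : ∀ i j, L' i j = L i (τ j) * (L⁻¹ * L') (τ j) j := by
    intro i j
    have : L' = L * (L⁻¹ * L') := by rw [← Matrix.mul_assoc, mul_nonsing_inv _ hu, Matrix.one_mul]
    rw [this, Matrix.mul_apply, ← this]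
    refine Finset.sum_eq_single _ (fun k _ hk => ?_) (by simp)
    by_contra hc
    exact hk (hτ k j fun h => hc (by simp [h]))
  have e1 := e i₀ j
  rw [h₀, h₀', one_mul] at e1
  exact ⟨by rw [e, ← e1, mul_one], e1.symm⟩

theorem eq_zero_of_det_ne_zero {A : Matrix ι ι ℝ} (hA : A.det ≠ 0) {x : ι → ℝ}
    (h : ∀ i, ∑ j, A i j * x j = 0) (j : ι) : x j = 0 :=
  congrFun (eq_zero_of_mulVec_eq_zero hA (funext h)) j

variable {w w' : ι → β → α → ℝ} {l l' : ι → γ → β → ℝ} {e e' : ι → γ → Option δ → ℝ}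

/-- Two finite mixtures that agree have the same components up to relabeling, at two given values
`c₁`, `c₂` of the middle variable. -/
theorem mixture_components_local
    (hl : ∀ j c b, 0 < l j c b) (hl' : ∀ j c b, 0 < l' j c b)
    (he : ∀ j c, e j c none = 1) (he' : ∀ j c, e' j c none = 1)
    (hf : ∀ a b c y, ∑ j, w j b a * l j c b * e j c y = ∑ j, w' j b a * l' j c b * e' j c y)
    (c₁ c₂ c₃ : γ) (b₁ b₂ : β) (a : ι → α) (y : ι → Option δ) (i₀ : ι) (hy : y i₀ = none)
    (hL₁ : (Matrix.of fun i j => e j c₁ (y i)).det ≠ 0)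
    (hL₂ : (Matrix.of fun i j => e j c₂ (y i)).det ≠ 0)
    (hL₃ : (Matrix.of fun i j => e j c₃ (y i)).det ≠ 0)
    (hW₁ : (Matrix.of fun i j => w j b₁ (a i)).det ≠ 0)
    (hW₂ : (Matrix.of fun i j => w j b₂ (a i)).det ≠ 0)
    (hinj : Function.Injective fun j =>
      l j c₁ b₁ * (l j c₃ b₁)⁻¹ * l j c₃ b₂ * (l j c₁ b₂)⁻¹) :
    ∃ τ : Equiv.Perm ι, ∀ j,
      (∀ z, e' j c₁ z = e (τ j) c₁ z) ∧ (∀ z, e' j c₂ z = e (τ j) c₂ z) ∧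
      ∀ b a, w' j b a * l' j c₁ b = w (τ j) b a * l (τ j) c₁ b := by
  set L : γ → Matrix ι ι ℝ := fun c => Matrix.of fun i j => e j c (y i) with hLd
  set L' : γ → Matrix ι ι ℝ := fun c => Matrix.of fun i j => e' j c (y i) with hLd'
  set W : β → Matrix ι ι ℝ := fun b => Matrix.of fun i j => w j b (a i) with hWd
  set W' : β → Matrix ι ι ℝ := fun b => Matrix.of fun i j => w' j b (a i) with hWd'
  have key : ∀ c b, L c * diagonal (fun j => l j c b) * (W b)ᵀ =
      L' c * diagonal (fun j => l' j c b) * (W' b)ᵀ := by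
    intro c b
    ext i k
    rw [Matrix.mul_apply, Matrix.mul_apply]
    simp only [mul_diagonal, transpose_apply, hLd, hLd', hWd, hWd', of_apply]
    have := hf (a k) b c (y i)
    convert this using 2 <;> ring
  have I : ∀ c b, (L c).det ≠ 0 → (W b).det ≠ 0 → (L' c).det ≠ 0 ∧ (W' b).det ≠ 0 ∧
      ∀ i j, l i c b * ((W b)ᵀ * (W' b)ᵀ⁻¹) i j = ((L c)⁻¹ * L' c) i j * l' j c b :=
    fun c b h1 h2 => diagonal_intertwine h1 h2 (fun i => hl i c b) (key c b)
  obtain ⟨hL'₁, hW'₁, I₁₁⟩ := I c₁ b₁ hL₁ hW₁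
  obtain ⟨-, hW'₂, I₁₂⟩ := I c₁ b₂ hL₁ hW₂
  obtain ⟨-, -, I₃₁⟩ := I c₃ b₁ hL₃ hW₁
  obtain ⟨-, -, I₃₂⟩ := I c₃ b₂ hL₃ hW₂
  obtain ⟨hL'₂, -, I₂₁⟩ := I c₂ b₁ hL₂ hW₁
  -- `R` depends on `c` alone and `N` on `b` alone. Each relation below links one of each, so all of
  -- them have the same zero pattern.
  set R : γ → Matrix ι ι ℝ := fun c => (L c)⁻¹ * L' c with hR
  set N : β → Matrix ι ι ℝ := fun b => (W b)ᵀ * (W' b)ᵀ⁻¹ with hN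
  have I₁₁' : ∀ i j, l i c₁ b₁ * N b₁ i j = R c₁ i j * l' j c₁ b₁ := I₁₁
  have I₁₂' : ∀ i j, l i c₁ b₂ * N b₂ i j = R c₁ i j * l' j c₁ b₂ := I₁₂
  have I₃₁' : ∀ i j, l i c₃ b₁ * N b₁ i j = R c₃ i j * l' j c₃ b₁ := I₃₁
  have I₃₂' : ∀ i j, l i c₃ b₂ * N b₂ i j = R c₃ i j * l' j c₃ b₂ := I₃₂
  have I₂₁' : ∀ i j, l i c₂ b₁ * N b₁ i j = R c₂ i j * l' j c₂ b₁ := I₂₁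
  -- In this cross ratio each of the four entries of `R` and `N` appears once in the numerator and
  -- once in the denominator.
  have ratio : ∀ i j, R c₁ i j ≠ 0 →
      l i c₁ b₁ * (l i c₃ b₁)⁻¹ * l i c₃ b₂ * (l i c₁ b₂)⁻¹ =
      l' j c₁ b₁ * (l' j c₃ b₁)⁻¹ * l' j c₃ b₂ * (l' j c₁ b₂)⁻¹ := by
    intro i j hij
    have p1 := (hl i c₁ b₁).ne'
    have p2 := (hl i c₁ b₂).ne'
    have p3 := (hl i c₃ b₁).ne'
    have p4 := (hl i c₃ b₂).ne'
    have p1' := (hl' j c₁ b₁).ne'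
    have p2' := (hl' j c₁ b₂).ne'
    have p3' := (hl' j c₃ b₁).ne'
    have p4' := (hl' j c₃ b₂).ne'
    have hn1 : N b₁ i j ≠ 0 := fun h0 => by
      have := I₁₁' i j
      rw [h0, mul_zero, eq_comm, mul_eq_zero] at this
      tauto
    have hn2 : N b₂ i j ≠ 0 := fun h0 => by
      have := I₁₂' i j
      rw [h0, mul_zero, eq_comm, mul_eq_zero] at this
      tauto
    have hr3 : R c₃ i j ≠ 0 := fun h0 => by
      have := I₃₁' i j
      rw [h0, zero_mul, mul_eq_zero] at this
      tauto
    have q1 : l i c₁ b₁ = R c₁ i j * l' j c₁ b₁ / N b₁ i j := by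
      rw [← I₁₁', mul_div_cancel_right₀ _ hn1]
    have q2 : l i c₁ b₂ = R c₁ i j * l' j c₁ b₂ / N b₂ i j := by
      rw [← I₁₂', mul_div_cancel_right₀ _ hn2]
    have q3 : l i c₃ b₁ = R c₃ i j * l' j c₃ b₁ / N b₁ i j := by
      rw [← I₃₁', mul_div_cancel_right₀ _ hn1]
    have q4 : l i c₃ b₂ = R c₃ i j * l' j c₃ b₂ / N b₂ i j := by
      rw [← I₃₂', mul_div_cancel_right₀ _ hn2]
    rw [q1, q2, q3, q4]
    field_simp
  have hdetR : (R c₁).det ≠ 0 := by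
    rw [hR, det_mul, det_nonsing_inv, Ring.inverse_eq_inv']
    exact mul_ne_zero (inv_ne_zero hL₁) hL'₁
  obtain ⟨τ, hτ⟩ := exists_perm_of_det_ne_zero hdetR fun i i' j hi hi' =>
    hinj ((ratio i j hi).trans (ratio i' j hi').symm)
  -- The zero pattern passes from `R c₁` to `N b₁` and from there to `R c₂`; no distinctness of
  -- ratios at `c₂` is needed.
  have hτ₂ : ∀ i j, R c₂ i j ≠ 0 → i = τ j := by
    intro i j hij
    refine hτ i j fun h0 => hij ?_
    have h1 := I₁₁' i j
    rw [h0, zero_mul, mul_eq_zero] at h1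
    have h2 := I₂₁' i j
    rw [h1.resolve_left (hl i c₁ b₁).ne', mul_zero, eq_comm, mul_eq_zero] at h2
    exact h2.resolve_right (hl' j c₂ b₁).ne'
  have one : ∀ c j, L c i₀ j = 1 := fun c j => by simp [hLd, hy, he]
  have one' : ∀ c j, L' c i₀ j = 1 := fun c j => by simp [hLd', hy, he']
  have C₁ := columns_eq_of_support hL₁ τ hτ (one c₁) (one' c₁)
  have C₂ := columns_eq_of_support hL₂ τ hτ₂ (one c₂) (one' c₂)
  -- the past factors agree at `b₁`
  have past : ∀ c, (L c).det ≠ 0 → (∀ i j, L' c i j = L c i (τ j)) →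
      ∀ j b a, w' j b a * l' j c b = w (τ j) b a * l (τ j) c b := by
    intro c hc hcol j b a
    have := eq_zero_of_det_ne_zero hc
      (x := fun i => w i b a * l i c b - w' (τ.symm i) b a * l' (τ.symm i) c b) (fun i => by
        simp only [mul_sub, Finset.sum_sub_distrib]
        rw [sub_eq_zero]
        have h1 := hf a b c (y i)
        have h2 : ∑ j, L c i j * (w' (τ.symm j) b a * l' (τ.symm j) c b) =
            ∑ j, L' c i j * (w' j b a * l' j c b) := by
          rw [← Equiv.sum_comp τ]
          simp [hcol]
        rw [h2]
        simp only [hLd, hLd', of_apply]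
        convert h1 using 2 <;> ring) (τ j)
    simp only [Equiv.symm_apply_apply] at this
    linarith
  -- With the past factors matched, nonsingularity of `W' b₁` gives the future factors at every `z`,
  -- not only at the rows selected by `y`.
  have future : ∀ c, (∀ j b a, w' j b a * l' j c b = w (τ j) b a * l (τ j) c b) →
      ∀ j z, e' j c z = e (τ j) c z := by
    intro c hc j z
    have hx := eq_zero_of_det_ne_zero hW'₁
      (x := fun j => l' j c b₁ * (e' j c z - e (τ j) c z)) (fun i => by
        have h1 := hf (a i) b₁ c z
        rw [← Equiv.sum_comp τ] at h1
        simp only [← hc] at h1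
        simp only [hWd', of_apply, mul_sub, Finset.sum_sub_distrib, ← mul_assoc]
        rw [h1, sub_self]) j
    have := (mul_eq_zero.1 hx).resolve_left (hl' j c b₁).ne'
    linarith
  have past₁ := past c₁ hL₁ fun i j => (C₁ i j).1
  have past₂ := past c₂ hL₂ fun i j => (C₂ i j).1
  exact ⟨τ, fun j => ⟨future c₁ past₁ j, future c₂ past₂ j, past₁ j⟩⟩

/-- Two finite mixtures that agree have the same components up to one common relabeling. -/
theorem mixture_components
    (hl : ∀ j c b, 0 < l j c b) (hl' : ∀ j c b, 0 < l' j c b)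
    (he : ∀ j c, e j c none = 1) (he' : ∀ j c, e' j c none = 1)
    (hf : ∀ a b c y, ∑ j, w j b a * l j c b * e j c y = ∑ j, w' j b a * l' j c b * e' j c y)
    (cs : γ) (i₀ : ι)
    (h : ∀ c, ∃ (b₂ b₁ : β) (c₃ : γ) (a : ι → α) (y : ι → Option δ), y i₀ = none ∧
      (Matrix.of fun i j => e j cs (y i)).det ≠ 0 ∧
      (Matrix.of fun i j => e j c (y i)).det ≠ 0 ∧
      (Matrix.of fun i j => e j c₃ (y i)).det ≠ 0 ∧
      (Matrix.of fun i j => w j b₁ (a i)).det ≠ 0 ∧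
      (Matrix.of fun i j => w j b₂ (a i)).det ≠ 0 ∧
      Function.Injective fun j => l j c b₁ * (l j c₃ b₁)⁻¹ * l j c₃ b₂ * (l j c b₂)⁻¹) :
    ∃ σ : Equiv.Perm ι, ∀ j c, (∀ z, e j c z = e' (σ j) c z) ∧
      ∀ b a, w j b a * l j c b = w' (σ j) b a * l' (σ j) c b := by
  have H : ∀ c, ∃ τ : Equiv.Perm ι, ∀ j,
      (∀ z, e' j c z = e (τ j) c z) ∧ (∀ z, e' j cs z = e (τ j) cs z) ∧
      ∀ b a, w' j b a * l' j c b = w (τ j) b a * l (τ j) c b := by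
    intro c
    obtain ⟨b₂, b₁, c₃, a, y, hy, h1, h2, h3, h4, h5, h6⟩ := h c
    exact mixture_components_local hl hl' he he' hf c cs c₃ b₁ b₂ a y i₀ hy h2 h1 h3 h4 h5 h6
  choose τ hτ using H
  -- A nonsingular matrix has distinct columns, so the future factors at `cs` tell the types apart.
  -- Every `τ c` matches these same factors, so it cannot vary with `c`.
  have inj : ∀ i j, (∀ z, e i cs z = e j cs z) → i = j := by
    obtain ⟨-, -, -, -, y, -, h1, -⟩ := h cs
    intro i j hij
    by_contra hne
    exact h1 (Matrix.det_zero_of_column_eq hne fun k => hij _)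
  have same : ∀ c, τ c = τ cs := by
    intro c
    ext j
    exact inj _ _ fun z => by rw [← (hτ c j).2.1, ← (hτ cs j).2.1]
  refine ⟨(τ cs).symm, fun j c => ?_⟩
  have := hτ c ((τ cs).symm j)
  rw [same c, Equiv.apply_symm_apply] at this
  exact ⟨fun z => (this.1 z).symm, fun b a => (this.2.2 b a).symm⟩

end LinearAlgebra

end FirmPanel

end

noncomputable section

namespace FirmPanel

/-! ### Supports, and densities of the observations extended by zero. -/

section Supports

theorem Env.isOpen_suppZ (E : Env) {t : ℕ} (ht : t ∈ Icc 1 E.T) : IsOpen (E.suppZ t) :=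
  (E.suppS_open t ht).prod ((E.suppK_open t ht).prod ((E.suppM_open t ht).prod (E.suppN_open t ht)))

theorem isOpen_suppL (E : Env) (θ : Theta E.J) {t : ℕ} (ht : t ∈ Icc 1 E.T) (j : Fin E.J) :
    IsOpen (suppL E θ t j) :=
  (Homeomorph.mulLeft₀ _ (Real.exp_pos (θ.ψ t j)).ne').isOpenMap _ (E.suppN_open t ht)

end Supports

section Densities

variable {E : Env} {Ω : Type*} [MeasurableSpace Ω] {μ : Measure Ω} {X : Vars E.J Ω}

theorem measurable_obs (E : Env) (X : Vars E.J Ω) (t : ℕ) : Measurable (obs E X t) := by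
  have h1 := X.M_meas t
  have h2 := X.Y_meas t
  have h3 := X.B_meas t
  have h4 := X.K_meas t
  have h5 := X.N_meas t
  unfold obs
  fun_prop

theorem TypeProbabilities.isProbabilityMeasure [IsProbabilityMeasure μ] {θ : Theta E.J}
    (h : TypeProbabilities E θ μ X) (j : Fin E.J) : IsProbabilityMeasure (X.P μ j) := by
  refine cond_isProbabilityMeasure ?_
  rw [(h j).2]
  exact (ENNReal.ofReal_pos.2 (h j).1).ne'

/-- The density of the first observation, extended by zero. -/
def initialDensity (E : Env) (g₁ : Fin E.J → Obs → ℝ) (j : Fin E.J) (z : Obs) : ENNReal :=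
  (E.suppZ 1).indicator (fun z => ENNReal.ofReal (g₁ j z)) z

/-- The transition density of the observations, extended by zero. -/
def transitionDensity (E : Env) (g : ℕ → Fin E.J → Obs → Obs → ℝ) (t : ℕ) (j : Fin E.J)
    (p : Obs × Obs) : ENNReal :=
  (E.suppZ t ×ˢ E.suppZ (t - 1)).indicator (fun p => ENNReal.ofReal (g t j p.1 p.2)) p

/-- The type densities are controlled only on the open supports; continuity there makes the
extension by zero globally measurable. -/
theorem measurable_indicator_of_continuousOn {α : Type*} [TopologicalSpace α] [MeasurableSpace α]
    [OpensMeasurableSpace α] {f : α → ℝ} {s : Set α} (hs : IsOpen s) (hf : ContinuousOn f s) :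
    Measurable (s.indicator fun z => ENNReal.ofReal (f z)) := by
  classical
  rw [← Set.piecewise_eq_indicator]
  exact (ENNReal.continuous_ofReal.comp_continuousOn hf).measurable_piecewise
    continuousOn_const hs.measurableSet

variable {g₁ : Fin E.J → Obs → ℝ} {g : ℕ → Fin E.J → Obs → Obs → ℝ}

theorem one_mem_periods {t T : ℕ} (ht : t ∈ Icc 2 T) : t - 1 ∈ Icc 1 T :=
  ⟨by have := ht.1; omega, by have := ht.2; omega⟩

theorem periods_of_two {t T : ℕ} (ht : t ∈ Icc 2 T) : t ∈ Icc 1 T :=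
  ⟨by have := ht.1; omega, ht.2⟩

namespace TypeDensities

variable (h : TypeDensities E μ X g₁ g) (j : Fin E.J)
include h

theorem measurable_initialDensity (hT : 1 ≤ E.T) : Measurable (initialDensity E g₁ j) :=
  measurable_indicator_of_continuousOn (E.isOpen_suppZ ⟨le_rfl, hT⟩) (h j).1

theorem measurable_transitionDensity {t : ℕ} (ht : t ∈ Icc 2 E.T) :
    Measurable (transitionDensity E g t j) :=
  measurable_indicator_of_continuousOn
    ((E.isOpen_suppZ (periods_of_two ht)).prod (E.isOpen_suppZ (one_mem_periods ht)))
    ((h j).2.2.2 t ht).1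

theorem map_obs_one (hT : 1 ≤ E.T) :
    (X.P μ j).map (obs E X 1) = volume.withDensity (initialDensity E g₁ j) := by
  have : initialDensity E g₁ j =
    (E.suppZ 1).indicator (fun z => ENNReal.ofReal (g₁ j z)) := rfl
  rw [this, withDensity_indicator (E.isOpen_suppZ ⟨le_rfl, hT⟩).measurableSet]
  exact (h j).2.2.1

theorem ae_mem_suppZ {t : ℕ} (ht : t ∈ Icc 1 E.T) [IsProbabilityMeasure (X.P μ j)] :
    ∀ᵐ o ∂(X.P μ j), obs E X t o ∈ E.suppZ t := by
  have hm := (E.isOpen_suppZ ht).measurableSet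
  rcases eq_or_lt_of_le ht.1 with rfl | h2
  · have : ∀ᵐ z ∂((X.P μ j).map (obs E X 1)), z ∈ E.suppZ 1 := by
      rw [(h j).2.2.1]
      exact (withDensity_absolutelyContinuous _ _).ae_le (ae_restrict_mem hm)
    exact ae_of_ae_map (measurable_obs E X 1).aemeasurable this
  · have ht' : t ∈ Icc 2 E.T := ⟨h2, ht.2⟩
    have : ∀ᵐ z ∂((X.P μ j).map (fun o => (obs E X t o, obs E X (t - 1) o))),
        z.1 ∈ E.suppZ t := by
      rw [((h j).2.2.2 t ht').2.2]
      refine (withDensity_absolutelyContinuous _ _).ae_le ?_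
      have : IsProbabilityMeasure ((X.P μ j).map (obs E X (t - 1))) :=
        Measure.isProbabilityMeasure_map (measurable_obs E X _).aemeasurable
      exact Measure.quasiMeasurePreserving_fst.ae (ae_restrict_mem hm)
    exact ae_of_ae_map
      ((measurable_obs E X t).prodMk (measurable_obs E X (t - 1))).aemeasurable this

/-- The previous observation lies almost surely in its support, so restricting the second factor
changes nothing. This allows the restricted reference measure to be traded for a zero-extended
density. -/
theorem prod_restrict_eq {t : ℕ} (ht : t ∈ Icc 2 E.T) [IsProbabilityMeasure (X.P μ j)] :
    (volume.restrict (E.suppZ t)).prod ((X.P μ j).map (obs E X (t - 1))) =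
      ((volume : Measure Obs).prod ((X.P μ j).map (obs E X (t - 1)))).restrict
        (E.suppZ t ×ˢ E.suppZ (t - 1)) := by
  have : IsProbabilityMeasure ((X.P μ j).map (obs E X (t - 1))) :=
    Measure.isProbabilityMeasure_map (measurable_obs E X _).aemeasurable
  rw [← Measure.prod_restrict]
  congr 1
  refine (Measure.restrict_eq_self_of_ae_mem ?_).symm
  exact (ae_map_iff (measurable_obs E X _).aemeasurable
    (E.isOpen_suppZ (one_mem_periods ht)).measurableSet).2 (h.ae_mem_suppZ j (one_mem_periods ht))

theorem map_obs_pair {t : ℕ} (ht : t ∈ Icc 2 E.T) [IsProbabilityMeasure (X.P μ j)] :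
    (X.P μ j).map (fun o => (obs E X t o, obs E X (t - 1) o)) =
      ((volume : Measure Obs).prod ((X.P μ j).map (obs E X (t - 1)))).withDensity
        (transitionDensity E g t j) := by
  have : transitionDensity E g t j = (E.suppZ t ×ˢ E.suppZ (t - 1)).indicator
    (fun p => ENNReal.ofReal (g t j p.1 p.2)) := rfl
  rw [this, withDensity_indicator ((E.isOpen_suppZ (periods_of_two ht)).measurableSet.prod
    (E.isOpen_suppZ (one_mem_periods ht)).measurableSet), ((h j).2.2.2 t ht).2.2,
    h.prod_restrict_eq j ht]

/-- The law of two successive observations dominates the product of Lebesgue measure on the support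
of the second and the law of the first. -/
theorem prod_absolutelyContinuous {t : ℕ} (ht : t ∈ Icc 2 E.T) [IsProbabilityMeasure (X.P μ j)] :
    (volume.restrict (E.suppZ t)).prod ((X.P μ j).map (obs E X (t - 1))) ≪
      (X.P μ j).map (fun o => (obs E X t o, obs E X (t - 1) o)) := by
  have hms := (E.isOpen_suppZ (periods_of_two ht)).measurableSet.prod
    (E.isOpen_suppZ (one_mem_periods ht)).measurableSet
  rw [h.map_obs_pair j ht, h.prod_restrict_eq j ht]
  have e : transitionDensity E g t j = (E.suppZ t ×ˢ E.suppZ (t - 1)).indicator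
      (transitionDensity E g t j) := by
    unfold transitionDensity
    ext p
    simp [Set.indicator_indicator]
  rw [e, withDensity_indicator hms]
  refine withDensity_absolutelyContinuous' (h.measurable_transitionDensity j ht).aemeasurable ?_
  filter_upwards [ae_restrict_mem hms] with p hp
  rw [transitionDensity, indicator_of_mem hp]
  exact (ENNReal.ofReal_pos.2 (((h j).2.2.2 t ht).2.1 _ hp.1 _ hp.2)).ne'

/-- Strict positivity of the densities is what counts. This turns almost sure statements about an
observation into Lebesgue almost everywhere statements on the support. -/
theorem restrict_absolutelyContinuous {t : ℕ} (ht : t ∈ Icc 1 E.T)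
    [IsProbabilityMeasure (X.P μ j)] :
    volume.restrict (E.suppZ t) ≪ (X.P μ j).map (obs E X t) := by
  rcases eq_or_lt_of_le ht.1 with rfl | h2
  · have hms := (E.isOpen_suppZ ht).measurableSet
    rw [(h j).2.2.1]
    refine withDensity_absolutelyContinuous' ?_ ?_
    · exact (ENNReal.continuous_ofReal.comp_continuousOn (h j).1).aemeasurable hms
    · filter_upwards [ae_restrict_mem hms] with p hp
      exact (ENNReal.ofReal_pos.2 ((h j).2.1 _ hp)).ne'
  · have ht' : t ∈ Icc 2 E.T := ⟨h2, ht.2⟩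
    have : IsProbabilityMeasure ((X.P μ j).map (obs E X (t - 1))) :=
      Measure.isProbabilityMeasure_map (measurable_obs E X _).aemeasurable
    have h1 := (h.prod_absolutelyContinuous j ht').map measurable_fst
    rw [Measure.map_map measurable_fst
      ((measurable_obs E X t).prodMk (measurable_obs E X (t - 1))), Measure.map_fst_prod] at h1
    simp only [measure_univ, one_smul] at h1
    exact h1

end TypeDensities

end Densities

/-! ### First-order conditions and measurability of partial derivatives. -/

section FirstOrder

/-- First-order conditions of an interior maximum of a profit function. -/
theorem first_order_conditions {F : ℝ → ℝ → ℝ} {U V : Set ℝ} (hU : IsOpen U) (hV : IsOpen V)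
    (hF : ContDiffOn ℝ 1 (fun p : ℝ × ℝ => F p.1 p.2) (U ×ˢ V)) {m l A b c : ℝ}
    (hm : m ∈ U) (hl : l ∈ V)
    (hmax : IsMaxOn (fun p : ℝ × ℝ => A * F p.1 p.2 - b * p.1 - c * p.2) (U ×ˢ V) (m, l)) :
    (DifferentiableAt ℝ (fun m' => F m' l) m ∧ A * deriv (fun m' => F m' l) m = b) ∧
      DifferentiableAt ℝ (fun l' => F m l') l ∧ A * deriv (fun l' => F m l') l = c := by
  have hd : DifferentiableAt ℝ (fun p : ℝ × ℝ => F p.1 p.2) (m, l) :=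
    (hF.differentiableOn (by norm_num)).differentiableAt ((hU.prod hV).mem_nhds ⟨hm, hl⟩)
  have d1 : DifferentiableAt ℝ (fun m' => F m' l) m :=
    DifferentiableAt.comp (f := fun m' : ℝ => (m', l)) m hd (by fun_prop)
  have d2 : DifferentiableAt ℝ (fun l' => F m l') l :=
    DifferentiableAt.comp (f := fun l' : ℝ => (m, l')) l hd (by fun_prop)
  refine ⟨⟨d1, ?_⟩, d2, ?_⟩
  · have hloc : IsLocalMax (fun m' => A * F m' l - b * m' - c * l) m := by
      filter_upwards [hU.mem_nhds hm] with m' hm'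
      exact hmax (show (m', l) ∈ U ×ˢ V from ⟨hm', hl⟩)
    have h0 := hloc.deriv_eq_zero
    have h1 : HasDerivAt (fun m' => A * F m' l - b * m' - c * l)
        (A * deriv (fun m' => F m' l) m - b * 1) m :=
      ((d1.hasDerivAt.const_mul A).sub ((hasDerivAt_id m).const_mul b)).sub_const _
    rw [h1.deriv] at h0
    linarith
  · have hloc : IsLocalMax (fun l' => A * F m l' - b * m - c * l') l := by
      filter_upwards [hV.mem_nhds hl] with l' hl'
      exact hmax (show (m, l') ∈ U ×ˢ V from ⟨hm, hl'⟩)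
    have h0 := hloc.deriv_eq_zero
    have h1 : HasDerivAt (fun l' => A * F m l' - b * m - c * l')
        (A * deriv (fun l' => F m l') l - c * 1) l :=
      ((d2.hasDerivAt.const_mul A).sub_const _).sub ((hasDerivAt_id l).const_mul c)
    rw [h1.deriv] at h0
    linarith

/-- A derivative with respect to one of several variables is measurable where it exists. -/
theorem aemeasurable_deriv {α : Type*} [MeasurableSpace α] {Q : Measure α} {f : α → ℝ → ℝ}
    {x : α → ℝ} (hf : ∀ c, Measurable fun z => f z (x z + c))
    (hd : ∀ᵐ z ∂Q, DifferentiableAt ℝ (f z) (x z)) :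
    AEMeasurable (fun z => deriv (f z) (x z)) Q := by
  -- The derivative is the limit of difference quotients with steps 1/(n+1). The base point is
  -- written `x z + 0` so that the hypothesis on shifts covers both terms.
  refine aemeasurable_of_tendsto_metrizable_ae Filter.atTop
    (f := fun (n : ℕ) z => ((1 / ((n : ℝ) + 1)))⁻¹ • (f z (x z + 1 / ((n : ℝ) + 1)) - f z (x z + 0)))
    (fun n => by
      exact (((hf (1 / ((n : ℝ) + 1))).sub (hf 0)).const_smul
        ((1 / ((n : ℝ) + 1))⁻¹)).aemeasurable) ?_
  filter_upwards [hd] with z hz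
  have h1 := hz.hasDerivAt.tendsto_slope_zero
  simp only [add_zero]
  refine h1.comp (tendsto_nhdsWithin_iff.2 ⟨tendsto_one_div_add_atTop_nhds_zero_nat, ?_⟩)
  exact Filter.Eventually.of_forall fun n => (by positivity : (1 / ((n : ℝ) + 1)) ≠ 0)

end FirstOrder

end FirmPanel

end

noncomputable section

namespace FirmPanel

/-! ### Productivity and shocks as functions of the observation. -/

section Inversion

/-- The derivative of the production function with respect to the intermediate input, at an
observation. -/
def derivM {J : ℕ} (θ : Theta J) (t : ℕ) (j : Fin J) (z : Obs) : ℝ :=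
  deriv (fun m => θ.F t j z.2.1 m (Real.exp (θ.ψ t j) * z.2.2.2)) z.2.2.1

/-- The derivative of the production function with respect to labor, at an observation. -/
def derivL {J : ℕ} (θ : Theta J) (t : ℕ) (j : Fin J) (z : Obs) : ℝ :=
  deriv (fun l => θ.F t j z.2.1 z.2.2.1 l) (Real.exp (θ.ψ t j) * z.2.2.2)

/-- Output net of productivity and shocks, at an observation. -/
def outputAt {J : ℕ} (θ : Theta J) (t : ℕ) (j : Fin J) (z : Obs) : ℝ :=
  θ.F t j z.2.1 z.2.2.1 (Real.exp (θ.ψ t j) * z.2.2.2)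

variable {E : Env} {θ : Theta E.J} {Ω : Type*} [MeasurableSpace Ω] {μ : Measure Ω}
  [IsProbabilityMeasure μ] {X : Vars E.J Ω}

namespace IsModel

variable (hX : IsModel E θ μ X) (j : Fin E.J)
include hX

theorem isProbabilityMeasure : IsProbabilityMeasure (X.P μ j) :=
  hX.types.isProbabilityMeasure j

theorem ae_mem_suppZ {t : ℕ} (ht : t ∈ Icc 1 E.T) :
    ∀ᵐ o ∂(X.P μ j), obs E X t o ∈ E.suppZ t := by
  obtain ⟨g₁, g, hd, -⟩ := hX.densities
  have := hX.isProbabilityMeasure j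
  exact hd.ae_mem_suppZ j ht

omit [IsProbabilityMeasure μ] in
theorem measurable_outputAt {t : ℕ} (ht : t ∈ Icc 1 E.T) : Measurable (outputAt θ t j) := by
  have h := (hX.production j t ht).1
  have h2 : Measurable fun z : Obs =>
    ((z.2.1, z.2.2.1, Real.exp (θ.ψ t j) * z.2.2.2) : ℝ × ℝ × ℝ) := by fun_prop
  exact h.comp h2

/-- The production, wage bill and first-order equations at an observation. -/
theorem ae_equations {t : ℕ} (ht : t ∈ Icc 1 E.T) :
    ∀ᵐ o ∂(X.P μ j), obs E X t o ∈ E.suppZ t ∧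
      X.Y t o = Real.exp (X.ω t o + X.ε t o) * outputAt θ t j (obs E X t o) ∧
      X.B t o = Real.exp (X.v t o + X.ζ t o) * θ.PL t * (Real.exp (θ.ψ t j) * X.N t o) ∧
      0 < outputAt θ t j (obs E X t o) ∧
      DifferentiableAt ℝ (fun m => θ.F t j (X.K t o) m (Real.exp (θ.ψ t j) * X.N t o)) (X.M t o) ∧
      DifferentiableAt ℝ (fun l => θ.F t j (X.K t o) (X.M t o) l)
        (Real.exp (θ.ψ t j) * X.N t o) ∧
      E.PY t * (∫ o, Real.exp (X.ε t o) ∂(X.P μ j)) * Real.exp (X.ω t o) *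
        derivM θ t j (obs E X t o) = E.PM t ∧
      E.PY t * (∫ o, Real.exp (X.ε t o) ∂(X.P μ j)) * Real.exp (X.ω t o) *
        derivL θ t j (obs E X t o) =
          (∫ o, Real.exp (X.ζ t o) ∂(X.P μ j)) * Real.exp (X.v t o) * θ.PL t := by
  obtain ⟨Md, Ld, -, -, hdem, -⟩ := hX.demand j t ht
  filter_upwards [hX.ae_mem_suppZ j ht, (hX.equations j).1 t ht, hdem] with o hz heq hd
  obtain ⟨hY, hL, hB⟩ := heq
  obtain ⟨-, -, hmem, hmax⟩ := hd
  have hprod := (hX.production j t ht).2 _ hz.2.1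
  rw [hL] at hY hB hmem hmax
  obtain ⟨⟨d1, f1⟩, d2, f2⟩ := first_order_conditions (F := fun m l => θ.F t j (X.K t o) m l)
    (E.suppM_open t ht) (isOpen_suppL E θ ht j)
    hprod.2.1 (A := E.PY t * (∫ o, Real.exp (X.ε t o) ∂(X.P μ j)) * Real.exp (X.ω t o))
    (b := E.PM t)
    (c := (∫ o, Real.exp (X.ζ t o) ∂(X.P μ j)) * Real.exp (X.v t o) * θ.PL t)
    hmem.1 hmem.2 hmax
  exact ⟨hz, hY, hB, hprod.1 _ hmem, d1, d2, f1, f2⟩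

theorem integral_exp_shock_pos {t : ℕ} (ht : t ∈ Icc 1 E.T) :
    0 < ∫ o, Real.exp (X.ε t o) ∂(X.P μ j) ∧ 0 < ∫ o, Real.exp (X.ζ t o) ∂(X.P μ j) := by
  have := hX.isProbabilityMeasure j
  obtain ⟨-, -, -, -, -, -, h1, h2⟩ := (hX.shocks j).1 t ht
  exact ⟨integral_exp_pos h1, integral_exp_pos h2⟩

omit [IsProbabilityMeasure μ] in
theorem differentiableAt_output {t : ℕ} (ht : t ∈ Icc 1 E.T) {k m l : ℝ} (hk : k ∈ E.suppK t)
    (hm : m ∈ E.suppM t) (hl : l ∈ suppL E θ t j) :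
    DifferentiableAt ℝ (fun p : ℝ × ℝ => θ.F t j k p.1 p.2) (m, l) :=
  (((hX.production j t ht).2 k hk).2.1.differentiableOn (by norm_num)).differentiableAt
    (((E.suppM_open t ht).prod (isOpen_suppL E θ ht j)).mem_nhds ⟨hm, hl⟩)

theorem ae_mem_supp_inputs {t : ℕ} (ht : t ∈ Icc 1 E.T) :
    ∀ᵐ x ∂((X.P μ j).map fun o => (obs E X t o).2),
      x ∈ E.suppK t ×ˢ E.suppM t ×ˢ E.suppN t := by
  refine (ae_map_iff (measurable_obs E X t).snd.aemeasurable
    ((E.suppK_open t ht).prod ((E.suppM_open t ht).prod (E.suppN_open t ht))).measurableSet).2 ?_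
  filter_upwards [hX.ae_mem_suppZ j ht] with o ho using ho.2

/-- The derivative with respect to the intermediate input is a measurable function of the inputs. -/
theorem exists_measurable_derivM {t : ℕ} (ht : t ∈ Icc 1 E.T) :
    ∃ D : ℝ × ℝ × ℝ → ℝ, Measurable D ∧
      ∀ᵐ z ∂((X.P μ j).map (obs E X t)), derivM θ t j z = D z.2 := by
  have hF := (hX.production j t ht).1
  have h : AEMeasurable (fun x : ℝ × ℝ × ℝ =>
      deriv (fun m => θ.F t j x.1 m (Real.exp (θ.ψ t j) * x.2.2)) x.2.1)
      ((X.P μ j).map fun o => (obs E X t o).2) := by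
    refine aemeasurable_deriv
      (f := fun (x : ℝ × ℝ × ℝ) m => θ.F t j x.1 m (Real.exp (θ.ψ t j) * x.2.2))
      (x := fun (x : ℝ × ℝ × ℝ) => x.2.1) (fun c => ?_) ?_
    · have h2 : Measurable fun x : ℝ × ℝ × ℝ =>
        ((x.1, x.2.1 + c, Real.exp (θ.ψ t j) * x.2.2) : ℝ × ℝ × ℝ) := by fun_prop
      exact hF.comp h2
    · filter_upwards [hX.ae_mem_supp_inputs j ht] with x hx
      exact DifferentiableAt.comp (f := fun m : ℝ => (m, Real.exp (θ.ψ t j) * x.2.2)) x.2.1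
        (hX.differentiableAt_output j ht hx.1 hx.2.1 (mem_image_of_mem _ hx.2.2))
        (by fun_prop)
  have h1 : ∀ᵐ x ∂(((X.P μ j).map (obs E X t)).map Prod.snd),
      deriv (fun m => θ.F t j x.1 m (Real.exp (θ.ψ t j) * x.2.2)) x.2.1 = h.mk _ x := by
    rw [Measure.map_map measurable_snd (measurable_obs E X t)]
    exact h.ae_eq_mk
  exact ⟨h.mk, h.measurable_mk, ae_of_ae_map measurable_snd.aemeasurable h1⟩

/-- The derivative with respect to labor is a measurable function of the inputs. -/
theorem exists_measurable_derivL {t : ℕ} (ht : t ∈ Icc 1 E.T) :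
    ∃ D : ℝ × ℝ × ℝ → ℝ, Measurable D ∧
      ∀ᵐ z ∂((X.P μ j).map (obs E X t)), derivL θ t j z = D z.2 := by
  have hF := (hX.production j t ht).1
  have h : AEMeasurable (fun x : ℝ × ℝ × ℝ =>
      deriv (fun l => θ.F t j x.1 x.2.1 l) (Real.exp (θ.ψ t j) * x.2.2))
      ((X.P μ j).map fun o => (obs E X t o).2) := by
    refine aemeasurable_deriv
      (f := fun (x : ℝ × ℝ × ℝ) l => θ.F t j x.1 x.2.1 l)
      (x := fun (x : ℝ × ℝ × ℝ) => Real.exp (θ.ψ t j) * x.2.2) (fun c => ?_) ?_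
    · have h2 : Measurable fun x : ℝ × ℝ × ℝ =>
        ((x.1, x.2.1, Real.exp (θ.ψ t j) * x.2.2 + c) : ℝ × ℝ × ℝ) := by fun_prop
      exact hF.comp h2
    · filter_upwards [hX.ae_mem_supp_inputs j ht] with x hx
      exact DifferentiableAt.comp (f := fun l : ℝ => (x.2.1, l)) (Real.exp (θ.ψ t j) * x.2.2)
        (hX.differentiableAt_output j ht hx.1 hx.2.1 (mem_image_of_mem _ hx.2.2))
        (by fun_prop)
  have h1 : ∀ᵐ x ∂(((X.P μ j).map (obs E X t)).map Prod.snd),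
      deriv (fun l => θ.F t j x.1 x.2.1 l) (Real.exp (θ.ψ t j) * x.2.2) = h.mk _ x := by
    rw [Measure.map_map measurable_snd (measurable_obs E X t)]
    exact h.ae_eq_mk
  exact ⟨h.mk, h.measurable_mk, ae_of_ae_map measurable_snd.aemeasurable h1⟩

/-- The cost shares, the wage bill per worker and the first-order condition for the intermediate
input, in terms of the observation and the unobserved variables. -/
theorem ae_shares {t : ℕ} (ht : t ∈ Icc 1 E.T) :
    ∀ᵐ o ∂(X.P μ j), obs E X t o ∈ E.suppZ t ∧
      (obs E X t o).1.1 * Real.exp (X.ε t o) * outputAt θ t j (obs E X t o) =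
        (∫ o, Real.exp (X.ε t o) ∂(X.P μ j)) * derivM θ t j (obs E X t o) * X.M t o ∧
      (∫ o, Real.exp (X.ζ t o) ∂(X.P μ j)) * (obs E X t o).1.2 * Real.exp (X.ε t o) *
        outputAt θ t j (obs E X t o) =
        (∫ o, Real.exp (X.ε t o) ∂(X.P μ j)) * Real.exp (X.ζ t o) * derivL θ t j (obs E X t o) *
          (Real.exp (θ.ψ t j) * X.N t o) ∧
      E.PM t * X.M t o * (obs E X t o).1.2 =
        Real.exp (X.v t o) * Real.exp (X.ζ t o) * θ.PL t * Real.exp (θ.ψ t j) * X.N t o *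
          (obs E X t o).1.1 ∧
      E.PY t * (∫ o, Real.exp (X.ε t o) ∂(X.P μ j)) * Real.exp (X.ω t o) *
        derivM θ t j (obs E X t o) = E.PM t ∧
      0 < outputAt θ t j (obs E X t o) := by
  filter_upwards [hX.ae_equations j ht] with o ho
  obtain ⟨hz, hY, hB, hpos, -, -, f1, f2⟩ := ho
  have hPY := (E.PY_pos t ht).ne'
  have e1 := (Real.exp_pos (X.ω t o)).ne'
  have e2 := (Real.exp_pos (X.ε t o)).ne'
  refine ⟨hz, ?_, ?_, ?_, f1, hpos⟩
  · have : (obs E X t o).1.1 = E.PM t * X.M t o / (E.PY t * X.Y t o) := rfl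
    rw [this, hY, ← f1, Real.exp_add]
    have hp := hpos.ne'
    field_simp
  · have : (obs E X t o).1.2 = X.B t o / (E.PY t * X.Y t o) := rfl
    rw [this, hY, hB, Real.exp_add, Real.exp_add]
    have hp := hpos.ne'
    generalize (∫ o, Real.exp (X.ε t o) ∂(X.P μ j)) = cε at *
    generalize (∫ o, Real.exp (X.ζ t o) ∂(X.P μ j)) = cζ at *
    have h1 : cζ * (Real.exp (X.v t o) * Real.exp (X.ζ t o) * θ.PL t *
        (Real.exp (θ.ψ t j) * X.N t o) / (E.PY t * (Real.exp (X.ω t o) * Real.exp (X.ε t o) *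
        outputAt θ t j (obs E X t o)))) * Real.exp (X.ε t o) * outputAt θ t j (obs E X t o) =
        cζ * Real.exp (X.v t o) * θ.PL t * (Real.exp (X.ζ t o) *
          (Real.exp (θ.ψ t j) * X.N t o)) / (E.PY t * Real.exp (X.ω t o)) := by
      field_simp
    rw [h1, ← f2]
    field_simp
  · have h1 : (obs E X t o).1.2 = X.B t o / (E.PY t * X.Y t o) := rfl
    have h2 : (obs E X t o).1.1 = E.PM t * X.M t o / (E.PY t * X.Y t o) := rfl
    rw [h1, h2, hB, Real.exp_add]
    ring

/-- Productivity and the shocks are functions of the observation. -/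
theorem exists_inversion {t : ℕ} (ht : t ∈ Icc 1 E.T) :
    ∃ rω rv rε rζ : Obs → ℝ, (Measurable rω ∧ Measurable rv ∧ Measurable rε ∧ Measurable rζ) ∧
      ∀ᵐ o ∂(X.P μ j), X.ω t o = rω (obs E X t o) ∧ X.v t o = rv (obs E X t o) ∧
        X.ε t o = rε (obs E X t o) ∧ X.ζ t o = rζ (obs E X t o) := by
  obtain ⟨hε, hζ⟩ := hX.integral_exp_shock_pos j ht
  have hFo := hX.measurable_outputAt j ht
  obtain ⟨DM, hM, hDM⟩ := hX.exists_measurable_derivM j ht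
  obtain ⟨DL, hL, hDL⟩ := hX.exists_measurable_derivL j ht
  set cε := ∫ o, Real.exp (X.ε t o) ∂(X.P μ j) with hcε
  set cζ := ∫ o, Real.exp (X.ζ t o) ∂(X.P μ j) with hcζ
  -- The system is triangular: the first-order condition for the intermediate input gives ω and its
  -- cost share gives ε; then the first-order condition for labor gives v from ω, and the ratio of
  -- the two shares gives ζ from v.
  let rω : Obs → ℝ := fun z => Real.log (E.PM t / (E.PY t * cε * DM z.2))
  let rε : Obs → ℝ := fun z => Real.log (cε * DM z.2 * z.2.2.1 / (z.1.1 * outputAt θ t j z))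
  let rv : Obs → ℝ := fun z => Real.log (E.PY t * cε * Real.exp (rω z) * DL z.2 / (cζ * θ.PL t))
  let rζ : Obs → ℝ := fun z => Real.log (E.PM t * z.2.2.1 * z.1.2 /
    (Real.exp (rv z) * θ.PL t * Real.exp (θ.ψ t j) * z.2.2.2 * z.1.1))
  have mω : Measurable rω := by fun_prop
  have mv : Measurable rv := by fun_prop
  have mε : Measurable rε := by fun_prop
  have mζ : Measurable rζ := by fun_prop
  refine ⟨rω, rv, rε, rζ, ⟨mω, mv, mε, mζ⟩, ?_⟩
  have hPY := E.PY_pos t ht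
  have hPM := E.PM_pos t ht
  have hPL := (hX.wages t ht).1
  filter_upwards [hX.ae_shares j ht, hX.ae_equations j ht,
    ae_of_ae_map (measurable_obs E X t).aemeasurable hDM,
    ae_of_ae_map (measurable_obs E X t).aemeasurable hDL] with o h1 h2 h3 h4
  obtain ⟨hz, s1, s2, s3, f1, hpos⟩ := h1
  obtain ⟨-, -, -, -, -, -, -, f2⟩ := h2
  rw [← hcε] at f1 s1 s2 f2
  rw [← hcζ] at f2 s2
  have hsM := (E.suppS_pos t ht hz.1).1
  have hsL := (E.suppS_pos t ht hz.1).2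
  have hm := E.suppM_pos t ht hz.2.2.1
  have hn := E.suppN_pos t ht hz.2.2.2
  simp only [mem_Ioi] at hsM hsL hm hn
  have eM : (obs E X t o).2.2.1 = X.M t o := rfl
  have eN : (obs E X t o).2.2.2 = X.N t o := rfl
  rw [h3] at f1 s1
  rw [h4] at f2 s2
  -- The marginal product cannot vanish, since the first-order condition equates a multiple of it to
  -- the positive input price.
  have hDMpos : DM (obs E X t o).2 ≠ 0 := fun h0 => by
    rw [h0, mul_zero] at f1
    exact hPM.ne f1
  have Eω : X.ω t o = rω (obs E X t o) := by
    simp only [rω]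
    rw [← f1, mul_right_comm, mul_div_cancel_left₀, Real.log_exp]
    exact mul_ne_zero (mul_ne_zero hPY.ne' hε.ne') hDMpos
  have Ev : X.v t o = rv (obs E X t o) := by
    simp only [rv]
    rw [← Eω, f2, mul_right_comm, mul_div_cancel_left₀, Real.log_exp]
    exact mul_ne_zero hζ.ne' hPL.ne'
  refine ⟨Eω, Ev, ?_, ?_⟩
  · simp only [rε]
    rw [eM, ← s1, mul_right_comm, mul_div_cancel_left₀, Real.log_exp]
    exact mul_ne_zero hsM.ne' hpos.ne'
  · simp only [rζ]
    rw [eM, s3, ← Ev, eN]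
    have hn' : X.N t o ≠ 0 := hn.ne'
    have : Real.exp (X.v t o) * Real.exp (X.ζ t o) * θ.PL t * Real.exp (θ.ψ t j) * X.N t o *
        (obs E X t o).1.1 / (Real.exp (X.v t o) * θ.PL t * Real.exp (θ.ψ t j) * X.N t o *
        (obs E X t o).1.1) = Real.exp (X.ζ t o) := by
      have := hsM.ne'
      field_simp
    rw [this, Real.log_exp]

end IsModel

end Inversion

end FirmPanel

end

noncomputable section

namespace FirmPanel

/-! ### Measurability up to null sets, and integration over independent variables. -/

section Determined

/-- `V` agrees almost surely with a variable that is measurable with respect to `m`. -/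
def DeterminedBy {Ω α : Type*} [MeasurableSpace α] (m : MeasurableSpace Ω) {_ : MeasurableSpace Ω}
    (P : Measure Ω) (V : Ω → α) : Prop :=
  ∃ V', Measurable[m] V' ∧ V =ᵐ[P] V'

variable {Ω α β : Type*} {m m' : MeasurableSpace Ω} {mΩ : MeasurableSpace Ω} [MeasurableSpace α]
  [MeasurableSpace β] {P : Measure Ω} {V : Ω → α} {W : Ω → β}

theorem DeterminedBy.mono (h : DeterminedBy m P V) (hm : m ≤ m') : DeterminedBy m' P V := by
  obtain ⟨V', h1, h2⟩ := h
  exact ⟨V', h1.mono hm le_rfl, h2⟩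

theorem DeterminedBy.prodMk (hV : DeterminedBy m P V) (hW : DeterminedBy m P W) :
    DeterminedBy m P (fun o => (V o, W o)) := by
  obtain ⟨V', h1, h2⟩ := hV
  obtain ⟨W', h3, h4⟩ := hW
  refine ⟨fun o => (V' o, W' o), h1.prodMk h3, ?_⟩
  filter_upwards [h2, h4] with o ho ho'
  rw [ho, ho']

theorem DeterminedBy.comp (hV : DeterminedBy m P V) {f : α → β} (hf : Measurable f) :
    DeterminedBy m P (f ∘ V) := by
  obtain ⟨V', h1, h2⟩ := hV
  exact ⟨f ∘ V', hf.comp h1, h2.fun_comp f⟩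

theorem Measurable.determinedBy (hV : Measurable[m] V) : DeterminedBy m P V :=
  ⟨V, hV, ae_eq_rfl⟩

/-- Integration over an independent variable. -/
theorem lintegral_of_indep [IsProbabilityMeasure P] (hm : m ≤ mΩ)
    (hV : Measurable[m] V) (hW : Measurable W)
    (h : Indep (MeasurableSpace.comap W inferInstance) m P) {φ : α × β → ENNReal}
    (hφ : Measurable φ) :
    ∫⁻ o, φ (V o, W o) ∂P = ∫⁻ o, ∫⁻ y, φ (V o, y) ∂(P.map W) ∂P := by
  have hV' : Measurable V := hV.mono hm le_rfl
  have hi : IndepFun V W P :=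
    (IndepFun_iff_Indep V W P).2 (indep_of_indep_of_le_right h hV.comap_le).symm
  rw [indepFun_iff_map_prod_eq_prod_map_map hV'.aemeasurable hW.aemeasurable] at hi
  have : IsProbabilityMeasure (P.map W) := Measure.isProbabilityMeasure_map hW.aemeasurable
  calc ∫⁻ o, φ (V o, W o) ∂P = ∫⁻ p, φ p ∂(P.map fun o => (V o, W o)) :=
        (lintegral_map hφ (hV'.prodMk hW)).symm
    _ = ∫⁻ v, ∫⁻ y, φ (v, y) ∂(P.map W) ∂(P.map V) := by
        rw [hi, lintegral_prod _ hφ.aemeasurable]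
    _ = _ := lintegral_map hφ.lintegral_prod_right' hV'

/-- An integrable centered variable has integral zero over every independent event. -/
theorem setIntegral_eq_zero_of_indep [IsProbabilityMeasure P] (hm : m ≤ mΩ) {f : Ω → ℝ}
    (hf : Measurable[m'] f) (hm' : m' ≤ mΩ) (hfi : Integrable f P) (h : Indep m' m P)
    (h0 : ∫ o, f o ∂P = 0) {S : Set Ω} (hS : MeasurableSet[m] S) : ∫ o in S, f o ∂P = 0 := by
  have h1 := condExp_indep_eq hm' hm hf.stronglyMeasurable h
  rw [← setIntegral_condExp hm hfi hS, setIntegral_congr_ae (hm S hS)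
    (h1.mono fun x hx _ => hx)]
  simp [h0]

end Determined

/-! ### The Markov property of the observations, given the type. -/

section Markov

variable {E : Env} {θ : Theta E.J} {Ω : Type*} [mΩ : MeasurableSpace Ω] {μ : Measure Ω}
  [IsProbabilityMeasure μ] {X : Vars E.J Ω}

namespace Vars

variable {J : ℕ} (X : Vars J Ω)

theorem measurable_state (t : ℕ) :
    Measurable fun o => (X.K t o, X.ω t o, X.v t o, X.ε t o, X.ζ t o) :=
  (X.K_meas t).prodMk ((X.ω_meas t).prodMk ((X.v_meas t).prodMk
    ((X.ε_meas t).prodMk (X.ζ_meas t))))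

theorem history_le (t : ℕ) : X.history t ≤ mΩ :=
  iSup₂_le fun s _ => (X.measurable_state s).comap_le

theorem history_mono {s t : ℕ} (h : s ≤ t) : X.history s ≤ X.history t :=
  biSup_mono fun _ hr => ⟨hr.1, hr.2.trans h⟩

theorem info_le (t : ℕ) : X.info t ≤ mΩ :=
  sup_le (X.history_le _) (((X.K_meas t).prodMk
    ((X.ω_meas t).prodMk (X.v_meas t))).comap_le)

theorem measurable_history {t : ℕ} (ht : 1 ≤ t) :
    Measurable[X.history t] fun o => (X.K t o, X.ω t o, X.v t o, X.ε t o, X.ζ t o) := by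
  refine Measurable.mono (comap_measurable _) ?_ le_rfl
  exact le_biSup (fun s => MeasurableSpace.comap
    (fun o => (X.K s o, X.ω s o, X.v s o, X.ε s o, X.ζ s o)) inferInstance)
    (show t ∈ Icc 1 t from ⟨ht, le_rfl⟩)

end Vars

namespace IsModel

variable (hX : IsModel E θ μ X) (j : Fin E.J)
include hX

omit [IsProbabilityMeasure μ] in
/-- The observation is a function of the state of the firm; capital and inputs are a function of
the information of the period. -/
theorem exists_outcome {t : ℕ} (ht : t ∈ Icc 1 E.T) :
    ∃ (Ψ : (ℝ × ℝ × ℝ) × ℝ × ℝ → Obs) (Φ : ℝ × ℝ × ℝ → ℝ × ℝ × ℝ), Measurable Ψ ∧ Measurable Φ ∧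
      ∀ᵐ o ∂(X.P μ j), obs E X t o = Ψ ((X.K t o, X.ω t o, X.v t o), (X.ε t o, X.ζ t o)) ∧
        (obs E X t o).2 = Φ (X.K t o, X.ω t o, X.v t o) := by
  obtain ⟨Md, Ld, hMd, hLd, hdem, -⟩ := hX.demand j t ht
  have hF := (hX.production j t ht).1
  let y : (ℝ × ℝ × ℝ) × ℝ × ℝ → ℝ := fun p =>
    Real.exp (p.1.2.1 + p.2.1) * θ.F t j p.1.1 (Md p.1) (Ld p.1)
  have hy : Measurable y := by
    have h1 : Measurable fun p : (ℝ × ℝ × ℝ) × ℝ × ℝ => θ.F t j p.1.1 (Md p.1) (Ld p.1) :=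
      hF.comp (measurable_fst.fst.prodMk ((hMd.comp measurable_fst).prodMk
        (hLd.comp measurable_fst)))
    fun_prop
  -- Demand is for effective labor; dividing by e^ψ returns the observed number of workers.
  let Φ : ℝ × ℝ × ℝ → ℝ × ℝ × ℝ := fun p => (p.1, Md p, (Real.exp (θ.ψ t j))⁻¹ * Ld p)
  have hΦ : Measurable Φ := by fun_prop
  refine ⟨fun p => ((E.PM t * Md p.1 / (E.PY t * y p),
    Real.exp (p.1.2.2 + p.2.2) * θ.PL t * Ld p.1 / (E.PY t * y p)), Φ p.1), Φ, ?_, hΦ, ?_⟩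
  · fun_prop
  · filter_upwards [hdem, (hX.equations j).1 t ht] with o h1 h2
    obtain ⟨hM, hL, -⟩ := h1
    obtain ⟨hY, hLN, hB⟩ := h2
    have hN : X.N t o = (Real.exp (θ.ψ t j))⁻¹ * X.L t o := by
      rw [hLN, inv_mul_cancel_left₀ (Real.exp_pos _).ne']
    constructor
    · simp only [obs, y, Φ]
      rw [hY, hB, hN, hM, hL]
    · simp only [obs, Φ]
      rw [hN, hM, hL]

omit [IsProbabilityMeasure μ] in
theorem obs_determinedBy_history {t : ℕ} (ht : t ∈ Icc 1 E.T) :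
    DeterminedBy (X.history t) (X.P μ j) (obs E X t) := by
  obtain ⟨Ψ, Φ, hΨ, hΦ, h⟩ := hX.exists_outcome j ht
  refine ⟨_, ?_, h.mono fun o ho => ho.1⟩
  have hre : Measurable fun p : ℝ × ℝ × ℝ × ℝ × ℝ =>
    (((p.1, p.2.1, p.2.2.1), (p.2.2.2.1, p.2.2.2.2)) : (ℝ × ℝ × ℝ) × ℝ × ℝ) := by fun_prop
  exact (hΨ.comp hre).comp (X.measurable_history ht.1)

omit [IsProbabilityMeasure μ] in
theorem inputs_determinedBy_info {t : ℕ} (ht : t ∈ Icc 1 E.T) :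
    DeterminedBy (X.info t) (X.P μ j) (fun o => (obs E X t o).2) := by
  obtain ⟨Ψ, Φ, hΨ, hΦ, h⟩ := hX.exists_outcome j ht
  refine ⟨_, ?_, h.mono fun o ho => ho.2⟩
  exact hΦ.comp (Measurable.mono (comap_measurable _) le_sup_right le_rfl)

/-- Integration over capital, given the past. -/
theorem exists_capital_kernel {t : ℕ} (ht : t ∈ Icc 2 E.T) :
    ∃ gK : ℝ × ℝ × ℝ → ENNReal, Measurable gK ∧
      ∀ {α : Type} [MeasurableSpace α] (V : Ω → α), Measurable[X.history (t - 1)] V →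
      ∀ φ : α × ℝ → ENNReal, Measurable φ →
        ∫⁻ o, φ (V o, X.K t o) ∂(X.P μ j) =
          ∫⁻ o, (∫⁻ k, φ (V o, k) * gK (k, X.K (t - 1) o, X.ω (t - 1) o) ∂volume) ∂(X.P μ j) := by
  have := hX.isProbabilityMeasure j
  obtain ⟨gK, hgK, h⟩ := hX.capital j t ht
  refine ⟨gK, hgK, fun {α} _ V hV φ hφ => ?_⟩
  have hV' : Measurable V := hV.mono (X.history_le _) le_rfl
  have hK := X.K_meas (t - 1)
  have hω := X.ω_meas (t - 1)
  set κ : Ω × ℝ → ENNReal := fun p => gK (p.2, X.K (t - 1) p.1, X.ω (t - 1) p.1) with hκ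
  have hκm : Measurable κ := by fun_prop
  have hpm : Measurable fun p : Ω × ℝ => (V p.1, p.2) := by fun_prop
  -- The assumption on capital concerns events only. Its values on rectangles determine the joint
  -- law of `V` and capital, and hence the integral of any function of both.
  have key : (X.P μ j).map (fun o => (V o, X.K t o)) =
      (((X.P μ j).prod volume).withDensity κ).map (fun p => (V p.1, p.2)) := by
    have : IsProbabilityMeasure ((X.P μ j).map (fun o => (V o, X.K t o))) :=
      Measure.isProbabilityMeasure_map (hV'.prodMk (X.K_meas t)).aemeasurable
    refine Measure.ext_prod fun {s A} hs hA => ?_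
    rw [Measure.map_apply (hV'.prodMk (X.K_meas t)) (hs.prod hA),
      Measure.map_apply hpm (hs.prod hA)]
    have e1 : (fun o => (V o, X.K t o)) ⁻¹' (s ×ˢ A) = X.K t ⁻¹' A ∩ V ⁻¹' s := by
      ext o; simp [and_comm]
    have e2 : (fun p : Ω × ℝ => (V p.1, p.2)) ⁻¹' (s ×ˢ A) = (V ⁻¹' s) ×ˢ A := rfl
    rw [e1, e2, h A hA _ (hV hs), withDensity_apply _ ((hV' hs).prod hA),
      setLIntegral_prod _ hκm.aemeasurable]
  calc ∫⁻ o, φ (V o, X.K t o) ∂(X.P μ j)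
      = ∫⁻ p, φ p ∂((X.P μ j).map (fun o => (V o, X.K t o))) :=
        (lintegral_map hφ (hV'.prodMk (X.K_meas t))).symm
    _ = ∫⁻ p, κ p * φ (V p.1, p.2) ∂((X.P μ j).prod volume) := by
        rw [key, lintegral_map hφ hpm]
        exact lintegral_withDensity_eq_lintegral_mul _ hκm (hφ.comp hpm)
    _ = _ := by
        refine (lintegral_prod (fun p => κ p * φ (V p.1, p.2))
          (hκm.mul (hφ.comp hpm)).aemeasurable).trans ?_
        simp only [mul_comm, hκ]

/-- The law of an observation given the past depends on capital and productivity of the period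
before. -/
theorem exists_transition_state {t : ℕ} (ht : t ∈ Icc 2 E.T) {f : Obs → ENNReal}
    (hf : Measurable f) :
    ∃ u : ℝ × ℝ → ENNReal, Measurable u ∧ ∀ W : Ω → ENNReal, Measurable[X.history (t - 1)] W →
      ∫⁻ o, W o * f (obs E X t o) ∂(X.P μ j) =
        ∫⁻ o, W o * u (X.K (t - 1) o, X.ω (t - 1) o) ∂(X.P μ j) := by
  have := hX.isProbabilityMeasure j
  have ht1 := periods_of_two ht
  have ht0 := one_mem_periods ht
  obtain ⟨Ψ, Φ, hΨ, hΦ, hZ⟩ := hX.exists_outcome j ht1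
  obtain ⟨gK, hgK, hcap⟩ := hX.exists_capital_kernel j ht
  obtain ⟨hh, hω⟩ := (hX.equations j).2 t ht
  obtain ⟨iε, iv⟩ := (hX.timing j).1 t ht1
  have iη := (hX.timing j).2 t ht
  have mε : Measurable fun o => (X.ε t o, X.ζ t o) := (X.ε_meas t).prodMk (X.ζ_meas t)
  have : IsProbabilityMeasure ((X.P μ j).map fun o => (X.ε t o, X.ζ t o)) :=
    Measure.isProbabilityMeasure_map mε.aemeasurable
  have : IsProbabilityMeasure ((X.P μ j).map (X.v t)) :=
    Measure.isProbabilityMeasure_map (X.v_meas t).aemeasurable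
  have : IsProbabilityMeasure ((X.P μ j).map (X.η t)) :=
    Measure.isProbabilityMeasure_map (X.η_meas t).aemeasurable
  -- The variables of period t are integrated out in the reverse order of their realization: (ε, ζ),
  -- then v, then η after ω is replaced by h(ω_{t-1}) + η, and finally capital. Each independence
  -- assumption covers exactly what remains at its turn.
  let f₁ : ℝ × ℝ × ℝ → ENNReal := fun s =>
    ∫⁻ x, f (Ψ (s, x)) ∂((X.P μ j).map fun o => (X.ε t o, X.ζ t o))
  have hf₁ : Measurable f₁ := (hf.comp hΨ).lintegral_prod_right'
  let f₂ : ℝ × ℝ → ENNReal := fun s => ∫⁻ y, f₁ (s.1, s.2, y) ∂((X.P μ j).map (X.v t))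
  have hf₂ : Measurable f₂ := by
    have : Measurable fun p : (ℝ × ℝ) × ℝ => f₁ (p.1.1, p.1.2, p.2) := by fun_prop
    exact this.lintegral_prod_right'
  let f₃ : ℝ × ℝ → ENNReal := fun s =>
    ∫⁻ e, f₂ (s.1, θ.h t j s.2 + e) ∂((X.P μ j).map (X.η t))
  have hf₃ : Measurable f₃ := by
    have : Measurable fun p : (ℝ × ℝ) × ℝ => f₂ (p.1.1, θ.h t j p.1.2 + p.2) := by fun_prop
    exact this.lintegral_prod_right'
  let u : ℝ × ℝ → ENNReal := fun s => ∫⁻ k, f₃ (k, s.2) * gK (k, s.1, s.2)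
  have hu : Measurable u := by
    have : Measurable fun p : (ℝ × ℝ) × ℝ => f₃ (p.2, p.1.2) * gK (p.2, p.1.1, p.1.2) := by
      fun_prop
    exact this.lintegral_prod_right'
  refine ⟨u, hu, fun W hW => ?_⟩
  have hle := X.history_le (t - 1)
  have hpast := X.measurable_history ht0.1
  calc ∫⁻ o, W o * f (obs E X t o) ∂(X.P μ j)
      = ∫⁻ o, W o * f (Ψ ((X.K t o, X.ω t o, X.v t o), (X.ε t o, X.ζ t o))) ∂(X.P μ j) := by
        refine lintegral_congr_ae ?_
        filter_upwards [hZ] with o ho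
        rw [ho.1]
    _ = ∫⁻ o, W o * f₁ (X.K t o, X.ω t o, X.v t o) ∂(X.P μ j) := by
        have hV : Measurable[X.info t] fun o => (W o, (X.K t o, X.ω t o, X.v t o)) :=
          (hW.mono le_sup_left le_rfl).prodMk (Measurable.mono (comap_measurable _) le_sup_right le_rfl)
        have hφ : Measurable fun p : (ENNReal × ℝ × ℝ × ℝ) × ℝ × ℝ =>
          p.1.1 * f (Ψ (p.1.2, p.2)) := by fun_prop
        rw [lintegral_of_indep (X.info_le t) hV mε iε hφ]
        refine lintegral_congr fun o => ?_
        exact lintegral_const_mul _ (by fun_prop)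
    _ = ∫⁻ o, W o * f₂ (X.K t o, X.ω t o) ∂(X.P μ j) := by
        have hm : X.history (t - 1) ⊔ MeasurableSpace.comap (fun o => (X.K t o, X.ω t o))
            inferInstance ≤ mΩ :=
          sup_le hle (((X.K_meas t).prodMk (X.ω_meas t)).comap_le)
        have hV : Measurable[X.history (t - 1) ⊔ MeasurableSpace.comap
            (fun o => (X.K t o, X.ω t o)) inferInstance] fun o => (W o, (X.K t o, X.ω t o)) :=
          (hW.mono le_sup_left le_rfl).prodMk (Measurable.mono (comap_measurable _) le_sup_right le_rfl)
        have hφ : Measurable fun p : (ENNReal × ℝ × ℝ) × ℝ =>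
          p.1.1 * f₁ (p.1.2.1, p.1.2.2, p.2) := by fun_prop
        have := lintegral_of_indep hm hV (X.v_meas t) iv hφ
        simp only at this
        rw [this]
        refine lintegral_congr fun o => ?_
        exact lintegral_const_mul _ (by fun_prop)
    _ = ∫⁻ o, W o * f₂ (X.K t o, θ.h t j (X.ω (t - 1) o) + X.η t o) ∂(X.P μ j) := by
        refine lintegral_congr_ae ?_
        filter_upwards [hω] with o ho
        rw [ho]
    _ = ∫⁻ o, W o * f₃ (X.K t o, X.ω (t - 1) o) ∂(X.P μ j) := by
        have hm : X.history (t - 1) ⊔ MeasurableSpace.comap (X.K t) inferInstance ≤ mΩ :=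
          sup_le hle (X.K_meas t).comap_le
        have hV : Measurable[X.history (t - 1) ⊔ MeasurableSpace.comap (X.K t) inferInstance]
            fun o => (W o, (X.K t o, X.ω (t - 1) o)) :=
          (hW.mono le_sup_left le_rfl).prodMk ((Measurable.mono (comap_measurable _) le_sup_right le_rfl).prodMk
            ((measurable_fst.comp (measurable_snd.comp hpast)).mono le_sup_left le_rfl))
        have hφ : Measurable fun p : (ENNReal × ℝ × ℝ) × ℝ =>
          p.1.1 * f₂ (p.1.2.1, θ.h t j p.1.2.2 + p.2) := by fun_prop
        have := lintegral_of_indep hm hV (X.η_meas t) iη hφ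
        simp only at this
        rw [this]
        refine lintegral_congr fun o => ?_
        exact lintegral_const_mul _ (by fun_prop)
    _ = ∫⁻ o, W o * u (X.K (t - 1) o, X.ω (t - 1) o) ∂(X.P μ j) := by
        have hV : Measurable[X.history (t - 1)] fun o => (W o, X.ω (t - 1) o) :=
          hW.prodMk (measurable_fst.comp (measurable_snd.comp hpast))
        have hφ : Measurable fun p : (ENNReal × ℝ) × ℝ => p.1.1 * f₃ (p.2, p.1.2) := by fun_prop
        have := hcap _ hV _ hφ
        simp only at this
        rw [this]
        refine lintegral_congr fun o => ?_
        simp only [mul_assoc]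
        exact lintegral_const_mul _ (by fun_prop)

/-- The observations form a Markov chain, given the type. -/
theorem exists_transition {t : ℕ} (ht : t ∈ Icc 2 E.T) {f : Obs → ENNReal}
    (hf : Measurable f) :
    ∃ u : Obs → ENNReal, Measurable u ∧
      ∀ W : Ω → ENNReal, DeterminedBy (X.history (t - 1)) (X.P μ j) W →
      ∫⁻ o, W o * f (obs E X t o) ∂(X.P μ j) =
        ∫⁻ o, W o * u (obs E X (t - 1) o) ∂(X.P μ j) := by
  obtain ⟨u, hu, h⟩ := hX.exists_transition_state j ht hf
  obtain ⟨rω, rv, rε, rζ, ⟨hrω, -⟩, hr⟩ := hX.exists_inversion j (one_mem_periods ht)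
  -- Lagged capital is a coordinate of the lagged observation and lagged productivity is a function
  -- of it, so the state is observable.
  refine ⟨fun z => u (z.2.1, rω z), by fun_prop, fun W hW => ?_⟩
  obtain ⟨W', hW', hWW⟩ := hW
  calc ∫⁻ o, W o * f (obs E X t o) ∂(X.P μ j)
      = ∫⁻ o, W' o * f (obs E X t o) ∂(X.P μ j) := by
        refine lintegral_congr_ae ?_
        filter_upwards [hWW] with o ho
        rw [ho]
    _ = ∫⁻ o, W' o * u (X.K (t - 1) o, X.ω (t - 1) o) ∂(X.P μ j) := h W' hW'
    _ = _ := by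
        refine lintegral_congr_ae ?_
        filter_upwards [hWW, hr] with o ho ho'
        rw [ho, ← ho'.1]
        rfl

variable {g₁ : Fin E.J → Obs → ℝ} {g : ℕ → Fin E.J → Obs → Obs → ℝ}

/-- The joint law of the past and of an observation. -/
theorem map_prodMk_obs (hd : TypeDensities E μ X g₁ g) {t : ℕ} (ht : t ∈ Icc 2 E.T) {α : Type}
    [MeasurableSpace α] {V : Ω → α} (hVm : Measurable V)
    (hV : DeterminedBy (X.history (t - 1)) (X.P μ j) V) {last : α → Obs} (hlast : Measurable last)
    (hlV : ∀ o, last (V o) = obs E X (t - 1) o) :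
    (X.P μ j).map (fun o => (V o, obs E X t o)) =
      (((X.P μ j).map V).prod volume).withDensity
        (fun p => transitionDensity E g t j (p.2, last p.1)) := by
  have := hX.isProbabilityMeasure j
  have hZ := measurable_obs E X t
  have hZ' := measurable_obs E X (t - 1)
  have hG := hd.measurable_transitionDensity j ht
  have : IsProbabilityMeasure ((X.P μ j).map V) :=
    Measure.isProbabilityMeasure_map hVm.aemeasurable
  have hQ : IsProbabilityMeasure ((X.P μ j).map (obs E X (t - 1))) :=
    Measure.isProbabilityMeasure_map hZ'.aemeasurable
  have hpm : IsProbabilityMeasure ((X.P μ j).map (fun o => (V o, obs E X t o))) :=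
    Measure.isProbabilityMeasure_map (hVm.prodMk hZ).aemeasurable
  have hGs : Measurable fun p : Obs × Obs => transitionDensity E g t j (p.2, p.1) :=
    hG.comp measurable_swap
  refine Measure.ext_prod fun {s A} hs hA => ?_
  obtain ⟨u, hu, h⟩ := hX.exists_transition j ht (f := A.indicator 1)
    (measurable_one.indicator hA)
  have hGA : Measurable fun z' => ∫⁻ z in A, transitionDensity E g t j (z, z') :=
    hGs.lintegral_prod_right'
  have hmeas : ∀ S, MeasurableSet S → DeterminedBy (X.history (t - 1)) (X.P μ j)
      (S.indicator (1 : Ω → ENNReal)) → (X.P μ j) (S ∩ obs E X t ⁻¹' A) =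
      ∫⁻ o in S, u (obs E X (t - 1) o) ∂(X.P μ j) := by
    intro S hS hdet
    have e := h _ hdet
    have e1 : ∀ o, S.indicator (1 : Ω → ENNReal) o * A.indicator 1 (obs E X t o) =
        (S ∩ obs E X t ⁻¹' A).indicator 1 o := by
      intro o
      by_cases h1 : o ∈ S <;> by_cases h2 : obs E X t o ∈ A <;> simp [h1, h2]
    have e2 : ∀ o, S.indicator (1 : Ω → ENNReal) o * u (obs E X (t - 1) o) =
        S.indicator (fun o => u (obs E X (t - 1) o)) o := by
      intro o
      by_cases h1 : o ∈ S <;> simp [h1]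
    simp only [e1, e2] at e
    rwa [lintegral_indicator_one (hS.inter (hZ hA)), lintegral_indicator hS] at e
  -- The kernel supplied by the Markov property is identified by testing it against events of the
  -- previous observation, which involves the pair law only. It then serves for an arbitrary past
  -- `V`.
  have hae : u =ᵐ[(X.P μ j).map (obs E X (t - 1))]
      fun z' => ∫⁻ z in A, transitionDensity E g t j (z, z') := by
    refine ae_eq_of_forall_setLIntegral_eq_of_sigmaFinite hu hGA fun C hC _ => ?_
    have hdet : DeterminedBy (X.history (t - 1)) (X.P μ j)
        ((obs E X (t - 1) ⁻¹' C).indicator (1 : Ω → ENNReal)) :=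
      (hX.obs_determinedBy_history j (one_mem_periods ht)).comp
        (f := C.indicator (1 : Obs → ENNReal)) (measurable_one.indicator hC)
    rw [setLIntegral_map hC hu hZ', ← hmeas _ (hZ' hC) hdet]
    have e : obs E X (t - 1) ⁻¹' C ∩ obs E X t ⁻¹' A =
      (fun o => (obs E X t o, obs E X (t - 1) o)) ⁻¹' (A ×ˢ C) := by
      ext o; simp [and_comm]
    rw [e, ← Measure.map_apply (hZ.prodMk hZ') (hA.prod hC), hd.map_obs_pair j ht,
      withDensity_apply _ (hA.prod hC), setLIntegral_prod_symm _ hG.aemeasurable]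
  have hdet : DeterminedBy (X.history (t - 1)) (X.P μ j) ((V ⁻¹' s).indicator (1 : Ω → ENNReal)) :=
    hV.comp (f := s.indicator (1 : α → ENNReal)) (measurable_one.indicator hs)
  have e : (fun o => (V o, obs E X t o)) ⁻¹' (s ×ˢ A) = V ⁻¹' s ∩ obs E X t ⁻¹' A := rfl
  have hGl : Measurable fun p : α × Obs => transitionDensity E g t j (p.2, last p.1) :=
    hG.comp (measurable_snd.prodMk (hlast.comp measurable_fst))
  rw [Measure.map_apply (hVm.prodMk hZ) (hs.prod hA), e, hmeas _ (hVm hs) hdet,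
    withDensity_apply _ (hs.prod hA), setLIntegral_prod _ hGl.aemeasurable]
  refine Eq.trans ?_ (setLIntegral_map hs (hGA.comp hlast) hVm).symm
  refine setLIntegral_congr_fun_ae (hVm hs) ?_
  filter_upwards [ae_of_ae_map hZ'.aemeasurable hae] with o ho _
  rw [ho]
  simp [hlV]

end IsModel

end Markov

end FirmPanel

end

noncomputable section

namespace FirmPanel

/-! ### Joint laws of several observations, given the type and as mixtures. -/

section JointLaw

theorem withDensity_prod_withDensity {α β : Type*} [MeasureSpace α] [MeasureSpace β]
    [SigmaFinite (volume : Measure α)] [SigmaFinite (volume : Measure β)]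
    {D : α → ENNReal} {H : α × β → ENNReal} (hD : Measurable D) (hH : Measurable H) :
    ((volume.withDensity D).prod volume).withDensity H =
      volume.withDensity fun p : α × β => D p.1 * H p := by
  rw [prod_withDensity_left hD]
  exact (withDensity_mul _ (hD.comp measurable_fst) hH).symm

variable {E : Env} {θ : Theta E.J} {Ω : Type*} [mΩ : MeasurableSpace Ω] {μ : Measure Ω}
  [IsProbabilityMeasure μ] {X : Vars E.J Ω}
  {g₁ : Fin E.J → Obs → ℝ} {g : ℕ → Fin E.J → Obs → Obs → ℝ}

/-- The observations of the first two periods. -/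
def obsTwo (E : Env) (X : Vars E.J Ω) (o : Ω) : Obs × Obs := (obs E X 1 o, obs E X 2 o)

/-- The observations of the first three periods. -/
def obsThree (E : Env) (X : Vars E.J Ω) (o : Ω) : (Obs × Obs) × Obs :=
  (obsTwo E X o, obs E X 3 o)

/-- The observations of the first four periods. -/
def obsFour (E : Env) (X : Vars E.J Ω) (o : Ω) : ((Obs × Obs) × Obs) × Obs :=
  (obsThree E X o, obs E X 4 o)

/-- The density of the first three observations, given the type. -/
def densityThree (E : Env) (g₁ : Fin E.J → Obs → ℝ) (g : ℕ → Fin E.J → Obs → Obs → ℝ)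
    (j : Fin E.J) (p : (Obs × Obs) × Obs) : ENNReal :=
  initialDensity E g₁ j p.1.1 * transitionDensity E g 2 j (p.1.2, p.1.1) *
    transitionDensity E g 3 j (p.2, p.1.2)

/-- The density of the first four observations, given the type. -/
def densityFour (E : Env) (g₁ : Fin E.J → Obs → ℝ) (g : ℕ → Fin E.J → Obs → Obs → ℝ)
    (j : Fin E.J) (p : ((Obs × Obs) × Obs) × Obs) : ENNReal :=
  densityThree E g₁ g j p.1 * transitionDensity E g 4 j (p.2, p.1.2)

theorem measurable_obsTwo : Measurable (obsTwo E X) :=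
  (measurable_obs E X 1).prodMk (measurable_obs E X 2)

theorem measurable_obsThree : Measurable (obsThree E X) :=
  measurable_obsTwo.prodMk (measurable_obs E X 3)

theorem measurable_obsFour : Measurable (obsFour E X) :=
  measurable_obsThree.prodMk (measurable_obs E X 4)

omit [IsProbabilityMeasure μ] in
theorem TypeDensities.measurable_densityThree (hd : TypeDensities E μ X g₁ g) (hT : 4 ≤ E.T)
    (j : Fin E.J) : Measurable (densityThree E g₁ g j) := by
  have h1 := hd.measurable_initialDensity j (by omega)
  have h2 := hd.measurable_transitionDensity j (t := 2) ⟨le_rfl, by omega⟩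
  have h3 := hd.measurable_transitionDensity j (t := 3) ⟨by omega, by omega⟩
  unfold densityThree
  fun_prop

omit [IsProbabilityMeasure μ] in
theorem TypeDensities.measurable_densityFour (hd : TypeDensities E μ X g₁ g) (hT : 4 ≤ E.T)
    (j : Fin E.J) : Measurable (densityFour E g₁ g j) := by
  have h1 := hd.measurable_densityThree hT j
  have h4 := hd.measurable_transitionDensity j (t := 4) ⟨by omega, by omega⟩
  unfold densityFour
  fun_prop

/-- The distribution of any variable is the mixture of its distributions given the types. -/
theorem TypeProbabilities.map_eq_sum (h : TypeProbabilities E θ μ X) {α : Type*}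
    [MeasurableSpace α] {V : Ω → α} (hV : Measurable V) :
    μ.map V = ∑ j, ENNReal.ofReal (θ.prob j) • (X.P μ j).map V := by
  have hD : ∀ j, MeasurableSet (X.D ⁻¹' {j}) := fun j => X.D_meas (measurableSet_singleton j)
  ext S hS
  rw [Measure.finsetSum_apply, Measure.map_apply hV hS]
  have h1 : ∀ j, (ENNReal.ofReal (θ.prob j) • (X.P μ j).map V) S =
      μ (V ⁻¹' S ∩ X.D ⁻¹' {j}) := by
    intro j
    rw [Measure.smul_apply, Measure.map_apply hV hS, ← (h j).2, smul_eq_mul, mul_comm, Vars.P,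
      inter_comm]
    exact cond_mul_eq_inter (hD j) (V ⁻¹' S) μ
  simp only [h1]
  rw [← measure_biUnion_finset]
  · congr 1
    ext o
    simp
  · intro i _ k _ hik
    refine Set.disjoint_left.2 fun o ho ho' => hik ?_
    simp only [mem_inter_iff, mem_preimage, mem_singleton_iff] at ho ho'
    exact ho.2.symm.trans ho'.2
  · exact fun j _ => (hV hS).inter (hD j)

namespace IsModel

variable (hX : IsModel E θ μ X) (hd : TypeDensities E μ X g₁ g) (hT : 4 ≤ E.T) (j : Fin E.J)
include hX hT

omit [IsProbabilityMeasure μ] in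
theorem obsTwo_determinedBy : DeterminedBy (X.history 2) (X.P μ j) (obsTwo E X) :=
  ((hX.obs_determinedBy_history j (t := 1) ⟨by omega, by omega⟩).mono
    (X.history_mono (by omega))).prodMk
    (hX.obs_determinedBy_history j (t := 2) ⟨by omega, by omega⟩)

omit [IsProbabilityMeasure μ] in
theorem obsThree_determinedBy : DeterminedBy (X.history 3) (X.P μ j) (obsThree E X) :=
  ((hX.obsTwo_determinedBy hT j).mono (X.history_mono (by omega))).prodMk
    (hX.obs_determinedBy_history j (t := 3) ⟨by omega, by omega⟩)

include hd

theorem map_obsThree :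
    (X.P μ j).map (obsThree E X) = volume.withDensity (densityThree E g₁ g j) := by
  have m1 := hd.measurable_initialDensity j (by omega)
  have m2 := hd.measurable_transitionDensity j (t := 2) ⟨le_rfl, by omega⟩
  have m3 := hd.measurable_transitionDensity j (t := 3) ⟨by omega, by omega⟩
  have h2 := hX.map_prodMk_obs j hd (t := 2) ⟨le_rfl, by omega⟩ (V := obs E X 1)
    (measurable_obs E X 1) (hX.obs_determinedBy_history j ⟨le_rfl, by omega⟩)
    (last := id) measurable_id (fun o => rfl)
  rw [hd.map_obs_one j (by omega), withDensity_prod_withDensity m1 (by fun_prop)] at h2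
  have h3 := hX.map_prodMk_obs j hd (t := 3) ⟨by omega, by omega⟩ (V := obsTwo E X)
    measurable_obsTwo (hX.obsTwo_determinedBy hT j)
    (last := Prod.snd) measurable_snd (fun o => rfl)
  have h2' : (X.P μ j).map (obsTwo E X) = _ := h2
  rw [h2', withDensity_prod_withDensity (by fun_prop) (by fun_prop)] at h3
  exact h3

theorem map_obsFour :
    (X.P μ j).map (obsFour E X) = volume.withDensity (densityFour E g₁ g j) := by
  have m4 := hd.measurable_transitionDensity j (t := 4) ⟨by omega, by omega⟩
  have h4 := hX.map_prodMk_obs j hd (t := 4) ⟨by omega, by omega⟩ (V := obsThree E X)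
    measurable_obsThree (hX.obsThree_determinedBy hT j)
    (last := Prod.snd) measurable_snd (fun o => rfl)
  rw [hX.map_obsThree hd hT j, withDensity_prod_withDensity (hd.measurable_densityThree hT j)
    (by fun_prop)] at h4
  exact h4

theorem map_obsThree_mixture :
    μ.map (obsThree E X) =
      volume.withDensity fun p => ∑ j, ENNReal.ofReal (θ.prob j) * densityThree E g₁ g j p := by
  have hm := hd.measurable_densityThree hT
  rw [hX.types.map_eq_sum measurable_obsThree]
  simp only [hX.map_obsThree hd hT]
  ext S hS
  rw [Measure.finsetSum_apply, withDensity_apply _ hS,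
    lintegral_finsetSum _ fun j _ => (hm j).const_mul _]
  refine Finset.sum_congr rfl fun j _ => ?_
  rw [Measure.smul_apply, withDensity_apply _ hS, lintegral_const_mul _ (hm j), smul_eq_mul]

theorem map_obsFour_mixture :
    μ.map (obsFour E X) =
      volume.withDensity fun p => ∑ j, ENNReal.ofReal (θ.prob j) * densityFour E g₁ g j p := by
  have hm := hd.measurable_densityFour hT
  rw [hX.types.map_eq_sum measurable_obsFour]
  simp only [hX.map_obsFour hd hT]
  ext S hS
  rw [Measure.finsetSum_apply, withDensity_apply _ hS,
    lintegral_finsetSum _ fun j _ => (hm j).const_mul _]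
  refine Finset.sum_congr rfl fun j _ => ?_
  rw [Measure.smul_apply, withDensity_apply _ hS, lintegral_const_mul _ (hm j), smul_eq_mul]

omit hT

omit hd in
/-- Given the type, later observations depend on the first three through the third. -/
theorem exists_future {n : ℕ} (hn : n ∈ Icc 3 E.T) {f : Obs → ENNReal} (hf : Measurable f) :
    ∃ u : Obs → ENNReal, Measurable u ∧
      ∀ W : Ω → ENNReal, DeterminedBy (X.history 3) (X.P μ j) W →
      ∫⁻ o, W o * f (obs E X n o) ∂(X.P μ j) = ∫⁻ o, W o * u (obs E X 3 o) ∂(X.P μ j) := by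
  obtain ⟨h3, hT⟩ := hn
  induction n, h3 using Nat.le_induction generalizing f with
  | base => exact ⟨f, hf, fun _ _ => rfl⟩
  | succ n hn ih =>
    obtain ⟨u, hu, h⟩ := hX.exists_transition j (t := n + 1) ⟨by omega, hT⟩ hf
    obtain ⟨u', hu', h'⟩ := ih hu (by omega)
    exact ⟨u', hu', fun W hW => (h W (hW.mono (X.history_mono (by omega)))).trans (h' W hW)⟩

/-- By the Markov property, the conditional probability of an event about two late observations,
given the first three, is a function of the third. This ties pair laws in all later periods to the
components separated at the third observation. -/
theorem exists_future_pair {n : ℕ} (hn : 3 ≤ n) (hn' : n + 1 ≤ E.T) {A : Set (Obs × Obs)}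
    (hA : MeasurableSet A) :
    ∃ u : Obs → ENNReal, Measurable u ∧
      ∀ S : Set Ω, MeasurableSet S →
      DeterminedBy (X.history 3) (X.P μ j) (S.indicator (1 : Ω → ENNReal)) →
      (X.P μ j) (S ∩ (fun o => (obs E X (n + 1) o, obs E X n o)) ⁻¹' A) =
        ∫⁻ o in S, u (obs E X 3 o) ∂(X.P μ j) := by
  have ht : n + 1 ∈ Icc 2 E.T := ⟨by omega, hn'⟩
  have := hX.isProbabilityMeasure j
  have hG := hd.measurable_transitionDensity j ht
  have hZ := measurable_obs E X n
  have hZ' := measurable_obs E X (n + 1)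
  have h1 : Measurable fun q : Obs × Obs =>
      A.indicator (1 : Obs × Obs → ENNReal) (q.2, q.1) *
        transitionDensity E g (n + 1) j (q.2, q.1) :=
    ((measurable_one.indicator hA).comp measurable_swap).mul (hG.comp measurable_swap)
  -- The conditional probability of `A` given that the earlier observation of the pair equals `z`.
  let f : Obs → ENNReal := fun z =>
    ∫⁻ z', A.indicator (1 : Obs × Obs → ENNReal) (z', z) * transitionDensity E g (n + 1) j (z', z)
  have hf : Measurable f := h1.lintegral_prod_right'
  obtain ⟨u, hu, h⟩ := hX.exists_future j (n := n) ⟨hn, by omega⟩ hf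
  refine ⟨u, hu, fun S hS hdet => ?_⟩
  have hWm : Measurable (S.indicator (1 : Ω → ENNReal)) := measurable_one.indicator hS
  -- Keeping the indicator of `S` next to the observation makes the pair an admissible past whose
  -- last component is that observation.
  have hV : Measurable fun o => (S.indicator (1 : Ω → ENNReal) o, obs E X n o) := hWm.prodMk hZ
  have : IsProbabilityMeasure
      ((X.P μ j).map fun o => (S.indicator (1 : Ω → ENNReal) o, obs E X n o)) :=
    Measure.isProbabilityMeasure_map hV.aemeasurable
  have hlaw := hX.map_prodMk_obs j hd ht hV
    ((hdet.mono (X.history_mono (by omega))).prodMk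
      (hX.obs_determinedBy_history j (t := n) ⟨by omega, by omega⟩))
    (last := Prod.snd) measurable_snd (fun o => rfl)
  have hφ : Measurable fun p : (ENNReal × Obs) × Obs =>
      p.1.1 * A.indicator (1 : Obs × Obs → ENNReal) (p.2, p.1.2) :=
    measurable_fst.fst.mul ((measurable_one.indicator hA).comp
      (measurable_snd.prodMk measurable_fst.snd))
  have hGl : Measurable fun p : (ENNReal × Obs) × Obs =>
      transitionDensity E g (n + 1) j (p.2, p.1.2) :=
    hG.comp (measurable_snd.prodMk measurable_fst.snd)
  have e2 : ∀ o, S.indicator (1 : Ω → ENNReal) o * u (obs E X 3 o) =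
      S.indicator (fun o => u (obs E X 3 o)) o := by
    intro o
    by_cases h1 : o ∈ S <;> simp [h1]
  calc (X.P μ j) (S ∩ (fun o => (obs E X (n + 1) o, obs E X n o)) ⁻¹' A)
      = ∫⁻ o, S.indicator (1 : Ω → ENNReal) o *
          A.indicator (1 : Obs × Obs → ENNReal) (obs E X (n + 1) o, obs E X n o) ∂(X.P μ j) := by
        rw [← lintegral_indicator_one (hS.inter ((hZ'.prodMk hZ) hA))]
        refine lintegral_congr fun o => ?_
        by_cases h1 : o ∈ S <;> by_cases h2 : (obs E X (n + 1) o, obs E X n o) ∈ A <;>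
          simp [h1, h2]
    _ = ∫⁻ p, p.1.1 * A.indicator (1 : Obs × Obs → ENNReal) (p.2, p.1.2)
          ∂((X.P μ j).map fun o => ((S.indicator (1 : Ω → ENNReal) o, obs E X n o),
            obs E X (n + 1) o)) := (lintegral_map hφ (hV.prodMk hZ')).symm
    _ = ∫⁻ v, v.1 * f v.2
          ∂((X.P μ j).map fun o => (S.indicator (1 : Ω → ENNReal) o, obs E X n o)) := by
        rw [hlaw, lintegral_withDensity_eq_lintegral_mul _ hGl hφ,
          lintegral_prod _ (hGl.mul hφ).aemeasurable]
        refine lintegral_congr fun v => ?_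
        refine Eq.trans ?_ (lintegral_const_mul (μ := volume) v.1
          (f := fun z' => A.indicator (1 : Obs × Obs → ENNReal) (z', v.2) *
            transitionDensity E g (n + 1) j (z', v.2))
          (h1.comp ((measurable_const (a := v.2)).prodMk measurable_id)))
        refine lintegral_congr fun z => ?_
        simp only [Pi.mul_apply]
        ring
    _ = ∫⁻ o, S.indicator (1 : Ω → ENNReal) o * f (obs E X n o) ∂(X.P μ j) :=
        lintegral_map (measurable_fst.mul (hf.comp measurable_snd)) hV
    _ = ∫⁻ o, S.indicator (1 : Ω → ENNReal) o * u (obs E X 3 o) ∂(X.P μ j) := h _ hdet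
    _ = _ := by simp only [e2]; rw [lintegral_indicator hS]

end IsModel

end JointLaw

end FirmPanel

end

noncomputable section

namespace FirmPanel

/-! ### Identification of the type-specific pair laws up to one permutation. -/

section Relabeling

/-- Equal laws give densities that agree only almost everywhere, while the rank condition evaluates
them at chosen points. Continuity on an open set, together with a volume that charges open sets,
closes the gap. -/
theorem eqOn_of_withDensity_eq {α : Type*} [TopologicalSpace α] [MeasureSpace α] [BorelSpace α]
    [SigmaFinite (volume : Measure α)] [(volume : Measure α).IsOpenPosMeasure]
    {D D' : α → ENNReal} (hD : Measurable D) (hD' : Measurable D')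
    (h : (volume : Measure α).withDensity D = volume.withDensity D') {U : Set α} (hU : IsOpen U)
    {f f' : α → ℝ} (hf : ContinuousOn f U) (hf' : ContinuousOn f' U)
    (hDf : ∀ x ∈ U, D x = ENNReal.ofReal (f x) ∧ 0 ≤ f x)
    (hDf' : ∀ x ∈ U, D' x = ENNReal.ofReal (f' x) ∧ 0 ≤ f' x) : EqOn f f' U := by
  rw [withDensity_eq_iff_of_sigmaFinite hD.aemeasurable hD'.aemeasurable] at h
  refine Measure.eqOn_open_of_ae_eq (μ := volume) ?_ hU hf hf'
  filter_upwards [ae_restrict_of_ae h, ae_restrict_mem hU.measurableSet] with x hx hxU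
  rw [(hDf x hxU).1, (hDf' x hxU).1] at hx
  exact (ENNReal.ofReal_eq_ofReal_iff (hDf x hxU).2 (hDf' x hxU).2).1 hx

instance : SigmaFinite (volume : Measure Obs) := inferInstance

instance : (volume : Measure Obs).IsOpenPosMeasure := inferInstance

instance : SigmaFinite (volume : Measure (Obs × Obs)) := inferInstance

instance : (volume : Measure (Obs × Obs)).IsOpenPosMeasure := inferInstance

instance : SigmaFinite (volume : Measure ((Obs × Obs) × Obs)) := inferInstance

instance : (volume : Measure ((Obs × Obs) × Obs)).IsOpenPosMeasure := inferInstance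

instance : SigmaFinite (volume : Measure (((Obs × Obs) × Obs) × Obs)) := inferInstance

instance : (volume : Measure (((Obs × Obs) × Obs) × Obs)).IsOpenPosMeasure := inferInstance

variable {E : Env} {θ : Theta E.J} {Ω : Type*} [mΩ : MeasurableSpace Ω] {μ : Measure Ω}
  {X : Vars E.J Ω}
  {g₁ : Fin E.J → Obs → ℝ} {g : ℕ → Fin E.J → Obs → Obs → ℝ}

/-- The mixture weight times the type-specific density of the first three observations. -/
def weightThree (π : Fin E.J → ℝ) (g₁ : Fin E.J → Obs → ℝ) (g : ℕ → Fin E.J → Obs → Obs → ℝ)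
    (j : Fin E.J) (p : (Obs × Obs) × Obs) : ℝ :=
  π j * g 2 j p.1.2 p.1.1 * g₁ j p.1.1 * g 3 j p.2 p.1.2

/-- The mixture weight times the type-specific density of the first four observations. -/
def weightFour (π : Fin E.J → ℝ) (g₁ : Fin E.J → Obs → ℝ) (g : ℕ → Fin E.J → Obs → Obs → ℝ)
    (j : Fin E.J) (p : ((Obs × Obs) × Obs) × Obs) : ℝ :=
  weightThree π g₁ g j p.1 * g 4 j p.2 p.1.2

/-- The support of the first three observations. -/
def suppThree (E : Env) : Set ((Obs × Obs) × Obs) := (E.suppZ 1 ×ˢ E.suppZ 2) ×ˢ E.suppZ 3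

/-- The support of the first four observations. -/
def suppFour (E : Env) : Set (((Obs × Obs) × Obs) × Obs) := suppThree E ×ˢ E.suppZ 4

theorem isOpen_suppThree (hT : 4 ≤ E.T) : IsOpen (suppThree E) :=
  ((E.isOpen_suppZ ⟨le_rfl, by omega⟩).prod (E.isOpen_suppZ ⟨by omega, by omega⟩)).prod
    (E.isOpen_suppZ ⟨by omega, by omega⟩)

theorem isOpen_suppFour (hT : 4 ≤ E.T) : IsOpen (suppFour E) :=
  (isOpen_suppThree hT).prod (E.isOpen_suppZ ⟨by omega, by omega⟩)

namespace TypeDensities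

variable (hd : TypeDensities E μ X g₁ g) (hp : TypeProbabilities E θ μ X) (hT : 4 ≤ E.T)
  (j : Fin E.J)
include hd hT

theorem continuousOn_weightThree :
    ContinuousOn (weightThree θ.prob g₁ g j) (suppThree E) := by
  have h1 := (hd j).1
  have h2 := ((hd j).2.2.2 2 ⟨le_rfl, by omega⟩).1
  have h3 := ((hd j).2.2.2 3 ⟨by omega, by omega⟩).1
  have c1 : ContinuousOn (fun p : (Obs × Obs) × Obs => g₁ j p.1.1) (suppThree E) :=
    h1.comp (by fun_prop) fun p hp => hp.1.1
  have c2 : ContinuousOn (fun p : (Obs × Obs) × Obs => g 2 j p.1.2 p.1.1) (suppThree E) :=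
    h2.comp (f := fun p : (Obs × Obs) × Obs => (p.1.2, p.1.1)) (by fun_prop)
      fun p hp => ⟨hp.1.2, hp.1.1⟩
  have c3 : ContinuousOn (fun p : (Obs × Obs) × Obs => g 3 j p.2 p.1.2) (suppThree E) :=
    h3.comp (f := fun p : (Obs × Obs) × Obs => (p.2, p.1.2)) (by fun_prop)
      fun p hp => ⟨hp.2, hp.1.2⟩
  exact ((continuousOn_const.mul c2).mul c1).mul c3

theorem continuousOn_weightFour :
    ContinuousOn (weightFour θ.prob g₁ g j) (suppFour E) := by
  have h4 := ((hd j).2.2.2 4 ⟨by omega, by omega⟩).1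
  have c4 : ContinuousOn (fun p : ((Obs × Obs) × Obs) × Obs => g 4 j p.2 p.1.2) (suppFour E) :=
    h4.comp (f := fun p : ((Obs × Obs) × Obs) × Obs => (p.2, p.1.2)) (by fun_prop)
      fun p hp => ⟨hp.2, hp.1.2⟩
  exact ((hd.continuousOn_weightThree hT j).comp (by fun_prop) fun p hp => hp.1).mul c4

include hp

/-- Bridge between the extended nonnegative densities of measure theory and the real weights to
which determinants apply. -/
theorem weightThree_eq {p : (Obs × Obs) × Obs} (h : p ∈ suppThree E) :
    ENNReal.ofReal (θ.prob j) * densityThree E g₁ g j p =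
      ENNReal.ofReal (weightThree θ.prob g₁ g j p) ∧ 0 < weightThree θ.prob g₁ g j p := by
  have h0 := (hp j).1
  have h1 := (hd j).2.1 _ h.1.1
  have h2 := ((hd j).2.2.2 2 ⟨le_rfl, by omega⟩).2.1 _ h.1.2 _ h.1.1
  have h3 := ((hd j).2.2.2 3 ⟨by omega, by omega⟩).2.1 _ h.2 _ h.1.2
  have e1 : initialDensity E g₁ j p.1.1 = ENNReal.ofReal (g₁ j p.1.1) := indicator_of_mem h.1.1 _
  have e2 : transitionDensity E g 2 j (p.1.2, p.1.1) = ENNReal.ofReal (g 2 j p.1.2 p.1.1) :=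
    indicator_of_mem (show (p.1.2, p.1.1) ∈ E.suppZ 2 ×ˢ E.suppZ 1 from ⟨h.1.2, h.1.1⟩) _
  have e3 : transitionDensity E g 3 j (p.2, p.1.2) = ENNReal.ofReal (g 3 j p.2 p.1.2) :=
    indicator_of_mem (show (p.2, p.1.2) ∈ E.suppZ 3 ×ˢ E.suppZ 2 from ⟨h.2, h.1.2⟩) _
  refine ⟨?_, mul_pos (mul_pos (mul_pos h0 h2) h1) h3⟩
  rw [densityThree, weightThree, e1, e2, e3, ENNReal.ofReal_mul (by positivity),
    ENNReal.ofReal_mul (by positivity), ENNReal.ofReal_mul h0.le]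
  ring

theorem weightFour_eq {p : ((Obs × Obs) × Obs) × Obs} (h : p ∈ suppFour E) :
    ENNReal.ofReal (θ.prob j) * densityFour E g₁ g j p =
      ENNReal.ofReal (weightFour θ.prob g₁ g j p) ∧ 0 < weightFour θ.prob g₁ g j p := by
  obtain ⟨e3, p3⟩ := hd.weightThree_eq hp hT j h.1
  have h4 := ((hd j).2.2.2 4 ⟨by omega, by omega⟩).2.1 _ h.2 _ h.1.2
  have e4 : transitionDensity E g 4 j (p.2, p.1.2) = ENNReal.ofReal (g 4 j p.2 p.1.2) :=
    indicator_of_mem (show (p.2, p.1.2) ∈ E.suppZ 4 ×ˢ E.suppZ 3 from ⟨h.2, h.1.2⟩) _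
  refine ⟨?_, mul_pos p3 h4⟩
  rw [densityFour, weightFour, e4, ENNReal.ofReal_mul p3.le, ← e3, mul_assoc]

theorem sum_weightThree {p : (Obs × Obs) × Obs} (h : p ∈ suppThree E) :
    ∑ j, ENNReal.ofReal (θ.prob j) * densityThree E g₁ g j p =
      ENNReal.ofReal (∑ j, weightThree θ.prob g₁ g j p) ∧
      0 ≤ ∑ j, weightThree θ.prob g₁ g j p := by
  have h1 := fun j => hd.weightThree_eq hp hT j h
  refine ⟨?_, Finset.sum_nonneg fun j _ => (h1 j).2.le⟩
  rw [ENNReal.ofReal_sum_of_nonneg fun j _ => (h1 j).2.le]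
  exact Finset.sum_congr rfl fun j _ => (h1 j).1

theorem sum_weightFour {p : ((Obs × Obs) × Obs) × Obs} (h : p ∈ suppFour E) :
    ∑ j, ENNReal.ofReal (θ.prob j) * densityFour E g₁ g j p =
      ENNReal.ofReal (∑ j, weightFour θ.prob g₁ g j p) ∧
      0 ≤ ∑ j, weightFour θ.prob g₁ g j p := by
  have h1 := fun j => hd.weightFour_eq hp hT j h
  refine ⟨?_, Finset.sum_nonneg fun j _ => (h1 j).2.le⟩
  rw [ENNReal.ofReal_sum_of_nonneg fun j _ => (h1 j).2.le]
  exact Finset.sum_congr rfl fun j _ => (h1 j).1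

omit hp hT

/-- The law of an observation is absolutely continuous on its support. -/
theorem map_obs_absolutelyContinuous {t : ℕ} (ht : t ∈ Icc 2 E.T)
    [IsProbabilityMeasure (X.P μ j)] :
    (X.P μ j).map (obs E X t) ≪ volume.restrict (E.suppZ t) := by
  have : IsProbabilityMeasure ((X.P μ j).map (obs E X (t - 1))) :=
    Measure.isProbabilityMeasure_map (measurable_obs E X _).aemeasurable
  have h1 : (X.P μ j).map (fun o => (obs E X t o, obs E X (t - 1) o)) ≪
      (volume.restrict (E.suppZ t)).prod ((X.P μ j).map (obs E X (t - 1))) := by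
    rw [((hd j).2.2.2 t ht).2.2]
    exact withDensity_absolutelyContinuous _ _
  have h2 := h1.map measurable_fst
  rw [Measure.map_map measurable_fst
    ((measurable_obs E X t).prodMk (measurable_obs E X (t - 1))), Measure.map_fst_prod] at h2
  simp only [measure_univ, one_smul] at h2
  exact h2

end TypeDensities

variable [IsProbabilityMeasure μ] {θ' : Theta E.J} {Ω' : Type*} [mΩ' : MeasurableSpace Ω']
  {μ' : Measure Ω'} [IsProbabilityMeasure μ'] {X' : Vars E.J Ω'}
  {g₁' : Fin E.J → Obs → ℝ} {g' : ℕ → Fin E.J → Obs → Obs → ℝ}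

theorem IsModel.exists_type (_ : IsModel E θ μ X) : 0 < E.J := by
  obtain ⟨o⟩ : Nonempty Ω := nonempty_of_isProbabilityMeasure μ
  exact Fin.pos (X.D o)

/-- The joint law of the first three observations and of an event in later periods. -/
theorem IsModel.exists_future_density (hX : IsModel E θ μ X) (hd : TypeDensities E μ X g₁ g)
    (hT : 4 ≤ E.T) {n : ℕ} (hn : 3 ≤ n) (hn' : n + 1 ≤ E.T) {A : Set (Obs × Obs)}
    (hA : MeasurableSet A) :
    ∃ u : Fin E.J → Obs → ENNReal, (∀ j, Measurable (u j)) ∧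
      ((μ.map (fun o => (obsThree E X o, (obs E X (n + 1) o, obs E X n o)))).restrict
          (univ ×ˢ A)).map Prod.fst = volume.withDensity
            (fun p => ∑ j, ENNReal.ofReal (θ.prob j) * densityThree E g₁ g j p * u j p.2) ∧
      (∀ j, (X.P μ j).map (fun o => (obs E X (n + 1) o, obs E X n o)) A =
        ∫⁻ z, u j z ∂((X.P μ j).map (obs E X 3))) ∧
      ∀ j, ∀ᵐ z ∂(volume.restrict (E.suppZ 3)), u j z < ⊤ := by
  have hP := hX.isProbabilityMeasure
  have h3 : 3 ∈ Icc 1 E.T := ⟨by omega, by omega⟩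
  have hpm : Measurable fun o => (obs E X (n + 1) o, obs E X n o) :=
    (measurable_obs E X _).prodMk (measurable_obs E X _)
  have hZ := measurable_obs E X 3
  have m3 := hd.measurable_densityThree hT
  have mV : Measurable fun o => (obsThree E X o, (obs E X (n + 1) o, obs E X n o)) :=
    measurable_obsThree.prodMk hpm
  choose u hu h using fun j => hX.exists_future_pair hd j hn hn' hA
  have hfull : ∀ j, (X.P μ j).map (fun o => (obs E X (n + 1) o, obs E X n o)) A =
      ∫⁻ z, u j z ∂((X.P μ j).map (obs E X 3)) := by
    intro j
    have := h j univ MeasurableSet.univ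
      ⟨fun _ => 1, measurable_const, by rw [indicator_univ]; rfl⟩
    rw [univ_inter, Measure.restrict_univ] at this
    rw [Measure.map_apply hpm hA, this, lintegral_map (hu j) hZ]
  refine ⟨u, hu, ?_, hfull, fun j => ?_⟩
  · ext S hS
    rw [Measure.map_apply measurable_fst hS, Measure.restrict_apply (measurable_fst hS),
      hX.types.map_eq_sum mV, Measure.finsetSum_apply, withDensity_apply _ hS,
      lintegral_finsetSum (f := fun j p =>
        ENNReal.ofReal (θ.prob j) * densityThree E g₁ g j p * u j p.2) _
        fun j _ => ((m3 j).const_mul _).mul ((hu j).comp measurable_snd)]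
    refine Finset.sum_congr rfl fun j _ => ?_
    have hdet : DeterminedBy (X.history 3) (X.P μ j)
        ((obsThree E X ⁻¹' S).indicator (1 : Ω → ENNReal)) :=
      (hX.obsThree_determinedBy hT j).comp (f := S.indicator (1 : (Obs × Obs) × Obs → ENNReal))
        (measurable_one.indicator hS)
    have e : (fun o => (obsThree E X o, (obs E X (n + 1) o, obs E X n o))) ⁻¹'
        (Prod.fst ⁻¹' S ∩ univ ×ˢ A) =
        obsThree E X ⁻¹' S ∩ (fun o => (obs E X (n + 1) o, obs E X n o)) ⁻¹' A := by
      ext o; simp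
    rw [Measure.smul_apply, Measure.map_apply mV ((measurable_fst hS).inter
      (MeasurableSet.univ.prod hA)), e, h j _ (measurable_obsThree hS) hdet]
    have e2 : ∫⁻ o in obsThree E X ⁻¹' S, u j (obs E X 3 o) ∂(X.P μ j) =
        ∫⁻ p in S, u j p.2 ∂((X.P μ j).map (obsThree E X)) :=
      (setLIntegral_map hS ((hu j).comp measurable_snd) measurable_obsThree).symm
    have m2 : Measurable fun p : (Obs × Obs) × Obs => u j p.2 := (hu j).comp measurable_snd
    have e3 := setLIntegral_withDensity_eq_setLIntegral_mul volume (m3 j) m2 hS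
    rw [e2, hX.map_obsThree hd hT, smul_eq_mul, e3, ← lintegral_const_mul _ ((m3 j).mul m2)]
    simp only [Pi.mul_apply, mul_assoc]
  -- The integral of `u j` against the law of the third observation is a probability, so `u j` is
  -- finite almost everywhere for that law, hence Lebesgue almost everywhere on the support.
  · refine (hd.restrict_absolutelyContinuous j h3).ae_le (ae_lt_top (hu j) ?_)
    rw [← hfull j]
    have : IsProbabilityMeasure ((X.P μ j).map (fun o => (obs E X (n + 1) o, obs E X n o))) :=
      Measure.isProbabilityMeasure_map hpm.aemeasurable
    exact measure_ne_top _ _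

/-- The type-specific densities of the first three observations, with their weights, are the same
up to a relabeling. -/
theorem exists_perm_weightThree (hX : IsModel E θ μ X) (hX' : IsModel E θ' μ' X')
    (hT : 4 ≤ E.T) (hd : TypeDensities E μ X g₁ g) (hd' : TypeDensities E μ' X' g₁' g')
    (hr : RankCondition E θ.prob g₁ g) (hr' : RankCondition E θ'.prob g₁' g')
    (h₃ : μ.map (obsThree E X) = μ'.map (obsThree E X'))
    (h₄ : μ.map (obsFour E X) = μ'.map (obsFour E X')) :
    ∃ σ : Equiv.Perm (Fin E.J), ∀ j, ∀ p ∈ suppThree E,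
      weightThree θ.prob g₁ g j p = weightThree θ'.prob g₁' g' (σ j) p := by
  have m3 := hd.measurable_densityThree hT
  have m3' := hd'.measurable_densityThree hT
  have m4 := hd.measurable_densityFour hT
  have m4' := hd'.measurable_densityFour hT
  rw [hX.map_obsThree_mixture hd hT, hX'.map_obsThree_mixture hd' hT] at h₃
  rw [hX.map_obsFour_mixture hd hT, hX'.map_obsFour_mixture hd' hT] at h₄
  have e3 := eqOn_of_withDensity_eq (by fun_prop) (by fun_prop) h₃ (isOpen_suppThree hT)
    (f := fun p => ∑ j, weightThree θ.prob g₁ g j p)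
    (f' := fun p => ∑ j, weightThree θ'.prob g₁' g' j p)
    (continuousOn_finsetSum _ fun j _ => hd.continuousOn_weightThree hT j)
    (continuousOn_finsetSum _ fun j _ => hd'.continuousOn_weightThree hT j)
    (fun p hp => hd.sum_weightThree hX.types hT hp)
    (fun p hp => hd'.sum_weightThree hX'.types hT hp)
  have e4 := eqOn_of_withDensity_eq (by fun_prop) (by fun_prop) h₄ (isOpen_suppFour hT)
    (f := fun p => ∑ j, weightFour θ.prob g₁ g j p)
    (f' := fun p => ∑ j, weightFour θ'.prob g₁' g' j p)
    (continuousOn_finsetSum _ fun j _ => hd.continuousOn_weightFour hT j)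
    (continuousOn_finsetSum _ fun j _ => hd'.continuousOn_weightFour hT j)
    (fun p hp => hd.sum_weightFour hX.types hT hp)
    (fun p hp => hd'.sum_weightFour hX'.types hT hp)
  obtain ⟨⟨zs, hzs, hr⟩, hpos⟩ := hr
  -- The value `none` stands for the fourth observation integrated out. It encodes equality of the
  -- three-period densities and supplies the row of ones.
  let e : (ℕ → Fin E.J → Obs → Obs → ℝ) → Fin E.J → E.suppZ 3 → Option (E.suppZ 4) → ℝ :=
    fun g j c y => y.elim 1 fun z => g 4 j z c
  obtain ⟨σ, hσ⟩ := mixture_components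
    (w := fun j (b : E.suppZ 2) (a : E.suppZ 1) => θ.prob j * g 2 j b a * g₁ j a)
    (w' := fun j (b : E.suppZ 2) (a : E.suppZ 1) => θ'.prob j * g' 2 j b a * g₁' j a)
    (l := fun j (c : E.suppZ 3) (b : E.suppZ 2) => g 3 j c b)
    (l' := fun j (c : E.suppZ 3) (b : E.suppZ 2) => g' 3 j c b)
    (e := e g) (e' := e g')
    (fun j c b => hpos _ b.2 _ c.2 j) (fun j c b => hr'.2 _ b.2 _ c.2 j)
    (fun j c => rfl) (fun j c => rfl)
    (fun a b c y => by
      cases y with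
      | none =>
        have := e3 (show ((a.1, b.1), c.1) ∈ suppThree E from ⟨⟨a.2, b.2⟩, c.2⟩)
        simpa [e, weightThree] using this
      | some d =>
        have := e4 (show (((a.1, b.1), c.1), d.1) ∈ suppFour E from ⟨⟨⟨a.2, b.2⟩, c.2⟩, d.2⟩)
        simpa [e, weightFour, weightThree] using this)
    ⟨zs, hzs⟩ (⟨0, hX.exists_type⟩ : Fin E.J)
    (fun c => by
      obtain ⟨b₂, hb₂, b₁, hb₁, c₃, hc₃, a, ha, b, hb, ⟨d1, d2, d3, d4, d5⟩, hinj⟩ := hr c c.2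
      let y : Fin E.J → Option (E.suppZ 4) := fun i =>
        if hi : (i : ℕ) = 0 then none else some ⟨b ⟨(i : ℕ) - 1, by omega⟩, hb _⟩
      have hmat : ∀ c : E.suppZ 3, (Matrix.of fun i j => e g j c (y i)) = matL g b c := by
        intro c
        ext i j
        by_cases hi : (i : ℕ) = 0 <;> simp [matL, e, y, hi]
      refine ⟨⟨b₂, hb₂⟩, ⟨b₁, hb₁⟩, ⟨c₃, hc₃⟩, fun i => ⟨a i, ha i⟩, y, by simp [y],
        ?_, ?_, ?_, d4, d5, hinj⟩
      · rwa [hmat]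
      · rwa [hmat]
      · rwa [hmat])
  refine ⟨σ, fun j p hp => ?_⟩
  exact (hσ j ⟨p.2, hp.2⟩).2 ⟨p.1.2, hp.1.2⟩ ⟨p.1.1, hp.1.1⟩

omit [IsProbabilityMeasure μ] in
/-- The conditional probabilities of a later event, given the third observation and the type, are
determined by the mixture. -/
theorem future_ae_eq (hX : IsModel E θ μ X) (hd : TypeDensities E μ X g₁ g)
    (hr : RankCondition E θ.prob g₁ g) (hT : 4 ≤ E.T) {u u' : Fin E.J → Obs → ENNReal}
    (hu : ∀ j, Measurable (u j)) (hu' : ∀ j, Measurable (u' j))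
    (hfin : ∀ j, ∀ᵐ z ∂(volume.restrict (E.suppZ 3)), u j z < ⊤)
    (hfin' : ∀ j, ∀ᵐ z ∂(volume.restrict (E.suppZ 3)), u' j z < ⊤)
    (σ : Equiv.Perm (Fin E.J)) {D' : Fin E.J → (Obs × Obs) × Obs → ENNReal}
    (hD' : ∀ j, Measurable (D' j))
    (hdens : ∀ j p, ENNReal.ofReal (θ.prob j) * densityThree E g₁ g j p = D' (σ j) p)
    (h : (volume : Measure ((Obs × Obs) × Obs)).withDensity
        (fun p => ∑ j, ENNReal.ofReal (θ.prob j) * densityThree E g₁ g j p * u j p.2) =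
      volume.withDensity (fun p => ∑ j, D' j p * u' j p.2)) (j : Fin E.J) :
    ∀ᵐ z ∂(volume.restrict (E.suppZ 3)), u j z = u' (σ j) z := by
  have m3 := hd.measurable_densityThree hT
  have hS3 := E.isOpen_suppZ (t := 3) ⟨by omega, by omega⟩
  have hS12 := (E.isOpen_suppZ (t := 1) ⟨by omega, by omega⟩).prod
    (E.isOpen_suppZ (t := 2) ⟨by omega, by omega⟩)
  have ms : Measurable (Prod.snd : (Obs × Obs) × Obs → Obs) := measurable_snd
  have hm : Measurable fun p : (Obs × Obs) × Obs =>
      ∑ j, ENNReal.ofReal (θ.prob j) * densityThree E g₁ g j p * u j p.2 :=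
    Finset.measurable_fun_sum _ fun j _ => ((m3 j).const_mul _).mul ((hu j).comp ms)
  have hm' : Measurable fun p : (Obs × Obs) × Obs => ∑ j, D' j p * u' j p.2 :=
    Finset.measurable_fun_sum _ fun j _ => (hD' j).mul ((hu' j).comp ms)
  rw [withDensity_eq_iff_of_sigmaFinite hm.aemeasurable hm'.aemeasurable] at h
  -- The third observation is moved to the outside so that it can be fixed while the first two vary.
  have hswap : ∀ᵐ q : Obs × (Obs × Obs) ∂(volume.prod volume),
      ∑ j, ENNReal.ofReal (θ.prob j) * densityThree E g₁ g j q.swap * u j q.swap.2 =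
        ∑ j, D' j q.swap * u' j q.swap.2 :=
    (Measure.measurePreserving_swap (μ := (volume : Measure Obs))
      (ν := (volume : Measure (Obs × Obs)))).quasiMeasurePreserving.ae h
  have hiter := Measure.ae_ae_of_ae_prod hswap
  filter_upwards [ae_restrict_of_ae hiter, ae_restrict_mem hS3.measurableSet,
    ae_all_iff.2 hfin, ae_all_iff.2 hfin'] with z hz hzS hf hf'
  obtain ⟨⟨zs, hzs, hr⟩, hpos⟩ := hr
  obtain ⟨b₂, hb₂, b₁, hb₁, c₃, hc₃, a, ha, b, hb, ⟨d1, d2, d3, d4, d5⟩, hinj⟩ := hr z hzS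
  have hcont : ∀ c : Fin E.J → ℝ, ContinuousOn
      (fun x : Obs × Obs => ∑ j, weightThree θ.prob g₁ g j (x, z) * c j)
      (E.suppZ 1 ×ˢ E.suppZ 2) := fun c =>
    continuousOn_finsetSum _ fun j _ =>
      ((hd.continuousOn_weightThree hT j).comp (f := fun x : Obs × Obs => (x, z)) (by fun_prop)
        fun x hx => ⟨hx, hzS⟩).mul continuousOn_const
  -- For fixed `z` both sides are continuous in the first two observations, so the almost everywhere
  -- identity may be evaluated at the points of the rank condition.
  have heq : EqOn (fun x : Obs × Obs => ∑ j, weightThree θ.prob g₁ g j (x, z) * (u j z).toReal)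
      (fun x => ∑ j, weightThree θ.prob g₁ g j (x, z) * (u' (σ j) z).toReal)
      (E.suppZ 1 ×ˢ E.suppZ 2) := by
    refine Measure.eqOn_open_of_ae_eq (μ := volume) ?_ hS12 (hcont _) (hcont _)
    filter_upwards [ae_restrict_of_ae hz, ae_restrict_mem hS12.measurableSet] with x hx hxS
    have hxz : (x, z) ∈ suppThree E := ⟨hxS, hzS⟩
    have hw := fun j => hd.weightThree_eq hX.types hT j hxz
    simp only [Prod.swap_prod_mk] at hx
    rw [← Equiv.sum_comp σ (fun j => D' j (x, z) * u' j z)] at hx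
    simp only [← hdens, (hw _).1] at hx
    have hx' := congrArg ENNReal.toReal hx
    rw [ENNReal.toReal_sum fun j _ => ENNReal.mul_ne_top ENNReal.ofReal_ne_top (hf j).ne,
      ENNReal.toReal_sum fun j _ => ENNReal.mul_ne_top ENNReal.ofReal_ne_top (hf' _).ne] at hx'
    simpa only [ENNReal.toReal_mul, ENNReal.toReal_ofReal (hw _).2.le] using hx'
  -- At the points `(a i, b₁)` the identity is a homogeneous system with matrix `matLbar`;
  -- positivity of `g 3` then removes the remaining factor.
  have hzero := eq_zero_of_det_ne_zero d4
    (x := fun j => g 3 j z b₁ * ((u j z).toReal - (u' (σ j) z).toReal)) (fun i => by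
      have := heq (show (a i, b₁) ∈ E.suppZ 1 ×ˢ E.suppZ 2 from ⟨ha i, hb₁⟩)
      simp only [weightThree] at this
      simp only [matLbar, Matrix.of_apply, mul_sub, Finset.sum_sub_distrib, ← mul_assoc]
      rw [this, sub_self]) j
  have := (mul_eq_zero.1 hzero).resolve_left (hpos _ hb₁ _ hzS j).ne'
  exact (ENNReal.toReal_eq_toReal_iff' (hf j).ne (hf' _).ne).1 (sub_eq_zero.1 this)

/-- Two models with the same joint density have, up to one relabeling, the same type probabilities
and the same type-specific distributions of successive observations. -/
theorem exists_relabeling (hX : IsModel E θ μ X) (hX' : IsModel E θ' μ' X') (hT : 4 ≤ E.T)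
    (h : μ.map (fun o (i : Fin E.T) => obs E X (i + 1) o) =
      μ'.map (fun o (i : Fin E.T) => obs E X' (i + 1) o)) :
    ∃ σ : Equiv.Perm (Fin E.J), ∀ j, θ.prob j = θ'.prob (σ j) ∧
      ∀ t ∈ Icc 2 E.T, (X.P μ j).map (fun o => (obs E X t o, obs E X (t - 1) o)) =
        (X'.P μ' (σ j)).map (fun o => (obs E X' t o, obs E X' (t - 1) o)) := by
  obtain ⟨g₁, g, hd, hr⟩ := hX.densities
  obtain ⟨g₁', g', hd', hr'⟩ := hX'.densities
  have hm : Measurable fun o (i : Fin E.T) => obs E X (i + 1) o :=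
    measurable_pi_lambda _ fun i => measurable_obs E X _
  have hm' : Measurable fun o (i : Fin E.T) => obs E X' (i + 1) o :=
    measurable_pi_lambda _ fun i => measurable_obs E X' _
  have transfer : ∀ {β : Type} [MeasurableSpace β] (Φ : (Fin E.T → Obs) → β), Measurable Φ →
      μ.map (fun o => Φ fun i => obs E X (i + 1) o) =
        μ'.map (fun o => Φ fun i => obs E X' (i + 1) o) := by
    intro β _ Φ hΦ
    have := congrArg (Measure.map Φ) h
    rwa [Measure.map_map hΦ hm, Measure.map_map hΦ hm'] at this
  let Φ₃ : (Fin E.T → Obs) → (Obs × Obs) × Obs := fun z =>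
    ((z ⟨0, by omega⟩, z ⟨1, by omega⟩), z ⟨2, by omega⟩)
  have hΦ₃ : Measurable Φ₃ := by fun_prop
  have h₃ : μ.map (obsThree E X) = μ'.map (obsThree E X') := transfer Φ₃ hΦ₃
  have h₄ : μ.map (obsFour E X) = μ'.map (obsFour E X') :=
    transfer (fun z => (Φ₃ z, z ⟨3, by omega⟩)) (by fun_prop)
  obtain ⟨σ, hσ⟩ := exists_perm_weightThree hX hX' hT hd hd' hr hr' h₃ h₄
  have hdens : ∀ j p, ENNReal.ofReal (θ.prob j) * densityThree E g₁ g j p =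
      ENNReal.ofReal (θ'.prob (σ j)) * densityThree E g₁' g' (σ j) p := by
    intro j p
    by_cases hp : p ∈ suppThree E
    · rw [(hd.weightThree_eq hX.types hT j hp).1, (hd'.weightThree_eq hX'.types hT (σ j) hp).1,
        hσ j p hp]
    · have h0 : ∀ (g₁ : Fin E.J → Obs → ℝ) (g : ℕ → Fin E.J → Obs → Obs → ℝ) j,
          densityThree E g₁ g j p = 0 := by
        intro g₁ g j
        by_contra hne
        simp only [densityThree, mul_ne_zero_iff] at hne
        exact hp ⟨(mem_of_indicator_ne_zero hne.1.2).symm, (mem_of_indicator_ne_zero hne.2).1⟩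
      rw [h0, h0, mul_zero, mul_zero]
  have hlaw : ∀ j, ENNReal.ofReal (θ.prob j) • (X.P μ j).map (obsThree E X) =
      ENNReal.ofReal (θ'.prob (σ j)) • (X'.P μ' (σ j)).map (obsThree E X') := by
    intro j
    rw [hX.map_obsThree hd hT, hX'.map_obsThree hd' hT,
      ← withDensity_smul _ (hd.measurable_densityThree hT j),
      ← withDensity_smul _ (hd'.measurable_densityThree hT _)]
    congr 1
    ext p
    exact hdens j p
  have hP := hX.isProbabilityMeasure
  have hP' := hX'.isProbabilityMeasure
  -- The weighted component laws agree, so their total masses, the type probabilities, agree.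
  have hprob : ∀ j, ENNReal.ofReal (θ.prob j) = ENNReal.ofReal (θ'.prob (σ j)) := by
    intro j
    have h1 := congrArg (fun ν => ν univ) (hlaw j)
    have i1 : IsProbabilityMeasure ((X.P μ j).map (obsThree E X)) :=
      Measure.isProbabilityMeasure_map measurable_obsThree.aemeasurable
    have i2 : IsProbabilityMeasure ((X'.P μ' (σ j)).map (obsThree E X')) :=
      Measure.isProbabilityMeasure_map measurable_obsThree.aemeasurable
    simpa using h1
  have hlaw3 : ∀ j, (X.P μ j).map (obsThree E X) = (X'.P μ' (σ j)).map (obsThree E X') := by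
    intro j
    have h1 := hlaw j
    rw [hprob j] at h1
    have h0 : ENNReal.ofReal (θ'.prob (σ j)) ≠ 0 :=
      (ENNReal.ofReal_pos.2 (hX'.types (σ j)).1).ne'
    ext S hS
    have h2 := congrArg (fun ν => ν S) h1
    simp only [Measure.smul_apply, smul_eq_mul] at h2
    exact (ENNReal.mul_right_inj h0 ENNReal.ofReal_ne_top).1 h2
  have proj : ∀ {β : Type} [MeasurableSpace β] (Φ : (Obs × Obs) × Obs → β), Measurable Φ →
      ∀ j, (X.P μ j).map (fun o => Φ (obsThree E X o)) =
        (X'.P μ' (σ j)).map (fun o => Φ (obsThree E X' o)) := by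
    intro β _ Φ hΦ j
    have := congrArg (Measure.map Φ) (hlaw3 j)
    rwa [Measure.map_map hΦ measurable_obsThree, Measure.map_map hΦ measurable_obsThree] at this
  refine ⟨σ, fun j => ⟨(ENNReal.ofReal_eq_ofReal_iff (hX.types j).1.le
    (hX'.types (σ j)).1.le).1 (hprob j), fun t ht => ?_⟩⟩
  -- Pairs within the first three periods are marginals of a law already matched. From period 4 on,
  -- the pair law is recovered event by event from conditional probabilities given the third
  -- observation.
  have hcases : t = 2 ∨ t = 3 ∨ ∃ n, 3 ≤ n ∧ t = n + 1 := by
    have := ht.1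
    by_cases h2 : t = 2
    · exact Or.inl h2
    by_cases h3 : t = 3
    · exact Or.inr (Or.inl h3)
    exact Or.inr (Or.inr ⟨t - 1, by omega, by omega⟩)
  rcases hcases with rfl | rfl | ⟨n, hn, rfl⟩
  · exact proj (fun p => (p.1.2, p.1.1)) (by fun_prop) j
  · exact proj (fun p => (p.2, p.1.2)) (by fun_prop) j
  have hn' : n + 1 ≤ E.T := ht.2
  have hpm : Measurable fun o => (obs E X (n + 1) o, obs E X n o) :=
    (measurable_obs E X _).prodMk (measurable_obs E X _)
  have hpm' : Measurable fun o => (obs E X' (n + 1) o, obs E X' n o) :=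
    (measurable_obs E X' _).prodMk (measurable_obs E X' _)
  simp only [Nat.add_sub_cancel]
  ext A hA
  obtain ⟨u, hu, hjoint, hfull, hfin⟩ := hX.exists_future_density hd hT hn hn' hA
  obtain ⟨u', hu', hjoint', hfull', hfin'⟩ := hX'.exists_future_density hd' hT hn hn' hA
  have htr := transfer (fun z => (Φ₃ z, (z ⟨n, by omega⟩, z ⟨n - 1, by omega⟩))) (by fun_prop)
  have hnn : n - 1 + 1 = n := by omega
  simp only [hnn] at htr
  have htr' : μ.map (fun o => (obsThree E X o, (obs E X (n + 1) o, obs E X n o))) =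
      μ'.map (fun o => (obsThree E X' o, (obs E X' (n + 1) o, obs E X' n o))) := htr
  rw [htr', hjoint'] at hjoint
  have hZ3 : (X.P μ j).map (obs E X 3) = (X'.P μ' (σ j)).map (obs E X' 3) :=
    proj Prod.snd measurable_snd j
  rw [hfull j, hfull' (σ j), hZ3]
  refine lintegral_congr_ae ?_
  refine (hd'.map_obs_absolutelyContinuous (σ j) (t := 3) ⟨by omega, by omega⟩).ae_le ?_
  exact future_ae_eq hX hd hr hT hu hu' hfin hfin' σ
    (D' := fun j p => ENNReal.ofReal (θ'.prob j) * densityThree E g₁' g' j p)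
    (fun j => (hd'.measurable_densityThree hT j).const_mul _) hdens hjoint.symm j

end Relabeling

end FirmPanel

end

noncomputable section

namespace FirmPanel

/-! ### The restrictions of the model, expressed on the law of the observations. -/

section CanonicalLaws

variable {E : Env}

/-- What the model implies for the law `Q` of one observation, given the type, where productivity
and the shocks are the functions `rω`, `rv`, `rε`, `rζ` of the observation. -/
structure PeriodLaw (E : Env) (θ : Theta E.J) (t : ℕ) (j : Fin E.J) (Q : Measure Obs)
    (rω rv rε rζ : Obs → ℝ) : Prop where
  measurable_ω : Measurable rω
  measurable_v : Measurable rv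
  measurable_ε : Measurable rε
  measurable_ζ : Measurable rζ
  measurable_output : Measurable (outputAt θ t j)
  ae_mem : ∀ᵐ z ∂Q, z ∈ E.suppZ t
  absolutelyContinuous : Q ≪ volume.restrict (E.suppZ t)
  restrict_absolutelyContinuous : volume.restrict (E.suppZ t) ≪ Q
  integrable_ω : Integrable rω Q
  integrable_v : Integrable rv Q
  integrable_ε : Integrable rε Q
  integrable_ζ : Integrable rζ Q
  mean_ω : ∫ z, rω z ∂Q = 0
  mean_v : ∫ z, rv z ∂Q = 0
  centered_ε : ∀ A : Set (ℝ × ℝ × ℝ), MeasurableSet A → ∫ z in Prod.snd ⁻¹' A, rε z ∂Q = 0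
  centered_ζ : ∀ A : Set (ℝ × ℝ × ℝ), MeasurableSet A → ∫ z in Prod.snd ⁻¹' A, rζ z ∂Q = 0
  density_v : IsDensity (Q.map rv) (θ.gv t j)
  density_εζ : IsDensity (Q.map fun z => (rε z, rζ z)) (θ.gεζ t j)
  exp_ε_pos : 0 < ∫ z, Real.exp (rε z) ∂Q
  exp_ζ_pos : 0 < ∫ z, Real.exp (rζ z) ∂Q
  derivM_eq : ∃ D : ℝ × ℝ × ℝ → ℝ, Measurable D ∧ ∀ᵐ z ∂Q, derivM θ t j z = D z.2
  derivL_eq : ∃ D : ℝ × ℝ × ℝ → ℝ, Measurable D ∧ ∀ᵐ z ∂Q, derivL θ t j z = D z.2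
  output_pos : ∀ᵐ z ∂Q, 0 < outputAt θ t j z
  share_m : ∀ᵐ z ∂Q, z.1.1 * Real.exp (rε z) * outputAt θ t j z =
    (∫ z, Real.exp (rε z) ∂Q) * derivM θ t j z * z.2.2.1
  share_l : ∀ᵐ z ∂Q, (∫ z, Real.exp (rζ z) ∂Q) * z.1.2 * Real.exp (rε z) * outputAt θ t j z =
    (∫ z, Real.exp (rε z) ∂Q) * Real.exp (rζ z) * derivL θ t j z *
      (Real.exp (θ.ψ t j) * z.2.2.2)
  wage : ∀ᵐ z ∂Q, E.PM t * z.2.2.1 * z.1.2 =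
    Real.exp (rv z) * Real.exp (rζ z) * θ.PL t * Real.exp (θ.ψ t j) * z.2.2.2 * z.1.1
  foc : ∀ᵐ z ∂Q, E.PY t * (∫ z, Real.exp (rε z) ∂Q) * Real.exp (rω z) * derivM θ t j z = E.PM t

/-- What the model implies for the law `Q` of two successive observations, given the type, where
productivity in the two periods is the function `rω`, `rω₀` of the observation. -/
structure TransitionLaw (E : Env) (θ : Theta E.J) (t : ℕ) (j : Fin E.J) (Q : Measure (Obs × Obs))
    (rω rω₀ : Obs → ℝ) : Prop where
  measurable_h : Measurable (θ.h t j)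
  integrable : Integrable (fun p => rω p.1 - θ.h t j (rω₀ p.2)) Q
  centered : ∀ A : Set (ℝ × Obs), MeasurableSet A →
    ∫ p in (fun p : Obs × Obs => (p.1.2.1, p.2)) ⁻¹' A, (rω p.1 - θ.h t j (rω₀ p.2)) ∂Q = 0
  density : IsDensity (Q.map fun p => rω p.1 - θ.h t j (rω₀ p.2)) (θ.gη t j)
  prod_absolutelyContinuous : (volume.restrict (E.suppK t)).prod (Q.map Prod.snd) ≪
    Q.map fun p => (p.1.2.1, p.2)

theorem restrict_suppZ (E : Env) (t : ℕ) : (volume : Measure Obs).restrict (E.suppZ t) =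
    (volume.restrict (E.suppS t)).prod ((volume.restrict (E.suppK t)).prod
      (volume.restrict (E.suppM t ×ˢ E.suppN t))) := by
  rw [Measure.prod_restrict, Measure.prod_restrict]
  rfl

theorem restrict_univ_ne_zero {α : Type*} [TopologicalSpace α] [MeasureSpace α]
    [(volume : Measure α).IsOpenPosMeasure] {U : Set α} (hU : IsOpen U) (h : U.Nonempty) :
    (volume.restrict U) univ ≠ 0 := by
  rw [Measure.restrict_apply_univ]
  exact (hU.measure_pos _ h).ne'

/-- The supports of the other coordinates are nonempty and open, so a cylinder over a set of capital
levels is null only if that set is null within the support. -/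
theorem restrict_suppK_absolutelyContinuous {t : ℕ} (ht : t ∈ Icc 1 E.T) :
    volume.restrict (E.suppK t) ≪
      (volume.restrict (E.suppZ t)).map fun z : Obs => z.2.1 := by
  have mk : Measurable fun z : Obs => z.2.1 := by fun_prop
  refine Measure.AbsolutelyContinuous.mk fun s hs h => ?_
  have e : (fun z : Obs => z.2.1) ⁻¹' s = univ ×ˢ (s ×ˢ univ) := by
    ext z
    simp
  rw [Measure.map_apply mk hs, e, restrict_suppZ, Measure.prod_prod, Measure.prod_prod] at h
  have h1 := restrict_univ_ne_zero (E.suppS_open t ht) (E.suppS_conn t ht).nonempty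
  have h2 := restrict_univ_ne_zero ((E.suppM_open t ht).prod (E.suppN_open t ht))
    ((E.suppM_conn t ht).nonempty.prod (E.suppN_conn t ht).nonempty)
  rw [mul_eq_zero, mul_eq_zero] at h
  tauto

/-- A centered variable has integral zero over the events determined by independent information. -/
theorem setIntegral_preimage_eq_zero {Ω α : Type*} {m m' mΩ : MeasurableSpace Ω}
    [MeasurableSpace α] {P : Measure Ω} [IsProbabilityMeasure P] (hm : m ≤ mΩ) (hm' : m' ≤ mΩ)
    {f : Ω → ℝ} (hf : Measurable[m'] f) (hfi : Integrable f P) (h : Indep m' m P)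
    (h0 : ∫ o, f o ∂P = 0) {V : Ω → α} (hV : DeterminedBy m P V) {A : Set α}
    (hA : MeasurableSet A) : ∫ o in V ⁻¹' A, f o ∂P = 0 := by
  obtain ⟨V', hV', hVV⟩ := hV
  have hS : V ⁻¹' A =ᵐ[P] V' ⁻¹' A := by
    filter_upwards [hVV] with o ho
    change (V o ∈ A) = (V' o ∈ A)
    rw [ho]
  rw [setIntegral_congr_set hS]
  exact setIntegral_eq_zero_of_indep hm hf hm' hfi h h0 (hV' hA)

variable {θ : Theta E.J} {Ω : Type*} [mΩ : MeasurableSpace Ω] {μ : Measure Ω}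
  [IsProbabilityMeasure μ] {X : Vars E.J Ω}

namespace IsModel

variable (hX : IsModel E θ μ X) (j : Fin E.J)
include hX

theorem map_obs_absolutelyContinuous {t : ℕ} (ht : t ∈ Icc 1 E.T) :
    (X.P μ j).map (obs E X t) ≪ volume.restrict (E.suppZ t) := by
  obtain ⟨g₁, g, hd, -⟩ := hX.densities
  have := hX.isProbabilityMeasure j
  rcases eq_or_lt_of_le ht.1 with rfl | h2
  · rw [(hd j).2.2.1]
    exact withDensity_absolutelyContinuous _ _
  · exact hd.map_obs_absolutelyContinuous j ⟨h2, ht.2⟩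

/-- Two models live on different probability spaces and share only the law of the observations.
Replacing the latent variables by functions of the observation makes them comparable on one space.
-/
theorem exists_periodLaw {t : ℕ} (ht : t ∈ Icc 1 E.T) :
    ∃ rω rv rε rζ : Obs → ℝ,
      PeriodLaw E θ t j ((X.P μ j).map (obs E X t)) rω rv rε rζ ∧
      ∀ᵐ o ∂(X.P μ j), X.ω t o = rω (obs E X t o) := by
  obtain ⟨rω, rv, rε, rζ, ⟨mω, mv, mε, mζ⟩, hr⟩ := hX.exists_inversion j ht
  obtain ⟨g₁, g, hd, -⟩ := hX.densities
  have hP := hX.isProbabilityMeasure j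
  have hZ := measurable_obs E X t
  obtain ⟨dv, dεζ, ⟨iv, ev⟩, ⟨iε, eε⟩, ⟨iζ, eζ⟩, ⟨iω, eω⟩, -, -⟩ := (hX.shocks j).1 t ht
  obtain ⟨hind, -⟩ := (hX.timing j).1 t ht
  obtain ⟨pε, pζ⟩ := hX.integral_exp_shock_pos j ht
  have aω : X.ω t =ᵐ[X.P μ j] rω ∘ obs E X t := hr.mono fun o ho => ho.1
  have av : X.v t =ᵐ[X.P μ j] rv ∘ obs E X t := hr.mono fun o ho => ho.2.1
  have aε : X.ε t =ᵐ[X.P μ j] rε ∘ obs E X t := hr.mono fun o ho => ho.2.2.1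
  have aζ : X.ζ t =ᵐ[X.P μ j] rζ ∘ obs E X t := hr.mono fun o ho => ho.2.2.2
  have integral_eq : ∀ {r : Obs → ℝ} {x : Ω → ℝ}, Measurable r → x =ᵐ[X.P μ j] r ∘ obs E X t →
      ∫ z, r z ∂((X.P μ j).map (obs E X t)) = ∫ o, x o ∂(X.P μ j) := by
    intro r x hr hx
    rw [integral_map hZ.aemeasurable hr.aestronglyMeasurable]
    exact integral_congr_ae hx.symm
  have integrable_of : ∀ {r : Obs → ℝ} {x : Ω → ℝ}, Measurable r → x =ᵐ[X.P μ j] r ∘ obs E X t →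
      Integrable x (X.P μ j) → Integrable r ((X.P μ j).map (obs E X t)) := by
    intro r x hr hx hi
    rw [integrable_map_measure hr.aestronglyMeasurable hZ.aemeasurable]
    exact hi.congr hx
  have centered : ∀ {r : Obs → ℝ} {x : Ω → ℝ}, Measurable r → x =ᵐ[X.P μ j] r ∘ obs E X t →
      Integrable x (X.P μ j) → ∫ o, x o ∂(X.P μ j) = 0 →
      Measurable[MeasurableSpace.comap (fun o => (X.ε t o, X.ζ t o)) inferInstance] x →
      ∀ A : Set (ℝ × ℝ × ℝ), MeasurableSet A →
        ∫ z in Prod.snd ⁻¹' A, r z ∂((X.P μ j).map (obs E X t)) = 0 := by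
    intro r x hr hx hi h0 hxm A hA
    rw [setIntegral_map (measurable_snd hA) hr.aestronglyMeasurable hZ.aemeasurable]
    refine Eq.trans ?_ (setIntegral_preimage_eq_zero (X.info_le t)
      ((X.ε_meas t).prodMk (X.ζ_meas t)).comap_le hxm hi hind h0
      (hX.inputs_determinedBy_info j ht) hA)
    exact integral_congr_ae (ae_restrict_of_ae (hx.symm))
  have cε := integral_eq (Real.measurable_exp.comp mε) (x := fun o => Real.exp (X.ε t o))
    (aε.fun_comp Real.exp)
  have cζ := integral_eq (Real.measurable_exp.comp mζ) (x := fun o => Real.exp (X.ζ t o))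
    (aζ.fun_comp Real.exp)
  simp only [Function.comp_def] at cε cζ
  have hshare := hX.ae_shares j ht
  have mout := hX.measurable_outputAt j ht
  obtain ⟨DM, hM, hDM⟩ := hX.exists_measurable_derivM j ht
  obtain ⟨DL, hL, hDL⟩ := hX.exists_measurable_derivL j ht
  have hDM' := ae_of_ae_map hZ.aemeasurable hDM
  have hDL' := ae_of_ae_map hZ.aemeasurable hDL
  -- Pushing an almost sure equality forward uses a measurable equality set. This is why the
  -- derivatives are replaced below by their measurable versions `DM` and `DL` and restored
  -- afterwards.
  have eqQ : ∀ {f₁ f₂ : Obs → ℝ}, Measurable f₁ → Measurable f₂ →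
      (∀ᵐ o ∂(X.P μ j), f₁ (obs E X t o) = f₂ (obs E X t o)) →
      ∀ᵐ z ∂((X.P μ j).map (obs E X t)), f₁ z = f₂ z := fun h1 h2 h =>
    (ae_map_iff hZ.aemeasurable (measurableSet_eq_fun h1 h2)).2 h
  refine ⟨rω, rv, rε, rζ, ?_, aω⟩
  constructor
  case measurable_ω => exact mω
  case measurable_v => exact mv
  case measurable_ε => exact mε
  case measurable_ζ => exact mζ
  case measurable_output => exact mout
  case ae_mem =>
    exact (ae_map_iff hZ.aemeasurable (E.isOpen_suppZ ht).measurableSet).2 (hX.ae_mem_suppZ j ht)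
  case absolutelyContinuous => exact hX.map_obs_absolutelyContinuous j ht
  case restrict_absolutelyContinuous => exact hd.restrict_absolutelyContinuous j ht
  case integrable_ω => exact integrable_of mω aω iω
  case integrable_v => exact integrable_of mv av iv
  case integrable_ε => exact integrable_of mε aε iε
  case integrable_ζ => exact integrable_of mζ aζ iζ
  case mean_ω => rw [integral_eq mω aω, eω]
  case mean_v => rw [integral_eq mv av, ev]
  case centered_ε =>
    exact centered mε aε iε eε (measurable_fst.comp (comap_measurable fun o => (X.ε t o, X.ζ t o)))
  case centered_ζ =>
    exact centered mζ aζ iζ eζ (measurable_snd.comp (comap_measurable fun o => (X.ε t o, X.ζ t o)))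
  case density_v =>
    rw [Measure.map_map mv hZ, ← Measure.map_congr av]
    exact dv
  case density_εζ =>
    rw [Measure.map_map (mε.prodMk mζ) hZ]
    have : (fun o => (X.ε t o, X.ζ t o)) =ᵐ[X.P μ j] (fun z => (rε z, rζ z)) ∘ obs E X t := by
      filter_upwards [hr] with o ho
      rw [ho.2.2.1, ho.2.2.2]
      rfl
    rw [← Measure.map_congr this]
    exact dεζ
  case exp_ε_pos => rw [cε]; exact pε
  case exp_ζ_pos => rw [cζ]; exact pζ
  case derivM_eq => exact ⟨DM, hM, hDM⟩
  case derivL_eq => exact ⟨DL, hL, hDL⟩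
  case output_pos =>
    refine (ae_map_iff hZ.aemeasurable (measurableSet_lt measurable_const mout)).2 ?_
    filter_upwards [hshare] with o ho using ho.2.2.2.2.2
  case share_m =>
    rw [cε]
    have h := eqQ (f₁ := fun z => z.1.1 * Real.exp (rε z) * outputAt θ t j z)
      (f₂ := fun z => (∫ o, Real.exp (X.ε t o) ∂(X.P μ j)) * DM z.2 * z.2.2.1)
      (by fun_prop) (by fun_prop) (by
        filter_upwards [hshare, hr, hDM'] with o h1 h2 h3
        rw [← h2.2.2.1, ← h3]
        exact h1.2.1)
    filter_upwards [h, hDM] with z h1 h2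
    rw [h2]
    exact h1
  case share_l =>
    rw [cε, cζ]
    have h := eqQ (f₁ := fun z => (∫ o, Real.exp (X.ζ t o) ∂(X.P μ j)) * z.1.2 *
        Real.exp (rε z) * outputAt θ t j z)
      (f₂ := fun z => (∫ o, Real.exp (X.ε t o) ∂(X.P μ j)) * Real.exp (rζ z) * DL z.2 *
        (Real.exp (θ.ψ t j) * z.2.2.2))
      (by fun_prop) (by fun_prop) (by
        filter_upwards [hshare, hr, hDL'] with o h1 h2 h3
        rw [← h2.2.2.1, ← h2.2.2.2, ← h3]
        exact h1.2.2.1)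
    filter_upwards [h, hDL] with z h1 h2
    rw [h2]
    exact h1
  case wage =>
    refine eqQ (f₁ := fun z => E.PM t * z.2.2.1 * z.1.2)
      (f₂ := fun z => Real.exp (rv z) * Real.exp (rζ z) * θ.PL t * Real.exp (θ.ψ t j) *
        z.2.2.2 * z.1.1) (by fun_prop) (by fun_prop) ?_
    filter_upwards [hshare, hr] with o h1 h2
    rw [← h2.2.1, ← h2.2.2.2]
    exact h1.2.2.2.1
  case foc =>
    rw [cε]
    have h := eqQ (f₁ := fun z => E.PY t * (∫ o, Real.exp (X.ε t o) ∂(X.P μ j)) *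
        Real.exp (rω z) * DM z.2)
      (f₂ := fun z => E.PM t) (by fun_prop) (by fun_prop) (by
        filter_upwards [hshare, hr, hDM'] with o h1 h2 h3
        rw [← h2.1, ← h3]
        exact h1.2.2.2.2.1)
    filter_upwards [h, hDM] with z h1 h2
    rw [h2]
    exact h1

theorem transitionLaw {t : ℕ} (ht : t ∈ Icc 2 E.T) {rω rω₀ : Obs → ℝ} (mω : Measurable rω)
    (mω₀ : Measurable rω₀) (hω : ∀ᵐ o ∂(X.P μ j), X.ω t o = rω (obs E X t o))
    (hω₀ : ∀ᵐ o ∂(X.P μ j), X.ω (t - 1) o = rω₀ (obs E X (t - 1) o)) :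
    TransitionLaw E θ t j
      ((X.P μ j).map (fun o => (obs E X t o, obs E X (t - 1) o))) rω rω₀ := by
  obtain ⟨g₁, g, hd, -⟩ := hX.densities
  have hP := hX.isProbabilityMeasure j
  have hZ := measurable_obs E X t
  have hZ₀ := measurable_obs E X (t - 1)
  have hpair : Measurable fun o => (obs E X t o, obs E X (t - 1) o) := hZ.prodMk hZ₀
  have hQ₀ : IsProbabilityMeasure ((X.P μ j).map (obs E X (t - 1))) :=
    Measure.isProbabilityMeasure_map hZ₀.aemeasurable
  obtain ⟨mh, heq⟩ := (hX.equations j).2 t ht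
  obtain ⟨dη, iη, eη⟩ := (hX.shocks j).2 t ht
  have hind := (hX.timing j).2 t ht
  have mr : Measurable fun p : Obs × Obs => rω p.1 - θ.h t j (rω₀ p.2) := by fun_prop
  have aη : X.η t =ᵐ[X.P μ j] (fun p : Obs × Obs => rω p.1 - θ.h t j (rω₀ p.2)) ∘
      fun o => (obs E X t o, obs E X (t - 1) o) := by
    filter_upwards [heq, hω, hω₀] with o h1 h2 h3
    simp only [Function.comp_apply]
    rw [← h2, ← h3, h1]
    ring
  have mφ : Measurable fun p : Obs × Obs => (p.1.2.1, p.2) := by fun_prop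
  constructor
  case measurable_h => exact mh
  case integrable =>
    rw [integrable_map_measure mr.aestronglyMeasurable hpair.aemeasurable]
    exact iη.congr aη
  case centered =>
    intro A hA
    rw [setIntegral_map (mφ hA) mr.aestronglyMeasurable hpair.aemeasurable]
    have hdet : DeterminedBy (X.history (t - 1) ⊔ MeasurableSpace.comap (X.K t) inferInstance)
        (X.P μ j) (fun o => (X.K t o, obs E X (t - 1) o)) :=
      (Measurable.determinedBy (Measurable.mono (comap_measurable _) le_sup_right le_rfl)).prodMk
        ((hX.obs_determinedBy_history j (one_mem_periods ht)).mono le_sup_left)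
    refine Eq.trans ?_ (setIntegral_preimage_eq_zero
      (sup_le (X.history_le _) (X.K_meas t).comap_le) (X.η_meas t).comap_le
      (comap_measurable _) iη hind eη hdet hA)
    exact integral_congr_ae (ae_restrict_of_ae aη.symm)
  case density =>
    rw [Measure.map_map mr hpair, ← Measure.map_congr aη]
    exact dη
  -- Positivity of the transition density lets current capital vary freely given the previous
  -- observation, up to null sets.
  case prod_absolutelyContinuous =>
    have h1 := (hd.prod_absolutelyContinuous j ht).map mφ
    refine Measure.AbsolutelyContinuous.trans ?_ h1
    rw [Measure.map_map measurable_snd hpair]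
    have e : (fun p : Obs × Obs => (p.1.2.1, p.2)) = Prod.map (fun z : Obs => z.2.1) id := rfl
    have mk : Measurable fun z : Obs => z.2.1 := by fun_prop
    rw [e, ← Measure.map_prod_map _ _ mk measurable_id, Measure.map_id]
    refine Measure.AbsolutelyContinuous.prod ?_ Measure.AbsolutelyContinuous.rfl
    exact restrict_suppK_absolutelyContinuous (periods_of_two ht)

end IsModel

end CanonicalLaws

end FirmPanel

end

noncomputable section

namespace FirmPanel

/-! ### Two models with the same law of one observation: wages, shocks and elasticities. -/

section Comparison

theorem IsDensity.ae_eq {α : Type*} [MeasureSpace α] [SigmaFinite (volume : Measure α)]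
    {ν : Measure α} {g g' : α → ℝ} (h : IsDensity ν g) (h' : IsDensity ν g') :
    g =ᵐ[volume] g' := by
  have e := h.2.2.symm.trans h'.2.2
  rw [withDensity_eq_iff_of_sigmaFinite h.1.ennreal_ofReal.aemeasurable
    h'.1.ennreal_ofReal.aemeasurable] at e
  filter_upwards [e] with x hx
  exact (ENNReal.ofReal_eq_ofReal_iff (h.2.1 x) (h'.2.1 x)).1 hx

/-- Two variables that are both centered given `φ` and differ by a function of `φ` are equal. -/
theorem ae_eq_of_centered {α β : Type*} [MeasurableSpace α] [MeasurableSpace β] {Q : Measure α}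
    {φ : α → β} (hφ : Measurable φ) {r r' : α → ℝ} (hr : Integrable r Q) (hr' : Integrable r' Q)
    (h : ∀ A, MeasurableSet A → ∫ z in φ ⁻¹' A, r z ∂Q = 0)
    (h' : ∀ A, MeasurableSet A → ∫ z in φ ⁻¹' A, r' z ∂Q = 0) {d : β → ℝ} (hd : Measurable d)
    (heq : ∀ᵐ z ∂Q, r z - r' z = d (φ z)) : r =ᵐ[Q] r' := by
  have hi : Integrable d (Q.map φ) := by
    rw [integrable_map_measure hd.aestronglyMeasurable hφ.aemeasurable]
    exact (hr.sub hr').congr heq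
  have h0 : d =ᵐ[Q.map φ] 0 := by
    refine hi.ae_eq_zero_of_forall_setIntegral_eq_zero fun A hA _ => ?_
    rw [setIntegral_map hA hd.aestronglyMeasurable hφ.aemeasurable]
    have : ∫ z in φ ⁻¹' A, d (φ z) ∂Q = ∫ z in φ ⁻¹' A, (r z - r' z) ∂Q :=
      integral_congr_ae (ae_restrict_of_ae (heq.mono fun z hz => hz.symm))
    rw [this, integral_sub hr.integrableOn hr'.integrableOn, h A hA, h' A hA, sub_zero]
  filter_upwards [heq, ae_of_ae_map hφ.aemeasurable h0] with z h1 h2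
  rw [h2] at h1
  exact sub_eq_zero.1 h1

variable {E : Env}

/-- A property of inputs that holds almost everywhere on the support. -/
theorem ae_inputs_of_ae {t : ℕ} (ht : t ∈ Icc 1 E.T) {p : ℝ × ℝ × ℝ → Prop}
    (h : ∀ᵐ z ∂((volume : Measure Obs).restrict (E.suppZ t)), p z.2) :
    ∀ᵐ k ∂(volume.restrict (E.suppK t)),
      ∀ᵐ y ∂(volume.restrict (E.suppM t ×ˢ E.suppN t)), p (k, y) := by
  rw [restrict_suppZ] at h
  have h1 := Measure.ae_ae_of_ae_prod h
  have hne : (ae (volume.restrict (E.suppS t))).NeBot := by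
    rw [ae_neBot]
    intro h0
    exact restrict_univ_ne_zero (E.suppS_open t ht) (E.suppS_conn t ht).nonempty (by simp [h0])
  -- The property does not involve the shares, so one good value of them suffices.
  obtain ⟨s, hs⟩ := h1.exists
  exact Measure.ae_ae_of_ae_prod hs

theorem ae_of_ae_capital {t : ℕ} {p : ℝ → Prop} (h : ∀ᵐ k ∂(volume.restrict (E.suppK t)), p k) :
    ∀ᵐ z ∂((volume : Measure Obs).restrict (E.suppZ t)), p z.2.1 := by
  rw [restrict_suppZ]
  exact Measure.quasiMeasurePreserving_snd.ae (p := fun x : ℝ × ℝ × ℝ => p x.1)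
    (Measure.quasiMeasurePreserving_fst.ae h)

variable {θ θ' : Theta E.J} {t : ℕ} {j j' : Fin E.J} {Q : Measure Obs}
  {rω rv rε rζ rω' rv' rε' rζ' : Obs → ℝ}

namespace PeriodLaw

theorem mean_ζ (h : PeriodLaw E θ t j Q rω rv rε rζ) : ∫ z, rζ z ∂Q = 0 := by
  simpa using h.centered_ζ univ MeasurableSet.univ

section

variable (ht : t ∈ Icc 1 E.T) (h : PeriodLaw E θ t j Q rω rv rε rζ)
  (h' : PeriodLaw E θ' t j' Q rω' rv' rε' rζ')
include ht h h'

/-- The market wage times the labor quality of a type. -/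
theorem log_wage_eq [IsProbabilityMeasure Q] (hPL : 0 < θ.PL t) (hPL' : 0 < θ'.PL t) :
    θ.PL t * Real.exp (θ.ψ t j) = θ'.PL t * Real.exp (θ'.ψ t j') := by
  -- Both sides are the log wage bill per worker. Since v and ζ have mean zero, taking expectations
  -- leaves the constants.
  have hae : ∀ᵐ z ∂Q, (rv z + rζ z) + (Real.log (θ.PL t) + θ.ψ t j) =
      (rv' z + rζ' z) + (Real.log (θ'.PL t) + θ'.ψ t j') := by
    filter_upwards [h.ae_mem, h.wage, h'.wage] with z hz h1 h2
    have hs : 0 < z.1.1 := (E.suppS_pos t ht hz.1).1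
    have hn : 0 < z.2.2.2 := E.suppN_pos t ht hz.2.2.2
    have e : Real.exp (rv z) * Real.exp (rζ z) * θ.PL t * Real.exp (θ.ψ t j) =
        Real.exp (rv' z) * Real.exp (rζ' z) * θ'.PL t * Real.exp (θ'.ψ t j') := by
      have := h1.symm.trans h2
      exact mul_right_cancel₀ hn.ne' (mul_right_cancel₀ hs.ne' this)
    have e2 := congrArg Real.log e
    rw [← Real.exp_add, ← Real.exp_add, Real.log_mul (by positivity) (by positivity),
      Real.log_mul (by positivity) (by positivity), Real.log_mul (by positivity) (by positivity),
      Real.log_mul (by positivity) (by positivity), Real.log_exp, Real.log_exp, Real.log_exp,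
      Real.log_exp] at e2
    linarith
  have aux : ∀ {a b : Obs → ℝ} (c : ℝ), Integrable a Q → Integrable b Q → ∫ z, a z ∂Q = 0 →
      ∫ z, b z ∂Q = 0 → ∫ z, ((a z + b z) + c) ∂Q = c := by
    intro a b c ha hb h1 h2
    refine (integral_add (f := fun z => a z + b z) (ha.add hb) (integrable_const c)).trans ?_
    rw [integral_add ha hb, h1, h2]
    simp
  have hi := integral_congr_ae hae
  rw [aux _ h.integrable_v h.integrable_ζ h.mean_v h.mean_ζ,
    aux _ h'.integrable_v h'.integrable_ζ h'.mean_v h'.mean_ζ] at hi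
  have := congrArg Real.exp hi
  rwa [Real.exp_add, Real.exp_add, Real.exp_log hPL, Real.exp_log hPL'] at this

/-- The log material share plus ε is a function of the inputs in either model, so the two candidates
for ε differ by a function of the inputs; both are centered given the inputs. -/
theorem ε_ae_eq : rε =ᵐ[Q] rε' := by
  obtain ⟨D, mD, hD⟩ := h.derivM_eq
  obtain ⟨D', mD', hD'⟩ := h'.derivM_eq
  have mo := h.measurable_output
  have mo' := h'.measurable_output
  refine ae_eq_of_centered measurable_snd h.integrable_ε h'.integrable_ε h.centered_ε
    -- The shares `(0, 0)` are placeholders: output net of productivity depends on the inputs only.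
    h'.centered_ε (d := fun x : ℝ × ℝ × ℝ =>
      Real.log ((∫ z, Real.exp (rε z) ∂Q) * D x * x.2.1 / outputAt θ t j ((0, 0), x)) -
      Real.log ((∫ z, Real.exp (rε' z) ∂Q) * D' x * x.2.1 / outputAt θ' t j' ((0, 0), x)))
    (by fun_prop) ?_
  filter_upwards [h.ae_mem, h.share_m, h'.share_m, h.output_pos, h'.output_pos, hD, hD']
    with z hz s s' o o' e e'
  have hs : 0 < z.1.1 := (E.suppS_pos t ht hz.1).1
  have f : outputAt θ t j ((0, 0), z.2) = outputAt θ t j z := rfl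
  have f' : outputAt θ' t j' ((0, 0), z.2) = outputAt θ' t j' z := rfl
  rw [f, f', ← e, ← e', ← s, ← s', mul_div_cancel_right₀ _ o.ne', mul_div_cancel_right₀ _ o'.ne',
    Real.log_mul hs.ne' (Real.exp_pos _).ne', Real.log_mul hs.ne' (Real.exp_pos _).ne',
    Real.log_exp, Real.log_exp]
  ring

theorem exp_ε_eq : ∫ z, Real.exp (rε z) ∂Q = ∫ z, Real.exp (rε' z) ∂Q :=
  integral_congr_ae ((h.ε_ae_eq ht h').fun_comp Real.exp)

/-- The log labor share plus ε minus ζ is a function of the inputs. As ε is already matched, the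
centering argument now applies to ζ. -/
theorem ζ_ae_eq : rζ =ᵐ[Q] rζ' := by
  obtain ⟨D, mD, hD⟩ := h.derivL_eq
  obtain ⟨D', mD', hD'⟩ := h'.derivL_eq
  have mo := h.measurable_output
  have mo' := h'.measurable_output
  have hε := h.ε_ae_eq ht h'
  refine ae_eq_of_centered measurable_snd h.integrable_ζ h'.integrable_ζ h.centered_ζ
    h'.centered_ζ (d := fun x : ℝ × ℝ × ℝ =>
      Real.log ((∫ z, Real.exp (rε' z) ∂Q) * D' x * (Real.exp (θ'.ψ t j') * x.2.2) /
        ((∫ z, Real.exp (rζ' z) ∂Q) * outputAt θ' t j' ((0, 0), x))) -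
      Real.log ((∫ z, Real.exp (rε z) ∂Q) * D x * (Real.exp (θ.ψ t j) * x.2.2) /
        ((∫ z, Real.exp (rζ z) ∂Q) * outputAt θ t j ((0, 0), x))))
    (by fun_prop) ?_
  have key : ∀ {cε cζ s ε ζ o d l : ℝ}, 0 < cζ → 0 < s → 0 < o →
      cζ * s * Real.exp ε * o = cε * Real.exp ζ * d * l →
      Real.log (cε * d * l / (cζ * o)) = Real.log s + ε - ζ := by
    intro cε cζ s ε ζ o d l h1 h2 h3 e
    have e2 : cε * d * l / (cζ * o) = s * Real.exp (ε - ζ) := by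
      rw [Real.exp_sub, div_eq_iff (by positivity)]
      have := (Real.exp_pos ζ).ne'
      field_simp
      linarith
    rw [e2, Real.log_mul h2.ne' (Real.exp_pos _).ne', Real.log_exp]
    ring
  filter_upwards [h.ae_mem, h.share_l, h'.share_l, h.output_pos, h'.output_pos, hD, hD', hε]
    with z hz s s' o o' e e' hεz
  have hs : 0 < z.1.2 := (E.suppS_pos t ht hz.1).2
  have f : outputAt θ t j ((0, 0), z.2) = outputAt θ t j z := rfl
  have f' : outputAt θ' t j' ((0, 0), z.2) = outputAt θ' t j' z := rfl
  rw [f, f', ← e, ← e', key h.exp_ζ_pos hs o s, key h'.exp_ζ_pos hs o' s', hεz]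
  ring

theorem exp_ζ_eq : ∫ z, Real.exp (rζ z) ∂Q = ∫ z, Real.exp (rζ' z) ∂Q :=
  integral_congr_ae ((h.ζ_ae_eq ht h').fun_comp Real.exp)

/-- Once the market wage, labor quality and ζ are matched, v is the only unknown left in the wage
bill. -/
theorem v_ae_eq (hPL : 0 < θ.PL t) (hPL' : θ.PL t = θ'.PL t) (hψ : θ.ψ t j = θ'.ψ t j') :
    rv =ᵐ[Q] rv' := by
  filter_upwards [h.ae_mem, h.wage, h'.wage, h.ζ_ae_eq ht h'] with z hz h1 h2 h3
  have hs : 0 < z.1.1 := (E.suppS_pos t ht hz.1).1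
  have hn : 0 < z.2.2.2 := E.suppN_pos t ht hz.2.2.2
  have e := h1.symm.trans h2
  rw [← hPL', ← hψ, ← h3] at e
  simp only [mul_assoc] at e
  exact Real.exp_injective (mul_right_cancel₀ (by positivity) e)

/-- The elasticities agree at the observations. -/
theorem log_deriv_ae_eq (hψ : θ.ψ t j = θ'.ψ t j') : ∀ᵐ z ∂Q,
    derivM θ t j z / outputAt θ t j z = derivM θ' t j' z / outputAt θ' t j' z ∧
      derivL θ t j z / outputAt θ t j z = derivL θ' t j' z / outputAt θ' t j' z := by
  have cε := h.exp_ε_eq ht h'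
  have cζ := h.exp_ζ_eq ht h'
  filter_upwards [h.ae_mem, h.share_m, h'.share_m, h.share_l, h'.share_l, h.output_pos,
    h'.output_pos, h.ε_ae_eq ht h', h.ζ_ae_eq ht h'] with z hz m m' l l' o o' e1 e2
  have hm : 0 < z.2.2.1 := E.suppM_pos t ht hz.2.2.1
  have hn : 0 < z.2.2.2 := E.suppN_pos t ht hz.2.2.2
  have pε := h.exp_ε_pos
  have pζ := h.exp_ζ_pos
  rw [← cε, ← e1] at m'
  rw [← cε, ← cζ, ← e1, ← e2, ← hψ] at l'
  rw [div_eq_div_iff o.ne' o'.ne', div_eq_div_iff o.ne' o'.ne']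
  constructor
  · refine mul_left_cancel₀ (mul_pos pε hm).ne' ?_
    linear_combination outputAt θ t j z * m' - outputAt θ' t j' z * m
  · have hp := mul_pos (mul_pos pε (Real.exp_pos (rζ z)))
      (mul_pos (Real.exp_pos (θ.ψ t j)) hn)
    refine mul_left_cancel₀ hp.ne' ?_
    linear_combination outputAt θ t j z * l' - outputAt θ' t j' z * l

/-- Productivity differs by the difference of log output net of productivity. -/
theorem ω_sub_ae_eq (hψ : θ.ψ t j = θ'.ψ t j') : ∀ᵐ z ∂Q,
    rω' z - rω z = Real.log (outputAt θ t j z) - Real.log (outputAt θ' t j' z) := by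
  have cε := h.exp_ε_eq ht h'
  filter_upwards [h.foc, h'.foc, h.log_deriv_ae_eq ht h' hψ, h.output_pos, h'.output_pos]
    with z f f' e o o'
  have hPM := E.PM_pos t ht
  have hPY := E.PY_pos t ht
  have pε := h.exp_ε_pos
  rw [← cε] at f'
  have hd : derivM θ t j z ≠ 0 := fun h0 => by
    rw [h0, mul_zero] at f
    exact hPM.ne f
  have e1 := (div_eq_div_iff o.ne' o'.ne').1 e.1
  -- The first-order condition fixes e^ω ∂F/∂M and the elasticities fix (∂F/∂M)/F; their quotient
  -- fixes e^ω F.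
  have e2 : Real.exp (rω z) * outputAt θ t j z = Real.exp (rω' z) * outputAt θ' t j' z := by
    refine mul_left_cancel₀ (mul_ne_zero (mul_pos hPY pε).ne' hd) ?_
    linear_combination outputAt θ t j z * f - outputAt θ t j z * f' -
      E.PY t * (∫ z, Real.exp (rε z) ∂Q) * Real.exp (rω' z) * e1
  have e3 := congrArg Real.log e2
  rw [Real.log_mul (Real.exp_pos _).ne' o.ne', Real.log_mul (Real.exp_pos _).ne' o'.ne',
    Real.log_exp, Real.log_exp] at e3
  linarith

end

end PeriodLaw

end Comparison

/-! ### Continuity of partial derivatives, and integration of logarithmic derivatives. -/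

section Elasticities

variable {F G : ℝ → ℝ → ℝ} {U V : Set ℝ}

theorem continuousOn_partial_left (hU : IsOpen U) (hV : IsOpen V)
    (hF : ContDiffOn ℝ 1 (fun p : ℝ × ℝ => F p.1 p.2) (U ×ˢ V)) :
    ContinuousOn (fun p : ℝ × ℝ => deriv (fun m => F m p.2) p.1) (U ×ˢ V) ∧
      ∀ m ∈ U, ∀ l ∈ V, DifferentiableAt ℝ (fun m' => F m' l) m := by
  have hd : ∀ p ∈ U ×ˢ V, HasDerivAt (fun m => F m p.2)
      (fderiv ℝ (fun p : ℝ × ℝ => F p.1 p.2) p (1, 0)) p.1 := by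
    intro p hp
    have h1 : HasFDerivAt (fun p : ℝ × ℝ => F p.1 p.2) _ p :=
      ((hF.differentiableOn (by norm_num)).differentiableAt
        ((hU.prod hV).mem_nhds hp)).hasFDerivAt
    exact HasFDerivAt.comp_hasDerivAt (f := fun m : ℝ => (m, p.2)) p.1 h1
      ((hasDerivAt_id p.1).prodMk (hasDerivAt_const p.1 p.2))
  refine ⟨?_, fun m hm l hl => (hd (m, l) ⟨hm, hl⟩).differentiableAt⟩
  refine ((hF.continuousOn_fderiv_of_isOpen (hU.prod hV) le_rfl).clm_apply
    (continuousOn_const (c := ((1 : ℝ), (0 : ℝ))))).congr fun p hp => (hd p hp).deriv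

theorem continuousOn_partial_right (hU : IsOpen U) (hV : IsOpen V)
    (hF : ContDiffOn ℝ 1 (fun p : ℝ × ℝ => F p.1 p.2) (U ×ˢ V)) :
    ContinuousOn (fun p : ℝ × ℝ => deriv (fun l => F p.1 l) p.2) (U ×ˢ V) ∧
      ∀ m ∈ U, ∀ l ∈ V, DifferentiableAt ℝ (fun l' => F m l') l := by
  have hd : ∀ p ∈ U ×ˢ V, HasDerivAt (fun l => F p.1 l)
      (fderiv ℝ (fun p : ℝ × ℝ => F p.1 p.2) p (0, 1)) p.2 := by
    intro p hp
    have h1 : HasFDerivAt (fun p : ℝ × ℝ => F p.1 p.2) _ p :=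
      ((hF.differentiableOn (by norm_num)).differentiableAt
        ((hU.prod hV).mem_nhds hp)).hasFDerivAt
    exact HasFDerivAt.comp_hasDerivAt (f := fun l : ℝ => (p.1, l)) p.2 h1
      ((hasDerivAt_const p.2 p.1).prodMk (hasDerivAt_id p.2))
  refine ⟨?_, fun m hm l hl => (hd (m, l) ⟨hm, hl⟩).differentiableAt⟩
  refine ((hF.continuousOn_fderiv_of_isOpen (hU.prod hV) le_rfl).clm_apply
    (continuousOn_const (c := ((0 : ℝ), (1 : ℝ))))).congr fun p hp => (hd p hp).deriv

/-- Functions of one variable with the same logarithmic derivative are proportional. -/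
theorem log_sub_log_const {f g : ℝ → ℝ} (hU : IsOpen U) (hU' : IsPreconnected U)
    (hf : ∀ x ∈ U, DifferentiableAt ℝ f x) (hg : ∀ x ∈ U, DifferentiableAt ℝ g x)
    (hf0 : ∀ x ∈ U, 0 < f x) (hg0 : ∀ x ∈ U, 0 < g x)
    (h : ∀ x ∈ U, deriv f x / f x = deriv g x / g x) {x y : ℝ} (hx : x ∈ U) (hy : y ∈ U) :
    Real.log (f x) - Real.log (g x) = Real.log (f y) - Real.log (g y) := by
  have hd : ∀ x ∈ U, HasDerivAt (fun x => Real.log (f x) - Real.log (g x))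
      (deriv f x / f x - deriv g x / g x) x := fun x hx =>
    ((hf x hx).hasDerivAt.log (hf0 x hx).ne').sub ((hg x hx).hasDerivAt.log (hg0 x hx).ne')
  refine hU.is_const_of_deriv_eq_zero (f := fun x => Real.log (f x) - Real.log (g x)) hU'
    (fun x hx => (hd x hx).differentiableAt.differentiableWithinAt) (fun x hx => ?_) hx hy
  rw [(hd x hx).deriv, h x hx, sub_self]
  rfl

end Elasticities

end FirmPanel

end

noncomputable section

namespace FirmPanel

/-! ### From elasticities to production functions, productivity and innovations. -/

section Components

variable {E : Env} {θ θ' : Theta E.J} {t : ℕ} {j j' : Fin E.J}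

theorem suppL_congr (hψ : θ.ψ t j = θ'.ψ t j') : suppL E θ t j = suppL E θ' t j' := by
  unfold suppL
  rw [hψ]

namespace PeriodLaw

variable {Q : Measure Obs} {rω rv rε rζ rω' rv' rε' rζ' : Obs → ℝ}
  (ht : t ∈ Icc 1 E.T) (h : PeriodLaw E θ t j Q rω rv rε rζ)
  (h' : PeriodLaw E θ' t j' Q rω' rv' rε' rζ') (hF : ProductionFunctions E θ)
  (hF' : ProductionFunctions E θ') (hψ : θ.ψ t j = θ'.ψ t j')
include ht h h' hF hF' hψ

/-- The logarithmic derivatives of the production function agree on the whole support. -/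
theorem log_deriv_eq : ∀ᵐ k ∂(volume.restrict (E.suppK t)),
    ∀ m ∈ E.suppM t, ∀ l ∈ suppL E θ t j,
      deriv (fun m' => θ.F t j k m' l) m / θ.F t j k m l =
        deriv (fun m' => θ'.F t j' k m' l) m / θ'.F t j' k m l ∧
      deriv (fun l' => θ.F t j k m l') l / θ.F t j k m l =
        deriv (fun l' => θ'.F t j' k m l') l / θ'.F t j' k m l := by
  have hae := ae_inputs_of_ae ht (p := fun x =>
    derivM θ t j ((0, 0), x) / outputAt θ t j ((0, 0), x) =
      derivM θ' t j' ((0, 0), x) / outputAt θ' t j' ((0, 0), x) ∧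
    derivL θ t j ((0, 0), x) / outputAt θ t j ((0, 0), x) =
      derivL θ' t j' ((0, 0), x) / outputAt θ' t j' ((0, 0), x))
    (h.restrict_absolutelyContinuous.ae_le (h.log_deriv_ae_eq ht h' hψ))
  have hM := E.suppM_open t ht
  have hN := E.suppN_open t ht
  have hL := isOpen_suppL E θ ht j
  filter_upwards [hae, ae_restrict_mem (E.suppK_open t ht).measurableSet] with k hk hkK
  -- Joint continuity in the flexible inputs, at a fixed capital level, upgrades the almost
  -- everywhere identity to all inputs. Labor is parametrized by workers, the coordinate in which
  -- that identity is known.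
  have cont : ∀ {G : ℝ → ℝ → ℝ}, (∀ p ∈ E.suppM t ×ˢ suppL E θ t j, 0 < G p.1 p.2) →
      ContDiffOn ℝ 1 (fun p : ℝ × ℝ => G p.1 p.2) (E.suppM t ×ˢ suppL E θ t j) →
      ContinuousOn (fun y : ℝ × ℝ =>
        (deriv (fun m => G m (Real.exp (θ.ψ t j) * y.2)) y.1 / G y.1 (Real.exp (θ.ψ t j) * y.2),
          deriv (fun l => G y.1 l) (Real.exp (θ.ψ t j) * y.2) /
            G y.1 (Real.exp (θ.ψ t j) * y.2))) (E.suppM t ×ˢ E.suppN t) := by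
    intro G hpos hG
    have c1 := (continuousOn_partial_left hM hL hG).1.div hG.continuousOn
      fun p hp => (hpos p hp).ne'
    have c2 := (continuousOn_partial_right hM hL hG).1.div hG.continuousOn
      fun p hp => (hpos p hp).ne'
    exact (c1.prodMk c2).comp (f := fun y : ℝ × ℝ => (y.1, Real.exp (θ.ψ t j) * y.2))
      (by fun_prop) fun y hy => ⟨hy.1, mem_image_of_mem _ hy.2⟩
  obtain ⟨p1, d1, -⟩ := (hF j t ht).2 k hkK
  obtain ⟨p2, d2, -⟩ := (hF' j' t ht).2 k hkK
  rw [← suppL_congr hψ] at p2 d2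
  have heq := Measure.eqOn_open_of_ae_eq (μ := (volume : Measure (ℝ × ℝ))) (by
    filter_upwards [hk] with y hy
    refine Prod.ext_iff.2 ⟨hy.1.trans ?_, hy.2.trans ?_⟩
    · simp only [derivM, outputAt, ← hψ]
    · simp only [derivL, outputAt, ← hψ]) (hM.prod hN) (cont p1 d1) (cont p2 d2)
  rintro m hm _ ⟨n, hn, rfl⟩
  have := heq (show (m, n) ∈ E.suppM t ×ˢ E.suppN t from ⟨hm, hn⟩)
  exact Prod.ext_iff.1 this

/-- The production functions are proportional, for each level of capital. -/
theorem log_output_sub_const {m₀ l₀ : ℝ} (hm₀ : m₀ ∈ E.suppM t) (hl₀ : l₀ ∈ suppL E θ t j) :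
    ∀ᵐ k ∂(volume.restrict (E.suppK t)), ∀ m ∈ E.suppM t, ∀ l ∈ suppL E θ t j,
      Real.log (θ.F t j k m l) - Real.log (θ'.F t j' k m l) =
        Real.log (θ.F t j k m₀ l₀) - Real.log (θ'.F t j' k m₀ l₀) := by
  have hM := E.suppM_open t ht
  have hL := isOpen_suppL E θ ht j
  have hLc : IsPreconnected (suppL E θ t j) :=
    (E.suppN_conn t ht).isPreconnected.image _ (by fun_prop)
  filter_upwards [h.log_deriv_eq ht h' hF hF' hψ,
    ae_restrict_mem (E.suppK_open t ht).measurableSet] with k hk hkK m hm l hl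
  obtain ⟨p1, d1, -⟩ := (hF j t ht).2 k hkK
  obtain ⟨p2, d2, -⟩ := (hF' j' t ht).2 k hkK
  rw [← suppL_congr hψ] at p2 d2
  refine (log_sub_log_const (f := fun m => θ.F t j k m l) (g := fun m => θ'.F t j' k m l) hM
    (E.suppM_conn t ht).isPreconnected
    (fun x hx => (continuousOn_partial_left hM hL d1).2 x hx l hl)
    (fun x hx => (continuousOn_partial_left hM hL d2).2 x hx l hl)
    (fun x hx => p1 (x, l) ⟨hx, hl⟩) (fun x hx => p2 (x, l) ⟨hx, hl⟩)
    (fun x hx => (hk x hx l hl).1) hm hm₀).trans ?_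
  exact log_sub_log_const (f := fun l => θ.F t j k m₀ l) (g := fun l => θ'.F t j' k m₀ l) hL hLc
    (fun x hx => (continuousOn_partial_right hM hL d1).2 m₀ hm₀ x hx)
    (fun x hx => (continuousOn_partial_right hM hL d2).2 m₀ hm₀ x hx)
    (fun x hx => p1 (m₀, x) ⟨hm₀, hx⟩) (fun x hx => p2 (m₀, x) ⟨hm₀, hx⟩)
    (fun x hx => (hk m₀ hm₀ x hx).2) hl hl₀

/-- From the second period on, productivity and the production function are determined. -/
theorem output_eq [IsProbabilityMeasure Q] {Q₂ : Measure (Obs × Obs)} {rω₀ rω₀' : Obs → ℝ}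
    (hQ₂ : IsProbabilityMeasure Q₂) (hfst : Q₂.map Prod.fst = Q)
    (mω₀ : Measurable rω₀) (mω₀' : Measurable rω₀') (hT : TransitionLaw E θ t j Q₂ rω rω₀)
    (hT' : TransitionLaw E θ' t j' Q₂ rω' rω₀') :
    (∀ᵐ k ∂(volume.restrict (E.suppK t)), ∀ m ∈ E.suppM t, ∀ l ∈ suppL E θ t j,
      θ.F t j k m l = θ'.F t j' k m l) ∧ rω =ᵐ[Q] rω' ∧
    (fun p => rω p.1 - θ.h t j (rω₀ p.2)) =ᵐ[Q₂] fun p => rω' p.1 - θ'.h t j' (rω₀' p.2) := by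
  obtain ⟨m₀, hm₀⟩ := (E.suppM_conn t ht).nonempty
  obtain ⟨n₀, hn₀⟩ := (E.suppN_conn t ht).nonempty
  have hl₀ : Real.exp (θ.ψ t j) * n₀ ∈ suppL E θ t j := mem_image_of_mem _ hn₀
  set l₀ := Real.exp (θ.ψ t j) * n₀
  have hlog := h.log_output_sub_const ht h' hF hF' hψ hm₀ hl₀
  let D : ℝ → ℝ := fun k => Real.log (θ.F t j k m₀ l₀) - Real.log (θ'.F t j' k m₀ l₀)
  have mD : Measurable D := by
    have mp : Measurable fun k : ℝ => ((k, m₀, l₀) : ℝ × ℝ × ℝ) := by fun_prop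
    exact (Real.measurable_log.comp ((hF j t ht).1.comp mp)).sub
      (Real.measurable_log.comp ((hF' j' t ht).1.comp mp))
  have mh := hT.measurable_h
  have mh' := hT'.measurable_h
  have mφ : Measurable fun p : Obs × Obs => (p.1.2.1, p.2) := by fun_prop
  -- productivity differs by a function of capital
  have hω : ∀ᵐ z ∂Q, rω' z - rω z = D z.2.1 := by
    filter_upwards [h.ω_sub_ae_eq ht h' hψ, h.absolutelyContinuous.ae_le (ae_of_ae_capital hlog),
      h.ae_mem] with z h1 h2 hz
    rw [h1]
    have h3 := h2 z.2.2.1 hz.2.2.1 _ (mem_image_of_mem _ hz.2.2.2)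
    simp only [outputAt, ← hψ]
    exact h3
  have hω₂ : ∀ᵐ p ∂Q₂, rω' p.1 - rω p.1 = D p.1.2.1 := by
    rw [← hfst] at hω
    exact ae_of_ae_map measurable_fst.aemeasurable hω
  -- the innovations agree
  have hη := ae_eq_of_centered mφ hT.integrable hT'.integrable hT.centered hT'.centered
    (d := fun x : ℝ × Obs => θ'.h t j' (rω₀' x.2) - θ.h t j (rω₀ x.2) - D x.1) (by fun_prop) (by
      filter_upwards [hω₂] with p hp
      rw [← hp]
      ring)
  -- With equal innovations, a function of the previous observation equals a function of current
  -- capital.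
  have hsep : ∀ᵐ x ∂(Q₂.map fun p => (p.1.2.1, p.2)),
      θ'.h t j' (rω₀' x.2) - θ.h t j (rω₀ x.2) = D x.1 := by
    refine (ae_map_iff mφ.aemeasurable (measurableSet_eq_fun (by fun_prop) (by fun_prop))).2 ?_
    filter_upwards [hω₂, hη] with p h1 h2
    linarith
  have hprod := hT.prod_absolutelyContinuous.ae_le hsep
  have hQs : IsProbabilityMeasure (Q₂.map Prod.snd) :=
    Measure.isProbabilityMeasure_map measurable_snd.aemeasurable
  have hswap : ∀ᵐ y ∂((Q₂.map Prod.snd).prod (volume.restrict (E.suppK t))),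
      θ'.h t j' (rω₀' y.1) - θ.h t j (rω₀ y.1) = D y.2 :=
    (Measure.measurePreserving_swap (μ := Q₂.map Prod.snd)
      (ν := volume.restrict (E.suppK t))).quasiMeasurePreserving.ae hprod
  -- Under a product measure such an equality forces constancy: one good previous observation
  -- already gives `D k = c` for almost every `k`.
  obtain ⟨z₀, hz₀⟩ := (Measure.ae_ae_of_ae_prod hswap).exists
  set c := θ'.h t j' (rω₀' z₀) - θ.h t j (rω₀ z₀)
  have hωc : ∀ᵐ z ∂Q, rω' z - rω z = c := by
    filter_upwards [hω, h.absolutelyContinuous.ae_le (ae_of_ae_capital hz₀)] with z h1 h2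
    rw [h1, ← h2]
  -- Productivity has mean zero in both models, which fixes the scale of the production function.
  have hc : c = 0 := by
    have h1 := integral_congr_ae hωc
    rw [integral_sub h'.integrable_ω h.integrable_ω, h.mean_ω, h'.mean_ω] at h1
    simpa using h1.symm
  refine ⟨?_, ?_, hη⟩
  · filter_upwards [hlog, hz₀, ae_restrict_mem (E.suppK_open t ht).measurableSet]
      with k h1 h2 hkK m hm l hl
    have p1 := ((hF j t ht).2 k hkK).1 (m, l) ⟨hm, hl⟩
    have p2 := ((hF' j' t ht).2 k hkK).1 (m, l) ⟨hm, by rwa [← suppL_congr hψ]⟩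
    have h3 : Real.log (θ.F t j k m l) - Real.log (θ'.F t j' k m l) = D k := h1 m hm l hl
    rw [show D k = 0 from h2.symm.trans hc] at h3
    exact Real.log_injOn_pos p1 p2 (sub_eq_zero.1 h3)
  · filter_upwards [hωc] with z hz
    rw [hc] at hz
    exact (sub_eq_zero.1 hz).symm

end PeriodLaw

end Components

end FirmPanel

end

/-! ### Assembly of all components of the structural parameter. -/

open MeasureTheory Set FirmPanel in
theorem proposition4 (E : Env) (hT : 4 ≤ E.T)
    (θ θ' : Theta E.J)
    {Ω : Type*} [MeasurableSpace Ω] (μ : Measure Ω) [IsProbabilityMeasure μ] (X : Vars E.J Ω)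
    {Ω' : Type*} [MeasurableSpace Ω'] (μ' : Measure Ω') [IsProbabilityMeasure μ']
    (X' : Vars E.J Ω')
    (hX : IsModel E θ μ X) (hX' : IsModel E θ' μ' X')
    (g : (Fin E.T → Obs) → ℝ) (hg : IsJointDensity E μ X g) (hg' : IsJointDensity E μ' X' g) :
    (∀ t ∈ Icc 1 E.T, θ.PL t = θ'.PL t) ∧
    ∃ σ : Equiv.Perm (Fin E.J), ∀ j,
      θ.prob j = θ'.prob (σ j) ∧
      (∀ t ∈ Icc 1 E.T,
        θ.gv t j =ᵐ[volume] θ'.gv t (σ j) ∧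
        θ.gεζ t j =ᵐ[volume] θ'.gεζ t (σ j) ∧
        θ.ψ t j = θ'.ψ t (σ j) ∧
        ∀ᵐ k ∂(volume.restrict (E.suppK t)), ∀ m ∈ E.suppM t, ∀ l ∈ suppL E θ t j,
          θ.ΓM t j k m l = θ'.ΓM t (σ j) k m l ∧ θ.ΓL t j k m l = θ'.ΓL t (σ j) k m l) ∧
      (∀ t ∈ Icc 2 E.T,
        ∀ᵐ k ∂(volume.restrict (E.suppK t)), ∀ m ∈ E.suppM t, ∀ l ∈ suppL E θ t j,
          θ.F t j k m l = θ'.F t (σ j) k m l) ∧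
      (∀ t ∈ Icc 3 E.T,
        (∀ᵐ w ∂((X.P μ j).map (X.ω (t - 1))), θ.h t j w = θ'.h t (σ j) w) ∧
        (∀ᵐ w ∂((X'.P μ' (σ j)).map (X'.ω (t - 1))), θ.h t j w = θ'.h t (σ j) w) ∧
        θ.gη t j =ᵐ[volume] θ'.gη t (σ j)) := by
  obtain ⟨σ, hσ⟩ := exists_relabeling hX hX' hT (hg.2.2.trans hg'.2.2.symm)
  have hP := hX.isProbabilityMeasure
  have hP' := hX'.isProbabilityMeasure
  have mZ := measurable_obs E X
  have mZ' := measurable_obs E X'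
  have hpair := fun j t ht => (hσ j).2 t ht
  have hone : ∀ j, ∀ t ∈ Icc 1 E.T,
      (X.P μ j).map (obs E X t) = (X'.P μ' (σ j)).map (obs E X' t) := by
    intro j t ht
    rcases eq_or_lt_of_le ht.1 with rfl | h2
    · have := congrArg (Measure.map Prod.snd) (hpair j 2 ⟨le_rfl, by omega⟩)
      rwa [Measure.map_map measurable_snd ((mZ _).prodMk (mZ _)),
        Measure.map_map measurable_snd ((mZ' _).prodMk (mZ' _))] at this
    · have := congrArg (Measure.map Prod.fst) (hpair j t ⟨h2, ht.2⟩)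
      rwa [Measure.map_map measurable_fst ((mZ _).prodMk (mZ _)),
        Measure.map_map measurable_fst ((mZ' _).prodMk (mZ' _))] at this
  have hQ : ∀ j t, IsProbabilityMeasure ((X.P μ j).map (obs E X t)) := fun j t =>
    Measure.isProbabilityMeasure_map (mZ t).aemeasurable
  have law' : ∀ j, ∀ t ∈ Icc 1 E.T, ∃ rω rv rε rζ : Obs → ℝ,
      PeriodLaw E θ' t (σ j) ((X.P μ j).map (obs E X t)) rω rv rε rζ ∧
      ∀ᵐ o ∂(X'.P μ' (σ j)), X'.ω t o = rω (obs E X' t o) := by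
    intro j t ht
    rw [hone j t ht]
    exact hX'.exists_periodLaw (σ j) ht
  have hwage : ∀ j, ∀ t ∈ Icc 1 E.T,
      θ.PL t * Real.exp (θ.ψ t j) = θ'.PL t * Real.exp (θ'.ψ t (σ j)) := by
    intro j t ht
    obtain ⟨rω, rv, rε, rζ, h, -⟩ := hX.exists_periodLaw j ht
    obtain ⟨rω', rv', rε', rζ', h', -⟩ := law' j t ht
    exact h.log_wage_eq ht h' (hX.wages t ht).1 (hX'.wages t ht).1
  have hPL : ∀ t ∈ Icc 1 E.T, θ.PL t = θ'.PL t := by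
    intro t ht
    have h1 := (hX.wages t ht).2
    have h2 := (hX'.wages t ht).2
    -- The quality normalization makes P_L the type average of P_L e^ψ, which is already matched and
    -- does not depend on the labeling.
    calc θ.PL t = ∑ j, θ.prob j * (θ.PL t * Real.exp (θ.ψ t j)) := by
          simp only [mul_left_comm _ (θ.PL t)]
          rw [← Finset.mul_sum, h1, mul_one]
      _ = ∑ j, θ'.prob (σ j) * (θ'.PL t * Real.exp (θ'.ψ t (σ j))) :=
          Finset.sum_congr rfl fun j _ => by rw [hwage j t ht, (hσ j).1]
      _ = ∑ j, θ'.prob j * (θ'.PL t * Real.exp (θ'.ψ t j)) :=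
          Equiv.sum_comp σ fun j => θ'.prob j * (θ'.PL t * Real.exp (θ'.ψ t j))
      _ = θ'.PL t := by
          simp only [mul_left_comm _ (θ'.PL t)]
          rw [← Finset.mul_sum, h2, mul_one]
  have hψ : ∀ j, ∀ t ∈ Icc 1 E.T, θ.ψ t j = θ'.ψ t (σ j) := by
    intro j t ht
    have h1 := hwage j t ht
    rw [hPL t ht] at h1
    exact Real.exp_injective (mul_left_cancel₀ (hX'.wages t ht).1.ne' h1)
  -- The functions representing productivity are arguments, so that applications at two successive
  -- periods can use the same representation of lagged productivity.
  have hmain : ∀ j, ∀ t ∈ Icc 2 E.T, ∀ rω rω' rω₀ rω₀' : Obs → ℝ,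
      (∃ rv rε rζ, PeriodLaw E θ t j ((X.P μ j).map (obs E X t)) rω rv rε rζ) →
      (∃ rv rε rζ, PeriodLaw E θ' t (σ j) ((X.P μ j).map (obs E X t)) rω' rv rε rζ) →
      Measurable rω₀ → Measurable rω₀' →
      (∀ᵐ o ∂(X.P μ j), X.ω t o = rω (obs E X t o)) →
      (∀ᵐ o ∂(X'.P μ' (σ j)), X'.ω t o = rω' (obs E X' t o)) →
      (∀ᵐ o ∂(X.P μ j), X.ω (t - 1) o = rω₀ (obs E X (t - 1) o)) →
      (∀ᵐ o ∂(X'.P μ' (σ j)), X'.ω (t - 1) o = rω₀' (obs E X' (t - 1) o)) →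
      (∀ᵐ k ∂(volume.restrict (E.suppK t)), ∀ m ∈ E.suppM t, ∀ l ∈ suppL E θ t j,
        θ.F t j k m l = θ'.F t (σ j) k m l) ∧
      rω =ᵐ[(X.P μ j).map (obs E X t)] rω' ∧
      (fun p => rω p.1 - θ.h t j (rω₀ p.2)) =ᵐ[(X.P μ j).map
        (fun o => (obs E X t o, obs E X (t - 1) o))]
        (fun p => rω' p.1 - θ'.h t (σ j) (rω₀' p.2)) ∧
      θ.gη t j =ᵐ[volume] θ'.gη t (σ j) ∧ Measurable (θ.h t j) ∧ Measurable (θ'.h t (σ j)) := by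
    rintro j t ht rω rω' rω₀ rω₀' ⟨rv, rε, rζ, h⟩ ⟨rv', rε', rζ', h'⟩ m₀ m₀' a a' a₀ a₀'
    have tr := hX.transitionLaw j ht h.measurable_ω m₀ a a₀
    have tr' := hX'.transitionLaw (σ j) ht h'.measurable_ω m₀' a' a₀'
    rw [← hpair j t ht] at tr'
    have hQ₂ : IsProbabilityMeasure
        ((X.P μ j).map (fun o => (obs E X t o, obs E X (t - 1) o))) :=
      Measure.isProbabilityMeasure_map ((mZ _).prodMk (mZ _)).aemeasurable
    obtain ⟨c1, c2, c3⟩ := h.output_eq (periods_of_two ht) h' hX.production hX'.production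
      (hψ j t (periods_of_two ht)) hQ₂
      (Measure.map_map measurable_fst ((mZ _).prodMk (mZ _))) m₀ m₀' tr tr'
    refine ⟨c1, c2, c3, ?_, tr.measurable_h, tr'.measurable_h⟩
    have d := tr.density
    rw [Measure.map_congr c3] at d
    exact d.ae_eq tr'.density
  refine ⟨hPL, σ, fun j => ⟨(hσ j).1, fun t ht => ?_, fun t ht => ?_, fun t ht => ?_⟩⟩
  · obtain ⟨rω, rv, rε, rζ, h, -⟩ := hX.exists_periodLaw j ht
    obtain ⟨rω', rv', rε', rζ', h', -⟩ := law' j t ht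
    refine ⟨?_, ?_, hψ j t ht, ?_⟩
    · have d := h.density_v
      rw [Measure.map_congr (h.v_ae_eq ht h' (hX.wages t ht).1 (hPL t ht) (hψ j t ht))] at d
      exact d.ae_eq h'.density_v
    · have d := h.density_εζ
      have e : (fun z => (rε z, rζ z)) =ᵐ[(X.P μ j).map (obs E X t)] fun z => (rε' z, rζ' z) := by
        filter_upwards [h.ε_ae_eq ht h', h.ζ_ae_eq ht h'] with z h1 h2
        rw [h1, h2]
      rw [Measure.map_congr e] at d
      exact d.ae_eq h'.density_εζ
    · filter_upwards [h.log_deriv_eq ht h' hX.production hX'.production (hψ j t ht)]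
        with k hk m hm l hl
      obtain ⟨h1, h2⟩ := hk m hm l hl
      simp only [Theta.ΓM, Theta.ΓL, mul_div_right_comm]
      rw [h1, h2]
      exact ⟨rfl, rfl⟩
  · obtain ⟨rω, rv, rε, rζ, h, a⟩ := hX.exists_periodLaw j (periods_of_two ht)
    obtain ⟨rω', rv', rε', rζ', h', a'⟩ := law' j t (periods_of_two ht)
    obtain ⟨rω₀, _, _, _, h₀, a₀⟩ := hX.exists_periodLaw j (one_mem_periods ht)
    obtain ⟨rω₀', _, _, _, h₀', a₀'⟩ := law' j (t - 1) (one_mem_periods ht)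
    exact (hmain j t ht rω rω' rω₀ rω₀' ⟨_, _, _, h⟩ ⟨_, _, _, h'⟩ h₀.measurable_ω
      h₀'.measurable_ω a a' a₀ a₀').1
  · have ht2 : t ∈ Icc 2 E.T := ⟨by have := ht.1; omega, ht.2⟩
    have ht1 : t - 1 ∈ Icc 2 E.T := ⟨by have := ht.1; omega, by have := ht.2; omega⟩
    obtain ⟨rω, rv, rε, rζ, h, a⟩ := hX.exists_periodLaw j (periods_of_two ht2)
    obtain ⟨rω', rv', rε', rζ', h', a'⟩ := law' j t (periods_of_two ht2)
    obtain ⟨rω₀, _, _, _, h₀, a₀⟩ := hX.exists_periodLaw j (one_mem_periods ht2)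
    obtain ⟨rω₀', _, _, _, h₀', a₀'⟩ := law' j (t - 1) (one_mem_periods ht2)
    obtain ⟨rω₁, _, _, _, h₁, a₁⟩ := hX.exists_periodLaw j (one_mem_periods ht1)
    obtain ⟨rω₁', _, _, _, h₁', a₁'⟩ := law' j (t - 1 - 1) (one_mem_periods ht1)
    obtain ⟨-, e, eη, hη, mh, mh'⟩ := hmain j t ht2 rω rω' rω₀ rω₀' ⟨_, _, _, h⟩ ⟨_, _, _, h'⟩
      h₀.measurable_ω h₀'.measurable_ω a a' a₀ a₀'
    obtain ⟨-, e₀, -⟩ := hmain j (t - 1) ht1 rω₀ rω₀' rω₁ rω₁' ⟨_, _, _, h₀⟩ ⟨_, _, _, h₀'⟩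
      h₁.measurable_ω h₁'.measurable_ω a₀ a₀' a₁ a₁'
    have hset : MeasurableSet {w | θ.h t j w = θ'.h t (σ j) w} := measurableSet_eq_fun mh mh'
    -- Innovations and productivity agree at t, and productivity agrees at t - 1, which is at least
    -- 2; so the two functions h coincide along lagged productivity.
    have key : ∀ᵐ z ∂((X.P μ j).map (obs E X (t - 1))),
        θ.h t j (rω₀ z) = θ'.h t (σ j) (rω₀ z) := by
      have mset : MeasurableSet {z | θ.h t j (rω₀ z) = θ'.h t (σ j) (rω₀ z)} :=
        h₀.measurable_ω hset
      refine (ae_map_iff (mZ _).aemeasurable mset).2 ?_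
      filter_upwards [ae_of_ae_map (mZ _).aemeasurable e, ae_of_ae_map (mZ _).aemeasurable e₀,
        ae_of_ae_map ((mZ _).prodMk (mZ _)).aemeasurable eη] with o h1 h2 h3
      have h3' : rω (obs E X t o) - θ.h t j (rω₀ (obs E X (t - 1) o)) =
          rω' (obs E X t o) - θ'.h t (σ j) (rω₀' (obs E X (t - 1) o)) := h3
      rw [← h1, ← h2] at h3'
      linarith
    refine ⟨?_, ?_, hη⟩
    · refine (ae_map_iff (X.ω_meas _).aemeasurable hset).2 ?_
      filter_upwards [a₀, ae_of_ae_map (mZ _).aemeasurable key] with o h1 h2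
      rw [h1]
      exact h2
    · refine (ae_map_iff (X'.ω_meas _).aemeasurable hset).2 ?_
      rw [hone j (t - 1) (one_mem_periods ht2)] at key e₀
      filter_upwards [a₀', ae_of_ae_map (mZ' _).aemeasurable key,
        ae_of_ae_map (mZ' _).aemeasurable e₀] with o h1 h2 h3
      rw [h1, ← h3]
      exact h2
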